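/- **Setting.** Let $0<p<1$, $N=1/(1-p)$. Consider the resonant system $i\dot\alpha_j=\sum_{S\ge j}\sum_{k=0}^S C^S_{jk}\,\bar\alpha_{S-j}\alpha_k\alpha_{S-k}$ with Gaussian couplings of covariance $\langle C^S_{jk}C^{S'}_{j'k'}\rangle=\frac{\delta_{SS'}}8\sum(\text{the eight products of two Kronecker deltas identifying } \{j,S-j,k,S-k\} \text{ with } \{j',S'-j',k',S'-k'\} \text{ compatibly with } x\leftrightarrow S-x)$ and independent complex Gaussian initial data with $\langle\alpha_j(0)\bar\alpha_{j'}(0)\rangle=\delta_{jj'}p^j/N$. Solving by trees and applying Wick's theorem expands the averaged Sobolev norm $\bar S_\gamma(t)=\sum_{r\ge0} r^\gamma\langle|\alpha_r(t)|^2\rangle$ ($\gamma\ge0$), as a formal power series in $t$, over graphs: $$\bar S_\gamma(t)=\sum_{n\ \mathrm{even}}t^n\,\bar s_{\gamma,n},\qquad \bar s_{\gamma,n}=\sum_{G\text{ of order }n} s_\gamma(G),\qquad s_\gamma(G)=\frac{8^{-n/2}}{n!}\,\epsilon(U)\sum_{r\ge0}\frac{r^\gamma}{N}\,\mathcal A_r(G).$$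 This graph expansion is the definition of $\bar s_{\gamma,n}$ used here. *Graphs.* A graph of order $n$ is $G=(U,w,w')$. $U$ is a heap-ordered plane ternary tree with a bivalent root and $n$ true vertices labelled $1,\dots,n$, labels increasing from parent to child; each true vertex $v$ has a parent half-edge $e_1(v)$ and ordered child half-edges $e_2(v),e_3(v),e_4(v)$. Of the two half-edges of the root, one has type $\alpha$ and one type $\bar\alpha$; a true vertex has the type of the half-edge to which its parent-edge is attached; $e_3,e_4$ have the type of their vertex and $e_2$ the conjugate type. The free half-edges of type $\alpha$ (resp. $\bar\alpha$) are the leaves (resp. anti-leaves). $w$ is a bijection from leaves to anti-leaves (the dashed edges; the parent-edges of the true vertices are the solid edges). $w'$ is a partition of the true vertices into pairs (the wavy edges), with one of the eight products of deltas (the propagator) for each pair. The sign $\epsilon(U)$ is the product over true vertices of $-i$ (type $\alpha$) or $+i$ (type $\bar\alpha$). *Amplitude.* $\mathcal A_r(G)=N^{-n}\sum\prod_{e\text{ dashed}}p^{j_e}$, summed over all integers $S_v\ge0$, $0\le j_v,k_v\le S_v$ such that, with momenta $j_v,S_v-j_v,k_v,S_v-k_v$ on $e_1(v),\dots,e_4(v)$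 and momentum $r$ on both half-edges of the root, the two momenta of each solid and of each dashed edge agree and the deltas of all propagators are satisfied; $j_e$ is the momentum of $e$. *Degree.* Each propagator joins the four half-edges of one of its vertices to those of the other by four corners, which form one 8-valent node. The faces of $G$ are the closed loops made of solid edges, dashed edges, corners, and the passage through the root. Let $F$ be their number, $R$ the rank of the node–face incidence matrix of the equations $i_1+i_2=i_3+i_4$, where $i_1,\dots,i_4$ are the momenta of the faces through the corners with momenta $j,S-j,k,S-k$ of the node, and $d(G)=n-(F-R-1)$. *Melonic graphs.* An elementary two-point melon consists of two true vertices $x,y$ of a wavy edge, joined by three solid or dashed edges each of which joins two half-edges identified by the propagator, and of two external half-edges, namely: (I) $e_2(x)e_2(y)$ and $\{e_3,e_4\}(x)$–$\{e_3,e_4\}(y)$ are dashed, and the external half-edges are $e_1(x),e_1(y)$; (II) $y$ is the child of $x$ along $e_2(x)$, $\{e_3,e_4\}(x)$–$\{e_3,e_4\}(y)$ are dashed, and the external ones are $e_1(x),e_2(y)$; (III) $y$ is the child of $x$ along one of $e_3(x),e_4(x)$, the external ones are $e_1(x)$ and one of $e_3(y),e_4(y)$, $e_2(x)$ is dashed to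 the other one of $e_3(y),e_4(y)$, and $e_2(y)$ is dashed to the other one of $e_3(x),e_4(x)$; the external half-edges are likewise identified by the propagator. A melonic insertion replaces a dashed edge by such a melon of type I, II or III, or a solid edge by one of type II or III. A graph is melonic if it arises from the trivial graph of order $0$ by a sequence of melonic insertions. Call $G$ of order $n$ dominant for $\bar S_\gamma$ if $s_\gamma(H)=O(s_\gamma(G))$ as $p\to1$ for every graph $H$ of order $n$. Put $s^{melo}_{\gamma,n}=\sum_{G\text{ melonic of order }n}s_\gamma(G)$, $G_2^{melo}(r,t)=\sum_{n\text{ even}}\frac{t^n}{n!}8^{-n/2}\sum_{G\text{ melonic of order }n}\epsilon(U)\mathcal A_r(G)$ and $S^{melo}_\gamma(t)=\sum_{r\ge0}\frac{r^\gamma}N G_2^{melo}(r,t)$. **Theorem 1.** The dominant graphs as $N\to\infty$ (i.e. $p\to1^-$) for the averaged Sobolev norm are exactly the melonic graphs, and $S^{melo}_\gamma(t)$ is analytic in a disk $|t|<\rho$. Precisely: 1. For every graph, $d(G)\ge0$; if $G$ is melonic then $d(G)=0$; if $G$ is not melonic then $d(G)>0$. 2. For every graph, the sum defining $\mathcal A_r(G)$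 converges for $0<p<1$, and for fixed $G$ and $r$, $\mathcal A_r(G)=O(N^{-d(G)})$ as $p\to1^-$. 3. If $G$ is melonic of order $n$, then for all $r\ge0$ and $0<p<1$: $\ (2n+1)^{-n}p^{(2n+1)r}\le\mathcal A_r(G)\le4^np^{r/2}$. 4. For every $\gamma\ge0$ and every graph $G$, the sum over $r$ defining $s_\gamma(G)$ converges for $0<p<1$, and $s_\gamma(G)=O(N^{\gamma-d(G)})$; if $G$ is melonic, $s_\gamma(G)$ is exactly of order $N^\gamma$; and $G$ is dominant for $\bar S_\gamma$ if and only if it is melonic. 5. For all $\gamma\ge0$ and $n$: $\ \bar s_{\gamma,n}=s^{melo}_{\gamma,n}+O(N^{\gamma-1})$ as $p\to1^-$. 6. There is a constant $K$ such that for every $n$ there are at most $K^n\,n!$ melonic graphs of order $n$. 7. There is $\rho>0$ such that for all $\gamma\ge0$, $0<p<1$ and complex $|t|<\rho$ the series defining $G_2^{melo}(r,t)$ and $S_\gamma^{melo}(t)$ converge, $S^{melo}_\gamma(t)=\sum_{n\text{ even}}s^{melo}_{\gamma,n}t^n$, and $t\mapsto S^{melo}_\gamma(t)$ is analytic on the disk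 $|t|<\rho$. -/

import Mathlib

open Filter Topology Asymptotics

namespace MelonicTurbulence

/-! ### Heap-ordered 2-rooted ternary trees -/

/-- The places of a 2-rooted ternary tree with true vertices `1, ..., n` (here `Fin n`) to which a
true vertex or a leaf can be attached: `inl true` is the half-edge of the root on the tree side
(it carries `α`), `inl false` the half-edge of the root on the anti-tree side (it carries the
conjugate `ᾱ`), and `inr (v, 0)`, `inr (v, 1)`, `inr (v, 2)` are the child half-edges
`e₂(v)`, `e₃(v)`, `e₄(v)` of the true vertex `v`. -/
abbrev Slot (n : ℕ) : Type := Bool ⊕ (Fin n × Fin 3)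

/-- A heap-ordered 3-ary 2-rooted plane tree with `n` true vertices. The vertices are named by
their heap labels, `parent v` is the place to which the parent-edge of `v` is attached, and labels
increase from a parent to its children. -/
@[ext]
structure HeapTree (n : ℕ) where
  parent : Fin n → Slot n
  parent_injective : Function.Injective parent
  heap : ∀ (v u : Fin n) (a : Fin 3), parent v = Sum.inr (u, a) → u < v

namespace HeapTree

variable {n : ℕ} (T : HeapTree n)

/-- The type of a true vertex: `true` if it differentiates a factor `α` (its parent-edge is
in-going at the vertex), `false` if it differentiates a factor `ᾱ`. The child `e₂` carries the
conjugate type of its vertex, the children `e₃`, `e₄` carry the type of the vertex. -/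
def vertexType (v : Fin n) : Bool :=
  match h : T.parent v with
  | Sum.inl b => b
  | Sum.inr (u, a) => if a = 0 then !(vertexType u) else vertexType u
termination_by v
decreasing_by all_goals exact T.heap v u a h

/-- `true` if a place carries a factor `α` (out-going), `false` if it carries `ᾱ` (in-going). -/
def slotType : Slot n → Bool
  | Sum.inl b => b
  | Sum.inr (u, a) => if a = 0 then !(T.vertexType u) else T.vertexType u

/-- The leaves: the free places that carry `α`. -/
def Leaf : Type := {s : Slot n // s ∉ Set.range T.parent ∧ T.slotType s = true}

/-- The anti-leaves: the free places that carry `ᾱ`. -/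
def AntiLeaf : Type := {s : Slot n // s ∉ Set.range T.parent ∧ T.slotType s = false}

instance : Finite T.Leaf := inferInstanceAs (Finite {_s : Slot n // _})

instance : Finite T.AntiLeaf := inferInstanceAs (Finite {_s : Slot n // _})

noncomputable instance : Fintype T.Leaf := Fintype.ofFinite _

/-- The factor `ε(U)`: a true vertex with in-going parent-edge has weight `-i`, a true vertex with
out-going parent-edge has weight `i`. -/
noncomputable def sign : ℂ :=
  ∏ v : Fin n, if T.vertexType v = true then -Complex.I else Complex.I

end HeapTree

/-! ### Graphs -/

/-- The four half-edges `e₁(v), e₂(v), e₃(v), e₄(v)` of a true vertex are numbered `0, 1, 2, 3`;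
they carry the momenta `j, S - j, k, S - k`. `complement` is the exchange `x ↔ S - x`. -/
def complement : Equiv.Perm (Fin 4) := Equiv.swap 0 1 * Equiv.swap 2 3

/-- A graph `G = (U, w, w')` of order `n`. `pairing` is the Wick contraction of leaves with
anti-leaves (dashed edges). `wavy` pairs the true vertices (wavy edges), and the propagator of the
wavy edge `{v, wavy v}` is the identification of each of the momenta `j, S - j, k, S - k` at `v`
with one of those at `wavy v`. The identifications that are compatible with `x ↔ S - x` are exactly
the eight terms of the covariance of the couplings. -/
structure Graph (n : ℕ) where
  tree : HeapTree n
  pairing : tree.Leaf ≃ tree.AntiLeaf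
  wavy : Fin n → Fin n
  wavy_wavy : ∀ v, wavy (wavy v) = v
  wavy_ne : ∀ v, wavy v ≠ v
  propagator : Fin n → Equiv.Perm (Fin 4)
  propagator_complement : ∀ v a, propagator v (complement a) = complement (propagator v a)
  propagator_wavy : ∀ v, propagator (wavy v) = (propagator v)⁻¹

instance (n : ℕ) : Finite (HeapTree n) :=
  Finite.of_injective (fun T : HeapTree n => T.parent) fun _ _ h => HeapTree.ext h

instance (n : ℕ) : Finite (Graph n) := by
  have : ∀ T : HeapTree n, Finite (T.Leaf ≃ T.AntiLeaf) := fun T => inferInstance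
  refine Finite.of_injective
    (β := (Σ T : HeapTree n, (T.Leaf ≃ T.AntiLeaf)) × (Fin n → Fin n) ×
      (Fin n → Equiv.Perm (Fin 4)))
    (fun G => (⟨G.tree, G.pairing⟩, G.wavy, G.propagator)) ?_
  rintro ⟨T, w, k, _, _, s, _, _⟩ ⟨T', w', k', _, _, s', _, _⟩ h
  simp only [Prod.mk.injEq, Sigma.mk.injEq] at h
  obtain ⟨⟨rfl, h1⟩, rfl, rfl⟩ := h
  obtain rfl := eq_of_heq h1
  rfl

noncomputable instance (n : ℕ) : Fintype (Graph n) := Fintype.ofFinite _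

/-! ### Momenta and amplitudes -/

/-- The three integers `S, j, k` attached to a true vertex. -/
structure Momentum where
  S : ℕ
  j : ℕ
  k : ℕ

/-- The momenta `j, S - j, k, S - k` of the four half-edges of a true vertex. -/
def Momentum.halfEdge (m : Momentum) : Fin 4 → ℕ := ![m.j, m.S - m.j, m.k, m.S - m.k]

/-- The momentum at a place of the tree, when the root has momentum `r`. -/
def slotMomentum {n : ℕ} (r : ℕ) (m : Fin n → Momentum) : Slot n → ℕ
  | Sum.inl _ => r
  | Sum.inr (v, a) => (m v).halfEdge a.succ

/-- The number `N = 1 / (1 - p)` of initially excited modes. -/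
noncomputable def modeNumber (p : ℝ) : ℝ := 1 / (1 - p)

namespace Graph

variable {n : ℕ} (G : Graph n)

/-- The momentum attributions with root momentum `r` that satisfy all constraints:
`j, k ≤ S` at each true vertex, equality of the two momenta of each solid edge, the product of
deltas of the propagator on each wavy edge, equality of the two momenta of each dashed edge. -/
structure Admissible (r : ℕ) (m : Fin n → Momentum) : Prop where
  j_le : ∀ v, (m v).j ≤ (m v).S
  k_le : ∀ v, (m v).k ≤ (m v).S
  solid : ∀ v, (m v).j = slotMomentum r m (G.tree.parent v)
  wavy_S : ∀ v, (m v).S = (m (G.wavy v)).S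
  wavy_eq : ∀ v a, (m v).halfEdge a = (m (G.wavy v)).halfEdge (G.propagator v a)
  dashed : ∀ l : G.tree.Leaf, slotMomentum r m l.1 = slotMomentum r m (G.pairing l).1

/-- The weight `∏ p ^ j_e` over the dashed edges `e`. -/
noncomputable def weight (r : ℕ) (p : ℝ) (m : Fin n → Momentum) : ℝ :=
  ∏ l : G.tree.Leaf, p ^ slotMomentum r m l.1

/-- The amplitude `A_r(G)`. -/
noncomputable def amplitude (r : ℕ) (p : ℝ) : ℝ :=
  1 / modeNumber p ^ n * ∑' m : {m : Fin n → Momentum // G.Admissible r m}, G.weight r p m.1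

/-! ### Faces and degree -/

/-- A place of the tree as a half-edge: the half-edges are the two half-edges of the root
and the four half-edges of each true vertex. -/
def slotHalfEdge : Slot n → Bool ⊕ (Fin n × Fin 4)
  | Sum.inl b => Sum.inl b
  | Sum.inr (v, a) => Sum.inr (v, a.succ)

/-- Two half-edges that follow each other on a strand of the stranded graph: the two ends of a
solid edge, the two ends of a dashed edge, two half-edges joined by a corner of an 8-valent node,
or the two half-edges of the root. -/
inductive Strand : Bool ⊕ (Fin n × Fin 4) → Bool ⊕ (Fin n × Fin 4) → Prop
  | solid (v : Fin n) : Strand (slotHalfEdge (G.tree.parent v)) (Sum.inr (v, 0))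
  | dashed (l : G.tree.Leaf) : Strand (slotHalfEdge l.1) (slotHalfEdge (G.pairing l).1)
  | corner (v : Fin n) (a : Fin 4) :
      Strand (Sum.inr (v, a)) (Sum.inr (G.wavy v, G.propagator v a))
  | root : Strand (Sum.inl true) (Sum.inl false)

/-- The faces: the closed loops formed by the strands. -/
def Face : Type := Quot G.Strand

instance : Finite G.Face := inferInstanceAs (Finite (Quot G.Strand))

noncomputable instance : Fintype G.Face := Fintype.ofFinite _

/-- The number `F` of faces. -/
noncomputable def faceCount : ℕ := Nat.card G.Face

/-- The 8-valent nodes of the stranded graph, i.e. the wavy edges; each one is represented by its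
true vertex with the smaller label. -/
def Node : Type := {v : Fin n // v < G.wavy v}

open Classical in
/-- The incidence matrix between nodes and faces of the linear system of momentum conservation
`j + (S - j) = k + (S - k)` at the nodes, in terms of the face momenta. -/
noncomputable def incidence : Matrix G.Node G.Face ℚ := fun v f =>
  ∑ a : Fin 4, (![1, 1, -1, -1] : Fin 4 → ℚ) a *
    if Quot.mk G.Strand (Sum.inr (v.1, a)) = f then 1 else 0

/-- The number `I = F - R - 1`, where `R` is the rank of the incidence matrix. -/
noncomputable def independentFaces : ℤ := (G.faceCount : ℤ) - (G.incidence.rank : ℤ) - 1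

/-- The degree `d(G) = n - I`. -/
noncomputable def degree : ℤ := (n : ℤ) - G.independentFaces

/-- `G.Dashed s t`: a dashed edge joins the places `s` and `t`. -/
def Dashed (s t : Slot n) : Prop :=
  ∃ l : G.tree.Leaf, (s = l.1 ∧ t = (G.pairing l).1) ∨ (t = l.1 ∧ s = (G.pairing l).1)

end Graph

/-! ### Melonic graphs -/

/-- The child half-edges `e₃` and `e₄`. -/
def upper : Bool → Fin 3
  | false => 1
  | true => 2

/-- Renaming of vertices on places. -/
def Slot.rename {n k : ℕ} (f : Fin n → Fin k) : Slot n → Slot k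
  | Sum.inl b => Sum.inl b
  | Sum.inr (v, a) => Sum.inr (f v, a)

section Melons

variable {n : ℕ} (G : Graph n) (G' : Graph (n + 2)) (f : Fin n ↪o Fin (n + 2))
  (x y : Fin (n + 2))

/-- The true vertices of `G'` are those of `G` (with the induced heap order) and two new ones,
`x` and `y`, joined by a wavy edge; the other wavy edges and their propagators are those of `G`. -/
structure AddsPair : Prop where
  ne_x : ∀ v, f v ≠ x
  ne_y : ∀ v, f v ≠ y
  wavy_new : G'.wavy x = y
  wavy_old : ∀ v, G'.wavy (f v) = f (G.wavy v)
  propagator_old : ∀ v, G'.propagator (f v) = G.propagator v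

/-- The solid edges and the dashed edges of `G`, other than the dashed edge `{s, t}`, are
edges of `G'`. -/
structure ReplacesDashed (s t : Slot n) : Prop where
  edge : G.Dashed s t
  solid_old : ∀ v, G'.tree.parent (f v) = Slot.rename f (G.tree.parent v)
  dashed_old : ∀ s' t', G.Dashed s' t' → s' ≠ s → s' ≠ t →
    G'.Dashed (Slot.rename f s') (Slot.rename f t')

/-- The solid edges of `G`, other than the parent-edge of `u`, and the dashed edges of `G` are
edges of `G'`. -/
structure ReplacesSolid (u : Fin n) : Prop where
  solid_old : ∀ v, v ≠ u → G'.tree.parent (f v) = Slot.rename f (G.tree.parent v)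
  dashed_old : ∀ s' t', G.Dashed s' t' → G'.Dashed (Slot.rename f s') (Slot.rename f t')

/-- The interior of an elementary two-point melon of type I with true vertices `x`, `y`; the
external half-edges are the two parent-edges. For `b = true` the edges from `e₃`, `e₄` are
crossed. The propagator is the leading one. -/
structure InteriorI (b : Bool) : Prop where
  dashed_lower : G'.Dashed (Sum.inr (x, 0)) (Sum.inr (y, 0))
  dashed_upper : ∀ c, G'.Dashed (Sum.inr (x, upper c)) (Sum.inr (y, upper (xor c b)))
  lead_zero : G'.propagator x 0 = 0
  lead_one : G'.propagator x 1 = 1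
  lead_upper : ∀ c, G'.propagator x (upper c).succ = (upper (xor c b)).succ

/-- The interior of an elementary two-point melon of type II: `y` is the child of `x` along
`e₂(x)`; the external half-edges are `e₁(x)` and `e₂(y)`. -/
structure InteriorII (b : Bool) : Prop where
  solid : G'.tree.parent y = Sum.inr (x, 0)
  dashed_upper : ∀ c, G'.Dashed (Sum.inr (x, upper c)) (Sum.inr (y, upper (xor c b)))
  lead_zero : G'.propagator x 0 = 1
  lead_one : G'.propagator x 1 = 0
  lead_upper : ∀ c, G'.propagator x (upper c).succ = (upper (xor c b)).succ

/-- The interior of an elementary two-point melon of type III: `y` is the child of `x` along one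
of `e₃(x), e₄(x)` (chosen by `a`); the external half-edges are `e₁(x)` and one of `e₃(y), e₄(y)`
(chosen by `b`). -/
structure InteriorIII (a b : Bool) : Prop where
  solid : G'.tree.parent y = Sum.inr (x, upper a)
  dashed_left : G'.Dashed (Sum.inr (x, 0)) (Sum.inr (y, upper (!b)))
  dashed_right : G'.Dashed (Sum.inr (x, upper (!a))) (Sum.inr (y, 0))
  lead_zero : G'.propagator x 0 = (upper b).succ
  lead_one : G'.propagator x 1 = (upper (!b)).succ
  lead_upper : G'.propagator x (upper a).succ = 0
  lead_upper' : G'.propagator x (upper (!a)).succ = 1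

end Melons

/-- `MelonicInsertion G G'`: the graph `G'` arises from `G` by a melonic insertion of one of the
five types, i.e. `G` arises from `G'` by a melonic reduction; the heap order of `G` is the one
induced by that of `G'`. -/
inductive MelonicInsertion {n : ℕ} (G : Graph n) (G' : Graph (n + 2)) : Prop
  | typeI (f : Fin n ↪o Fin (n + 2)) (x y : Fin (n + 2)) (s t : Slot n) (b : Bool)
      (pair : AddsPair G G' f x y) (old : ReplacesDashed G G' f s t)
      (interior : InteriorI G' x y b)
      (left : G'.tree.parent x = Slot.rename f s)
      (right : G'.tree.parent y = Slot.rename f t)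
  | typeII (f : Fin n ↪o Fin (n + 2)) (x y : Fin (n + 2)) (s t : Slot n) (b : Bool)
      (pair : AddsPair G G' f x y) (old : ReplacesDashed G G' f s t)
      (interior : InteriorII G' x y b)
      (left : G'.tree.parent x = Slot.rename f s)
      (right : G'.Dashed (Sum.inr (y, 0)) (Slot.rename f t))
  | typeIII (f : Fin n ↪o Fin (n + 2)) (x y : Fin (n + 2)) (s t : Slot n) (a b : Bool)
      (pair : AddsPair G G' f x y) (old : ReplacesDashed G G' f s t)
      (interior : InteriorIII G' x y a b)
      (left : G'.tree.parent x = Slot.rename f s)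
      (right : G'.Dashed (Sum.inr (y, upper b)) (Slot.rename f t))
  | typeIIs (f : Fin n ↪o Fin (n + 2)) (x y : Fin (n + 2)) (u : Fin n) (b : Bool)
      (pair : AddsPair G G' f x y) (old : ReplacesSolid G G' f u)
      (interior : InteriorII G' x y b)
      (left : G'.tree.parent x = Slot.rename f (G.tree.parent u))
      (right : G'.tree.parent (f u) = Sum.inr (y, 0))
  | typeIIIs (f : Fin n ↪o Fin (n + 2)) (x y : Fin (n + 2)) (u : Fin n) (a b : Bool)
      (pair : AddsPair G G' f x y) (old : ReplacesSolid G G' f u)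
      (interior : InteriorIII G' x y a b)
      (left : G'.tree.parent x = Slot.rename f (G.tree.parent u))
      (right : G'.tree.parent (f u) = Sum.inr (y, upper b))

/-- The melonic graphs: those that can be reduced to the trivial graph, which is the only graph of
order `0`, by a sequence of melonic reductions. -/
inductive IsMelonic : ∀ {n : ℕ}, Graph n → Prop
  | trivial (G : Graph 0) : IsMelonic G
  | insertion {n : ℕ} (G : Graph n) (G' : Graph (n + 2)) :
      IsMelonic G → MelonicInsertion G G' → IsMelonic G'

/-! ### Sobolev norms -/

/-- The contribution of a graph `G` of order `n` to the coefficient of `t ^ n` in the expansion of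
the averaged two-point function `⟨G₂(r, t)⟩`. -/
noncomputable def Graph.twoPointTerm {n : ℕ} (G : Graph n) (r : ℕ) (p : ℝ) : ℂ :=
  1 / ((n.factorial : ℂ) * (Real.sqrt 8 : ℂ) ^ n) * G.tree.sign * (G.amplitude r p : ℂ)

/-- The contribution of a graph `G` of order `n` to the coefficient of `t ^ n` in the expansion of
the averaged Sobolev norm `∑ r, (r ^ γ / N) ⟨G₂(r, t)⟩`. -/
noncomputable def Graph.sobolevTerm {n : ℕ} (G : Graph n) (γ p : ℝ) : ℂ :=
  ∑' r : ℕ, (((r : ℝ) ^ γ / modeNumber p : ℝ) : ℂ) * G.twoPointTerm r p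

/-- A graph is dominant for the averaged Sobolev norm if its contribution scales in the leading
way among all graphs of the same order as `N → ∞`, i.e. as `p → 1`. -/
def Graph.IsDominant {n : ℕ} (G : Graph n) (γ : ℝ) : Prop :=
  ∀ H : Graph n, (fun p : ℝ => H.sobolevTerm γ p) =O[𝓝[<] 1] fun p : ℝ => G.sobolevTerm γ p

/-- The coefficient of `t ^ n` in the expansion of the averaged Sobolev norm over graphs. -/
noncomputable def sobolevCoeff (γ p : ℝ) (n : ℕ) : ℂ := ∑ G : Graph n, G.sobolevTerm γ p

open Classical in
/-- The coefficient of `t ^ n` in the melonic approximation of the averaged Sobolev norm. -/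
noncomputable def meloSobolevCoeff (γ p : ℝ) (n : ℕ) : ℂ :=
  ∑ G : Graph n with IsMelonic G, G.sobolevTerm γ p

open Classical in
/-- The coefficient of `t ^ n` in the melonic approximation of the averaged two-point function. -/
noncomputable def meloTwoPointCoeff (r : ℕ) (p : ℝ) (n : ℕ) : ℂ :=
  ∑ G : Graph n with IsMelonic G, G.twoPointTerm r p

/-- The melonic approximation of the averaged two-point function; only even orders occur. -/
noncomputable def meloTwoPoint (r : ℕ) (p : ℝ) (t : ℂ) : ℂ :=
  ∑' m : ℕ, meloTwoPointCoeff r p (2 * m) * t ^ (2 * m)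

/-- The melonic approximation of the averaged Sobolev norm. -/
noncomputable def meloSobolev (γ p : ℝ) (t : ℂ) : ℂ :=
  ∑' r : ℕ, (((r : ℝ) ^ γ / modeNumber p : ℝ) : ℂ) * meloTwoPoint r p t

end MelonicTurbulence

/-!
The edges of a graph (solid or dashed) and the corners of its nodes, together with the passage
through the root, are two fixed-point free involutions `mate` and `turn` of the set of half-edges.
A momentum attribution is a function on half-edges that is invariant under both and satisfies
`j + (S - j) = k + (S - k)` at each true vertex. Over `ℚ` these functions form the space
`G.flowSpace`, of dimension `F - R`, so the degree is `n + 1 - dim` (`Graph.degree_eq`).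

*Bounds.* The momentum entering a set of true vertices balances the one leaving it; applied to the
descendants of a vertex, this says that a flow is determined by its values on the `n + 1` dashed
edges. Hence the degree is nonnegative. Summing over the whole tree, the total dashed momentum is
`r` plus a sum of momenta of child half-edges, and in particular it dominates the mean of `r` and
of any family of distinct dashed momenta. Choosing `dim - 1` dashed edges which together with the
root determine the flow bounds the amplitude of every graph by a product of geometric series,
`2 ^ n * N ^ (-d) * p ^ (r / 2)` (`Graph.amplitude_bound`).

*Melonic graphs.* On half-edges, all five kinds of melonic insertion are one and the same
operation (`InsertsMelon`): an edge is cut open and a pair of true vertices, joined by three edges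
along the propagator, is put there. Each insertion extends a family of flows by two new free
natural numbers while keeping all momenta at most `r` plus the sum of the parameters. This yields
the lower bound on melonic amplitudes (`IsMelonic.le_amplitude`), and compared with the upper bound
as `p → 1` it forces the degree to vanish.

*Degree zero.* If the degree is zero, every function on the dashed edges extends to a flow. From
this one reads off, for each corner where two different edges meet, a set of true vertices whose
boundary consists of precisely these two edges. By submodularity of the edge boundary, a minimal
nonempty set of vertices with at most two boundary edges consists of the two vertices of an
elementary melon (`Graph.exists_melon`). Removing it keeps the degree zero, so that induction shows
that the graph is melonic.

*Counting and analyticity.* A melonic graph is determined by the chain of melons along its root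
edge, which is recorded by a preorder word over a finite alphabet together with the list of vertex
labels; this gives at most `K ^ n * n!` graphs (`exists_card_isMelonic_le`). The remaining
statements follow by comparing `∑ r, r ^ γ / N * p ^ (c * r)` with `N ^ γ`, where dominance singles
out the melonic graphs because there is one of each even order, and from the absolute convergence
of the double series in `r` and the order.
-/

namespace MelonicTurbulence

/-! ### Half-edges, edges and corners -/

/-- The half-edges of a graph of order `n`: the two half-edges of the root and the four half-edges
of each true vertex. -/
abbrev HalfEdge (n : ℕ) : Type := Bool ⊕ (Fin n × Fin 4)

theorem slotHalfEdge_injective (n : ℕ) : Function.Injective (Graph.slotHalfEdge (n := n)) := by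
  rintro (b | ⟨v, a⟩) (c | ⟨w, d⟩) h <;> simp_all [Graph.slotHalfEdge]

theorem slotHalfEdge_ne_up {n : ℕ} (s : Slot n) (v : Fin n) :
    Graph.slotHalfEdge s ≠ Sum.inr (v, 0) := by
  rcases s with b | ⟨u, a⟩
  · simp [Graph.slotHalfEdge]
  · intro h
    simp only [Graph.slotHalfEdge, Sum.inr.injEq, Prod.mk.injEq] at h
    exact Fin.succ_ne_zero _ h.2

theorem halfEdge_cases {n : ℕ} (h : HalfEdge n) :
    (∃ v, h = Sum.inr (v, 0)) ∨ ∃ s, h = Graph.slotHalfEdge s := by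
  rcases h with b | ⟨v, a⟩
  · exact Or.inr ⟨Sum.inl b, rfl⟩
  · rcases Fin.eq_zero_or_eq_succ a with rfl | ⟨c, rfl⟩
    · exact Or.inl ⟨v, rfl⟩
    · exact Or.inr ⟨Sum.inr (v, c), rfl⟩

theorem HeapTree.vertexType_eq {n : ℕ} (T : HeapTree n) (v : Fin n) :
    T.vertexType v = T.slotType (T.parent v) := by
  rw [HeapTree.vertexType]
  split <;> rename_i h <;> rw [h] <;> rfl

namespace Graph

variable {n : ℕ} (G : Graph n)

/-- `G.IsEdge h h'`: the half-edges `h` and `h'` are the two ends of a solid or dashed edge. -/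
inductive IsEdge : HalfEdge n → HalfEdge n → Prop
  | down (v : Fin n) : IsEdge (slotHalfEdge (G.tree.parent v)) (Sum.inr (v, 0))
  | up (v : Fin n) : IsEdge (Sum.inr (v, 0)) (slotHalfEdge (G.tree.parent v))
  | dashed (s t : Slot n) (h : G.Dashed s t) : IsEdge (slotHalfEdge s) (slotHalfEdge t)

variable {G}

theorem Dashed.symm {s t : Slot n} (h : G.Dashed s t) : G.Dashed t s := by
  obtain ⟨l, h | h⟩ := h
  · exact ⟨l, Or.inr h⟩
  · exact ⟨l, Or.inl h⟩

theorem Dashed.left_free {s t : Slot n} (h : G.Dashed s t) : s ∉ Set.range G.tree.parent := by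
  obtain ⟨l, ⟨rfl, -⟩ | ⟨-, rfl⟩⟩ := h
  · exact l.2.1
  · exact (G.pairing l).2.1

theorem Dashed.slotType {s t : Slot n} (h : G.Dashed s t) :
    G.tree.slotType t = !G.tree.slotType s := by
  obtain ⟨l, ⟨rfl, rfl⟩ | ⟨rfl, rfl⟩⟩ := h <;> rw [l.2.2, (G.pairing l).2.2] <;> rfl

theorem exists_dashed {s : Slot n} (h : s ∉ Set.range G.tree.parent) : ∃ t, G.Dashed s t := by
  by_cases hs : G.tree.slotType s = true
  · exact ⟨_, ⟨s, h, hs⟩, Or.inl ⟨rfl, rfl⟩⟩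
  · obtain ⟨l, hl⟩ := G.pairing.surjective ⟨s, h, by simpa using hs⟩
    exact ⟨l.1, l, Or.inr ⟨rfl, by rw [hl]⟩⟩

theorem Dashed.unique {s t t' : Slot n} (h : G.Dashed s t) (h' : G.Dashed s t') : t = t' := by
  obtain ⟨l, ⟨h1, h2⟩ | ⟨h1, h2⟩⟩ := h <;> obtain ⟨l', ⟨h3, h4⟩ | ⟨h3, h4⟩⟩ := h'
  · obtain rfl : l = l' := Subtype.ext (h1.symm.trans h3)
    rw [h2, h4]
  · have := l.2.2
    rw [← h1, h4, (G.pairing l').2.2] at this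
    cases this
  · have := l'.2.2
    rw [← h3, h2, (G.pairing l).2.2] at this
    cases this
  · obtain rfl : l = l' := G.pairing.injective (Subtype.ext (h2.symm.trans h4))
    rw [h1, h3]

theorem IsEdge.symm {h h' : HalfEdge n} (e : G.IsEdge h h') : G.IsEdge h' h := by
  cases e with
  | down v => exact .up v
  | up v => exact .down v
  | dashed s t h => exact .dashed t s h.symm

variable (G)

theorem exists_isEdge (h : HalfEdge n) : ∃ h', G.IsEdge h h' := by
  rcases halfEdge_cases h with ⟨v, rfl⟩ | ⟨s, rfl⟩
  · exact ⟨_, .up v⟩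
  · by_cases hs : s ∈ Set.range G.tree.parent
    · obtain ⟨v, rfl⟩ := hs
      exact ⟨_, .down v⟩
    · obtain ⟨t, ht⟩ := exists_dashed hs
      exact ⟨_, .dashed s t ht⟩

variable {G}

theorem IsEdge.unique {h h₁ h₂ : HalfEdge n} (e₁ : G.IsEdge h h₁) (e₂ : G.IsEdge h h₂) :
    h₁ = h₂ := by
  generalize hg : h = g at e₂
  cases e₁ with
  | down v =>
    cases e₂ with
    | down w => rw [G.tree.parent_injective (slotHalfEdge_injective n hg)]
    | up w => exact absurd hg (slotHalfEdge_ne_up _ _)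
    | dashed s t d => exact absurd ⟨v, slotHalfEdge_injective n hg⟩ d.left_free
  | up v =>
    cases e₂ with
    | down w => exact absurd hg.symm (slotHalfEdge_ne_up _ _)
    | up w => simp only [Sum.inr.injEq, Prod.mk.injEq, and_true] at hg; rw [hg]
    | dashed s t d => exact absurd hg.symm (slotHalfEdge_ne_up _ _)
  | dashed s t d =>
    cases e₂ with
    | down w => exact absurd ⟨w, (slotHalfEdge_injective n hg).symm⟩ d.left_free
    | up w => exact absurd hg (slotHalfEdge_ne_up _ _)
    | dashed s' t' d' =>
      obtain rfl := slotHalfEdge_injective n hg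
      rw [d.unique d']

variable (G)

/-- The other end of the solid or dashed edge to which a half-edge belongs. -/
noncomputable def mate (h : HalfEdge n) : HalfEdge n := (G.exists_isEdge h).choose

theorem isEdge_mate (h : HalfEdge n) : G.IsEdge h (G.mate h) := (G.exists_isEdge h).choose_spec

theorem mate_eq_iff {h h' : HalfEdge n} : G.mate h = h' ↔ G.IsEdge h h' :=
  ⟨fun e => e ▸ G.isEdge_mate h, fun e => (G.isEdge_mate h).unique e⟩

@[simp]
theorem mate_mate (h : HalfEdge n) : G.mate (G.mate h) = h :=
  (G.mate_eq_iff).2 (G.isEdge_mate h).symm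

theorem mate_injective : Function.Injective G.mate :=
  Function.LeftInverse.injective G.mate_mate

theorem mate_up (v : Fin n) : G.mate (Sum.inr (v, 0)) = slotHalfEdge (G.tree.parent v) :=
  (G.mate_eq_iff).2 (.up v)

theorem mate_parent (v : Fin n) : G.mate (slotHalfEdge (G.tree.parent v)) = Sum.inr (v, 0) :=
  (G.mate_eq_iff).2 (.down v)

variable {G} in
theorem Dashed.mate_eq {s t : Slot n} (h : G.Dashed s t) :
    G.mate (slotHalfEdge s) = slotHalfEdge t := (G.mate_eq_iff).2 (.dashed s t h)

theorem dashed_iff_mate {s t : Slot n} :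
    G.Dashed s t ↔ G.mate (slotHalfEdge s) = slotHalfEdge t := by
  refine ⟨Dashed.mate_eq, fun h => ?_⟩
  have hs : s ∉ Set.range G.tree.parent := by
    rintro ⟨v, rfl⟩
    rw [mate_parent] at h
    exact slotHalfEdge_ne_up _ _ h.symm
  obtain ⟨t', ht'⟩ := exists_dashed hs
  rwa [slotHalfEdge_injective n (h.symm.trans ht'.mate_eq)]

theorem parent_eq_iff_mate {v : Fin n} {s : Slot n} :
    G.tree.parent v = s ↔ G.mate (Sum.inr (v, 0)) = slotHalfEdge s := by
  rw [mate_up]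
  exact ⟨fun h => by rw [h], fun h => slotHalfEdge_injective n h⟩

/-- Every edge is the parent-edge of a true vertex or a dashed edge, the latter having a leaf as
one of its ends. -/
theorem edge_cases (h : HalfEdge n) :
    (∃ v, h = Sum.inr (v, 0) ∨ G.mate h = Sum.inr (v, 0)) ∨
      ∃ l : G.tree.Leaf, h = slotHalfEdge l.1 ∨ G.mate h = slotHalfEdge l.1 := by
  have := G.isEdge_mate h
  generalize hg : G.mate h = g at this
  cases this with
  | down v => exact Or.inl ⟨v, Or.inr rfl⟩
  | up v => exact Or.inl ⟨v, Or.inl rfl⟩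
  | dashed s t d =>
    obtain ⟨l, ⟨rfl, rfl⟩ | ⟨rfl, rfl⟩⟩ := d
    · exact Or.inr ⟨l, Or.inl rfl⟩
    · exact Or.inr ⟨l, Or.inr rfl⟩

/-- The other end of the corner at a half-edge of a node; the two half-edges of the root are
treated as the ends of one more corner. -/
def turn : HalfEdge n → HalfEdge n
  | Sum.inl b => Sum.inl (!b)
  | Sum.inr (v, a) => Sum.inr (G.wavy v, G.propagator v a)

theorem propagator_wavy_apply (v : Fin n) (a : Fin 4) :
    G.propagator (G.wavy v) (G.propagator v a) = a := by
  rw [G.propagator_wavy]; simp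

@[simp]
theorem turn_turn (h : HalfEdge n) : G.turn (G.turn h) = h := by
  rcases h with b | ⟨v, a⟩
  · simp [turn]
  · simp [turn, G.wavy_wavy, G.propagator_wavy_apply]

theorem turn_ne (h : HalfEdge n) : G.turn h ≠ h := by
  rcases h with b | ⟨v, a⟩
  · simp [turn]
  · intro e
    simp only [turn, Sum.inr.injEq, Prod.mk.injEq] at e
    exact G.wavy_ne v e.1

/-- The orientation of a half-edge: `true` if it is out-going, i.e. carries `α` or is the
parent half-edge of a vertex of type `ᾱ`. -/
def outgoing : HalfEdge n → Bool
  | Sum.inl b => b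
  | Sum.inr (v, a) => if a = 0 ∨ a = 1 then !G.tree.vertexType v else G.tree.vertexType v

theorem outgoing_slot (s : Slot n) : G.outgoing (slotHalfEdge s) = G.tree.slotType s := by
  rcases s with b | ⟨v, a⟩
  · rfl
  · fin_cases a <;> simp [slotHalfEdge, outgoing, HeapTree.slotType, ← Fin.val_inj]

theorem outgoing_mate (h : HalfEdge n) : G.outgoing (G.mate h) = !G.outgoing h := by
  have := G.isEdge_mate h
  generalize hg : G.mate h = g at this
  cases this with
  | down v => rw [outgoing_slot, ← HeapTree.vertexType_eq]; simp [outgoing]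
  | up v => rw [outgoing_slot, ← HeapTree.vertexType_eq]; simp [outgoing]
  | dashed s t d => rw [outgoing_slot, outgoing_slot, d.slotType]

theorem mate_ne (h : HalfEdge n) : G.mate h ≠ h := by
  intro e
  have := G.outgoing_mate h
  rw [e] at this
  cases hh : G.outgoing h <;> simp [hh] at this

/-- The tree, the Wick contractions and the wavy edges are determined by the two involutions
on half-edges. -/
theorem ext_of_mate {G G' : Graph n} (hm : ∀ h, G.mate h = G'.mate h)
    (hw : ∀ v, G.wavy v = G'.wavy v) (hp : ∀ v, G.propagator v = G'.propagator v) : G = G' := by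
  have ht : G.tree = G'.tree := by
    ext1
    funext v
    rw [parent_eq_iff_mate, hm, mate_up]
  have hd : ∀ l : G.tree.Leaf, ∀ t, (G.pairing l).1 = t ↔ G'.mate (slotHalfEdge l.1) =
      slotHalfEdge t := by
    intro l t
    have : G.Dashed l.1 (G.pairing l).1 := ⟨l, Or.inl ⟨rfl, rfl⟩⟩
    rw [← hm, this.mate_eq]
    exact ⟨fun h => by rw [h], fun h => slotHalfEdge_injective n h⟩
  obtain ⟨T, w, k, _, _, s, _, _⟩ := G
  obtain ⟨T', w', k', h1, h2, s', h3, h4⟩ := G'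
  obtain rfl : T = T' := ht
  obtain rfl : k = k' := funext hw
  obtain rfl : s = s' := funext hp
  obtain rfl : w = w' := by
    refine Equiv.ext fun l => Subtype.ext ?_
    refine (hd l _).2 ?_
    exact Dashed.mate_eq (G := ⟨T, w', k, h1, h2, s, h3, h4⟩) ⟨l, Or.inl ⟨rfl, rfl⟩⟩
  rfl

end Graph

/-! ### Flows and the degree -/

/-- A permutation that commutes with `complement` preserves the relation `i₁ + i₂ = i₃ + i₄`, and
exchanges or preserves the two sides. -/
theorem complement_perm_sum {R : Type*} [AddCommMonoid R] {π : Equiv.Perm (Fin 4)}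
    (hπ : ∀ a, π (complement a) = complement (π a)) (g : Fin 4 → R)
    (hg : g 0 + g 1 = g 2 + g 3) :
    g (π 0) + g (π 1) = g 0 + g 1 ∧ g (π 2) + g (π 3) = g 0 + g 1 := by
  have h1 : π 1 = complement (π 0) := hπ 0
  have h3 : π 3 = complement (π 2) := hπ 2
  have c0 : complement 0 = 1 := by decide
  have c1 : complement 1 = 0 := by decide
  have c2 : complement 2 = 3 := by decide
  have c3 : complement 3 = 2 := by decide
  have n02 : π 0 ≠ π 2 := fun h => absurd (π.injective h) (by decide)
  have n12 : π 1 ≠ π 2 := fun h => absurd (π.injective h) (by decide)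
  rw [h1] at n12 ⊢
  rw [h3]
  generalize π 0 = a at *
  generalize π 2 = b at *
  fin_cases a <;> fin_cases b <;>
    simp_all [add_comm] <;> rw [add_comm (g 1)] <;> exact hg

namespace Graph

variable {n : ℕ} (G : Graph n)

/-- A momentum attribution to half-edges that is constant along every strand and conserved at
every true vertex. -/
structure IsFlow {R : Type*} [Add R] (X : HalfEdge n → R) : Prop where
  mate : ∀ h, X (G.mate h) = X h
  turn : ∀ h, X (G.turn h) = X h
  node : ∀ v, X (Sum.inr (v, 0)) + X (Sum.inr (v, 1)) = X (Sum.inr (v, 2)) + X (Sum.inr (v, 3))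

variable {G} in
theorem IsFlow.cast {X : HalfEdge n → ℕ} (hX : G.IsFlow X) :
    G.IsFlow fun h => (X h : ℚ) where
  mate h := by rw [hX.mate]
  turn h := by rw [hX.turn]
  node v := by exact_mod_cast hX.node v

/-- The space of rational flows. -/
def flowSpace : Submodule ℚ (HalfEdge n → ℚ) where
  carrier := {X | G.IsFlow X}
  add_mem' {X Y} hX hY :=
    { mate := fun h => by simp [hX.mate, hY.mate]
      turn := fun h => by simp [hX.turn, hY.turn]
      node := fun v => by
        have := hX.node v
        have := hY.node v
        simp only [Pi.add_apply]; linarith }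
  zero_mem' := ⟨fun _ => rfl, fun _ => rfl, fun _ => rfl⟩
  smul_mem' c X hX :=
    { mate := fun h => by simp [hX.mate]
      turn := fun h => by simp [hX.turn]
      node := fun v => by simp only [Pi.smul_apply, ← smul_add, hX.node v] }

@[simp]
theorem mem_flowSpace {X : HalfEdge n → ℚ} : X ∈ G.flowSpace ↔ G.IsFlow X := Iff.rfl

theorem isFlow_one : G.IsFlow fun _ => (1 : ℚ) := ⟨fun _ => rfl, fun _ => rfl, fun _ => rfl⟩

/-- The face through a half-edge. -/
def face (h : HalfEdge n) : G.Face := Quot.mk G.Strand h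

theorem face_mate (h : HalfEdge n) : G.face (G.mate h) = G.face h := by
  have := G.isEdge_mate h
  generalize hg : G.mate h = g at this
  cases this with
  | down v => exact (Quot.sound (.solid v)).symm
  | up v => exact Quot.sound (.solid v)
  | dashed s t d =>
    obtain ⟨l, ⟨rfl, rfl⟩ | ⟨rfl, rfl⟩⟩ := d
    · exact (Quot.sound (.dashed l)).symm
    · exact Quot.sound (.dashed l)

theorem face_turn (h : HalfEdge n) : G.face (G.turn h) = G.face h := by
  rcases h with (_ | _) | ⟨v, a⟩
  · exact Quot.sound .root
  · exact (Quot.sound .root).symm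
  · exact (Quot.sound (.corner v a)).symm

theorem incidence_mulVec (x : G.Face → ℚ) (v : G.Node) :
    G.incidence.mulVec x v =
      x (G.face (Sum.inr (v.1, 0))) + x (G.face (Sum.inr (v.1, 1))) -
      x (G.face (Sum.inr (v.1, 2))) - x (G.face (Sum.inr (v.1, 3))) := by
  classical
  have : ∀ a : Fin 4, ∑ f : G.Face, (if G.face (Sum.inr (v.1, a)) = f then (1 : ℚ) else 0) * x f =
      x (G.face (Sum.inr (v.1, a))) := by
    intro a
    rw [Finset.sum_eq_single (G.face (Sum.inr (v.1, a)))]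
    · simp
    · intro f _ hf
      rw [if_neg hf.symm, zero_mul]
    · simp
  have h2 : G.incidence.mulVec x v = ∑ a : Fin 4, (![1, 1, -1, -1] : Fin 4 → ℚ) a *
      ∑ f : G.Face, (if G.face (Sum.inr (v.1, a)) = f then (1 : ℚ) else 0) * x f := by
    simp only [Matrix.mulVec, dotProduct, incidence, Finset.sum_mul]
    rw [Finset.sum_comm]
    simp only [mul_assoc, ← Finset.mul_sum]
    refine Finset.sum_congr rfl fun a _ => ?_
    congr 1
  rw [h2]
  simp only [this]
  rw [Fin.sum_univ_four]
  simp
  ring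

theorem lt_or_wavy_lt (v : Fin n) : v < G.wavy v ∨ G.wavy v < G.wavy (G.wavy v) := by
  rw [G.wavy_wavy]
  exact lt_or_gt_of_ne (G.wavy_ne v).symm

theorem IsFlow.of_face {x : G.Face → ℚ} (hx : G.incidence.mulVec x = 0) :
    G.IsFlow fun h => x (G.face h) where
  mate h := by rw [face_mate]
  turn h := by rw [face_turn]
  node v := by
    have key : ∀ w, w < G.wavy w → x (G.face (Sum.inr (w, 0))) + x (G.face (Sum.inr (w, 1))) =
        x (G.face (Sum.inr (w, 2))) + x (G.face (Sum.inr (w, 3))) := by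
      intro w hw
      have : _ = (0 : ℚ) := (G.incidence_mulVec x ⟨w, hw⟩).symm.trans (congrFun hx _)
      simp only at this
      linarith
    rcases G.lt_or_wavy_lt v with h | h
    · exact key v h
    · have := complement_perm_sum (G.propagator_complement v)
        (fun a => x (G.face (Sum.inr (G.wavy v, a)))) (key _ h)
      have e : ∀ a, x (G.face (Sum.inr (G.wavy v, G.propagator v a))) =
          x (G.face (Sum.inr (v, a))) := fun a => by
        rw [← G.face_turn (Sum.inr (v, a))]; rfl
      simp only [e] at this
      rw [this.1, this.2]

/-- The solutions of the linear system of momentum conservation in terms of the face momenta. -/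
theorem finrank_flowSpace :
    (Module.finrank ℚ G.flowSpace : ℤ) = (G.faceCount : ℤ) - G.incidence.rank := by
  classical
  have h := LinearMap.finrank_range_add_finrank_ker G.incidence.mulVecLin
  rw [Module.finrank_fintype_fun_eq_card, ← Nat.card_eq_fintype_card] at h
  let Φ : (G.Face → ℚ) →ₗ[ℚ] (HalfEdge n → ℚ) := LinearMap.funLeft ℚ ℚ G.face
  have hΦ : Function.Injective Φ :=
    LinearMap.funLeft_injective_of_surjective _ _ _ Quot.mk_surjective
  have hmap : (LinearMap.ker G.incidence.mulVecLin).map Φ = G.flowSpace := by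
    ext X
    simp only [Submodule.mem_map, LinearMap.mem_ker, Matrix.mulVecLin_apply, mem_flowSpace]
    constructor
    · rintro ⟨x, hx, rfl⟩
      exact IsFlow.of_face G hx
    · intro hX
      have hS : ∀ h h', G.Strand h h' → X h = X h' := by
        intro h h' s
        cases s with
        | solid v => rw [← G.mate_up, hX.mate]
        | dashed l =>
          rw [← Dashed.mate_eq (⟨l, Or.inl ⟨rfl, rfl⟩⟩ : G.Dashed l.1 (G.pairing l).1), hX.mate]
        | corner v a => exact (hX.turn (Sum.inr (v, a))).symm
        | root => exact (hX.turn (Sum.inl true)).symm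
      let x : G.Face → ℚ := Quot.lift X hS
      refine ⟨x, ?_, rfl⟩
      funext v
      rw [incidence_mulVec]
      have h1 : ∀ h, x (G.face h) = X h := fun _ => rfl
      have := hX.node v.1
      simp only [Pi.zero_apply, h1]
      linarith
  have hf := LinearEquiv.finrank_eq (Submodule.equivMapOfInjective Φ hΦ
    (LinearMap.ker G.incidence.mulVecLin))
  rw [hmap] at hf
  rw [← hf, faceCount, Matrix.rank]
  omega

theorem degree_eq : G.degree = (n : ℤ) + 1 - Module.finrank ℚ G.flowSpace := by
  rw [degree, independentFaces, finrank_flowSpace]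
  ring

/-! ### Cuts -/

/-- The half-edges of the vertices of `C`. -/
def Inside (C : Finset (Fin n)) : HalfEdge n → Prop
  | Sum.inl _ => False
  | Sum.inr (v, _) => v ∈ C

@[simp]
theorem inside_inr (C : Finset (Fin n)) (v : Fin n) (a : Fin 4) :
    Inside C (Sum.inr (v, a)) ↔ v ∈ C := Iff.rfl

open Classical in
/-- The half-edges of the vertices of `C` whose edge leaves `C`. -/
noncomputable def boundary (C : Finset (Fin n)) : Finset (HalfEdge n) :=
  Finset.univ.filter fun h => Inside C h ∧ ¬ Inside C (G.mate h)

@[simp]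
theorem mem_boundary {C : Finset (Fin n)} {h : HalfEdge n} :
    h ∈ G.boundary C ↔ Inside C h ∧ ¬ Inside C (G.mate h) := by
  simp [boundary]

/-- The orientation of a half-edge as a sign. -/
def orientation (h : HalfEdge n) : ℚ := if G.outgoing h then 1 else -1

theorem orientation_mate (h : HalfEdge n) : G.orientation (G.mate h) = - G.orientation h := by
  unfold orientation
  rw [outgoing_mate]
  cases G.outgoing h <;> simp

theorem orientation_ne_zero (h : HalfEdge n) : G.orientation h ≠ 0 := by
  unfold orientation
  split <;> norm_num

/-- The flow through the boundary of a set of true vertices vanishes: the edges inside the set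
cancel by orientation. -/
theorem sum_boundary {X : HalfEdge n → ℚ} (hX : G.IsFlow X) (C : Finset (Fin n)) :
    ∑ h ∈ G.boundary C, G.orientation h * X h = 0 := by
  classical
  have h1 : ∑ h ∈ Finset.univ.filter (Inside C), G.orientation h * X h = 0 := by
    rw [Finset.sum_filter, Fintype.sum_sum_type, Fintype.sum_prod_type]
    rw [Finset.sum_eq_zero fun b _ => if_neg (by simp [Inside]), zero_add]
    refine Finset.sum_eq_zero fun v _ => ?_
    simp only [inside_inr]
    by_cases hv : v ∈ C
    · simp only [hv, if_true]
      have := hX.node v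
      rw [Fin.sum_univ_four]
      have e1 : G.orientation (Sum.inr (v, 1)) = G.orientation (Sum.inr (v, 0)) := by
        simp [orientation, outgoing]
      have e2 : G.orientation (Sum.inr (v, 2)) = - G.orientation (Sum.inr (v, 0)) := by
        simp [orientation, outgoing]; cases G.tree.vertexType v <;> simp
      have e3 : G.orientation (Sum.inr (v, 3)) = - G.orientation (Sum.inr (v, 0)) := by
        simp [orientation, outgoing]; cases G.tree.vertexType v <;> simp
      rw [e1, e2, e3]
      linear_combination G.orientation (Sum.inr (v, 0)) * this
    · simp [hv]
  have h2 : ∑ h ∈ (Finset.univ.filter (Inside C)).filter (fun h => Inside C (G.mate h)),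
      G.orientation h * X h = 0 := by
    refine Finset.sum_involution (fun h _ => G.mate h) ?_ ?_ ?_ ?_
    · intro h _
      rw [orientation_mate, hX.mate]; ring
    · intro h _ _
      exact G.mate_ne h
    · intro h hh
      simp only [Finset.mem_filter, Finset.mem_univ, true_and, mate_mate] at hh ⊢
      exact hh.symm
    · intro h _
      exact G.mate_mate h
  rw [← Finset.sum_filter_add_sum_filter_not _ (fun h => Inside C (G.mate h)), h2, zero_add,
    Finset.filter_filter] at h1
  convert h1
  ext h
  simp

/-- `u` is `v` or lies below `v` in the tree. -/
def Below (v u : Fin n) : Prop :=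
  Relation.ReflTransGen (fun w w' => ∃ a, G.tree.parent w' = Sum.inr (w, a)) v u

theorem Below.le {v u : Fin n} (h : G.Below v u) : v ≤ u := by
  induction h with
  | refl => exact le_rfl
  | tail _ h ih =>
    obtain ⟨a, ha⟩ := h
    exact ih.trans (G.tree.heap _ _ a ha).le

open Classical in
/-- The true vertices of the branch that starts at `v`. -/
noncomputable def branch (v : Fin n) : Finset (Fin n) := Finset.univ.filter (G.Below v)

theorem mem_branch {v u : Fin n} : u ∈ G.branch v ↔ G.Below v u := by simp [branch]

theorem self_mem_branch (v : Fin n) : v ∈ G.branch v :=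
  (G.mem_branch).2 Relation.ReflTransGen.refl

theorem mate_up_not_inside_branch (v : Fin n) :
    ¬ Inside (G.branch v) (G.mate (Sum.inr (v, 0))) := by
  rw [mate_up]
  intro h
  rcases hp : G.tree.parent v with b | ⟨u, a⟩ <;> rw [hp] at h
  · exact h
  · have h1 := G.tree.heap v u a hp
    have h2 := Below.le G ((G.mem_branch).1 h)
    exact absurd h1 h2.not_gt

theorem mate_up_inside_branch_iff {v u : Fin n} (hu : u ≠ v) :
    Inside (G.branch v) (G.mate (Sum.inr (u, 0))) ↔ u ∈ G.branch v := by
  rw [mate_up, mem_branch, Below, Relation.ReflTransGen.cases_tail_iff]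
  simp only [hu, false_or]
  rcases hp : G.tree.parent u with b | ⟨w, a⟩
  · simp [slotHalfEdge, Inside]
  · simp only [slotHalfEdge, inside_inr, mem_branch, Sum.inr.injEq, Prod.mk.injEq]
    constructor
    · exact fun h => ⟨w, h, a, rfl, rfl⟩
    · rintro ⟨w', h, a', rfl, rfl⟩
      exact h

/-- Only one solid edge leaves a branch, so that the flow through it is the signed sum of those
through the dashed edges leaving the branch. -/
theorem eq_up_or_dashed_of_mem_boundary_branch {v : Fin n} {h : HalfEdge n}
    (hh : h ∈ G.boundary (G.branch v)) :
    h = Sum.inr (v, 0) ∨ ∃ l : G.tree.Leaf, h = slotHalfEdge l.1 ∨ G.mate h = slotHalfEdge l.1 := by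
  rw [mem_boundary] at hh
  rcases G.edge_cases h with ⟨u, hu | hu⟩ | hl
  · left
    by_contra hne
    have huv : u ≠ v := fun e => hne (by rw [hu, e])
    subst hu
    exact hh.2 ((G.mate_up_inside_branch_iff huv).2 hh.1)
  · exfalso
    rw [hu] at hh
    have e : h = G.mate (Sum.inr (u, 0)) := by rw [← hu, mate_mate]
    by_cases huv : u = v
    · subst huv
      exact hh.2 (G.self_mem_branch u)
    · rw [e, G.mate_up_inside_branch_iff huv] at hh
      exact hh.2 hh.1
  · exact Or.inr hl

variable {G}

/-- A flow is determined by the dashed momenta: the flow through a solid edge is balanced by the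
dashed edges that leave the branch below it. -/
theorem IsFlow.eq_zero {X : HalfEdge n → ℚ} (hX : G.IsFlow X)
    (hl : ∀ l : G.tree.Leaf, X (slotHalfEdge l.1) = 0) : X = 0 := by
  have hup : ∀ v, X (Sum.inr (v, 0)) = 0 := by
    intro v
    have h := G.sum_boundary hX (G.branch v)
    rw [Finset.sum_eq_single (Sum.inr (v, 0))] at h
    · exact (mul_eq_zero.1 h).resolve_left (G.orientation_ne_zero _)
    · intro h hb hne
      rcases G.eq_up_or_dashed_of_mem_boundary_branch hb with h1 | ⟨l, h1 | h1⟩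
      · exact absurd h1 hne
      · rw [h1, hl, mul_zero]
      · rw [← hX.mate, h1, hl, mul_zero]
    · intro hne
      exact absurd ((G.mem_boundary).2 ⟨(inside_inr _ _ _).2 (G.self_mem_branch v),
        G.mate_up_not_inside_branch v⟩) hne
  funext h
  rcases G.edge_cases h with ⟨v, h1 | h1⟩ | ⟨l, h1 | h1⟩
  · rw [h1]; exact hup v
  · rw [← hX.mate, h1]; exact hup v
  · rw [h1]; exact hl l
  · rw [← hX.mate, h1]; exact hl l

variable (G)

theorem card_leaf : Fintype.card G.tree.Leaf = n + 1 := by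
  classical
  have e : (Finset.univ.image G.tree.parent).card = n := by
    rw [Finset.card_image_of_injective _ G.tree.parent_injective, Finset.card_univ,
      Fintype.card_fin]
  have h1 : ((Finset.univ.image G.tree.parent)ᶜ).card = 2 * n + 2 := by
    rw [Finset.card_compl, e]
    simp only [Fintype.card_sum, Fintype.card_bool, Fintype.card_prod, Fintype.card_fin]
    omega
  have h2 : Nat.card G.tree.Leaf = ((Finset.univ.image G.tree.parent)ᶜ.filter
      fun s => G.tree.slotType s = true).card := by
    rw [HeapTree.Leaf, Nat.subtype_card]
    simp
  have h3 : Nat.card G.tree.AntiLeaf = ((Finset.univ.image G.tree.parent)ᶜ.filter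
      fun s => ¬ G.tree.slotType s = true).card := by
    rw [HeapTree.AntiLeaf, Nat.subtype_card]
    simp
  have h4 := Nat.card_congr G.pairing
  have h5 := Finset.card_filter_add_card_filter_not (s := (Finset.univ.image G.tree.parent)ᶜ)
    (fun s => G.tree.slotType s = true)
  rw [← Nat.card_eq_fintype_card]
  omega

/-- The momenta of the dashed edges, as a linear map on flows. -/
noncomputable def leafMomentum : G.flowSpace →ₗ[ℚ] (G.tree.Leaf → ℚ) where
  toFun X l := X.1 (slotHalfEdge l.1)
  map_add' _ _ := rfl
  map_smul' _ _ := rfl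

theorem leafMomentum_injective : Function.Injective G.leafMomentum := by
  rw [injective_iff_map_eq_zero]
  intro X hX
  exact Subtype.ext (IsFlow.eq_zero X.2 fun l => congrFun hX l)

theorem finrank_flowSpace_le : Module.finrank ℚ G.flowSpace ≤ n + 1 := by
  have := LinearMap.finrank_le_finrank_of_injective G.leafMomentum_injective
  rwa [Module.finrank_fintype_fun_eq_card, card_leaf] at this

theorem degree_nonneg : 0 ≤ G.degree := by
  have := G.finrank_flowSpace_le
  rw [degree_eq]
  omega

/-- The sum of the dashed momenta exceeds the root momentum by the momenta of the half-edges
`e₂`. -/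
theorem sum_leaf {X : HalfEdge n → ℕ} (hX : G.IsFlow X) :
    ∑ l : G.tree.Leaf, X (slotHalfEdge l.1) =
      X (Sum.inl true) + ∑ v, X (Sum.inr (v, 1)) := by
  classical
  let g : Slot n → ℕ := fun s => if G.tree.slotType s = true then X (slotHalfEdge s) else 0
  have h1 : ∑ s, g s = X (Sum.inl true) + ∑ v, (if G.tree.vertexType v = true then
      X (Sum.inr (v, 2)) + X (Sum.inr (v, 3)) else X (Sum.inr (v, 1))) := by
    rw [Fintype.sum_sum_type, Fintype.sum_prod_type]
    refine congr_arg₂ _ ?_ ?_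
    · simp [g, HeapTree.slotType, slotHalfEdge]
    · refine Finset.sum_congr rfl fun v _ => ?_
      rw [Fin.sum_univ_three]
      have e1 : G.tree.slotType (Sum.inr (v, 1)) = G.tree.vertexType v := rfl
      have e2 : G.tree.slotType (Sum.inr (v, 2)) = G.tree.vertexType v := rfl
      have e0 : G.tree.slotType (Sum.inr (v, 0)) = !G.tree.vertexType v := rfl
      cases hv : G.tree.vertexType v <;> simp [g, e0, e1, e2, hv, slotHalfEdge]
  have h2 : ∑ s ∈ Finset.univ.image G.tree.parent, g s =
      ∑ v, (if G.tree.vertexType v = true then X (Sum.inr (v, 0)) else 0) := by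
    rw [Finset.sum_image fun _ _ _ _ h => G.tree.parent_injective h]
    refine Finset.sum_congr rfl fun v _ => ?_
    simp only [g, ← HeapTree.vertexType_eq]
    rw [← mate_up, hX.mate]
  have h3 : ∑ s ∈ (Finset.univ.image G.tree.parent)ᶜ, g s =
      ∑ l : G.tree.Leaf, X (slotHalfEdge l.1) := by
    simp only [g]
    rw [← Finset.sum_filter]
    refine Finset.sum_subtype (p := fun s => s ∉ Set.range G.tree.parent ∧ G.tree.slotType s = true)
      (F := (inferInstance : Fintype G.tree.Leaf)) _ (fun s => ?_) (fun s => X (slotHalfEdge s))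
    simp
  have h4 := Finset.sum_add_sum_compl (Finset.univ.image G.tree.parent) g
  have h5 : ∑ v, (if G.tree.vertexType v = true then X (Sum.inr (v, 0)) else 0) +
      ∑ v, X (Sum.inr (v, 1)) = ∑ v, (if G.tree.vertexType v = true then
      X (Sum.inr (v, 2)) + X (Sum.inr (v, 3)) else X (Sum.inr (v, 1))) := by
    rw [← Finset.sum_add_distrib]
    refine Finset.sum_congr rfl fun v _ => ?_
    split_ifs
    · exact hX.node v
    · simp
  omega

end Graph

/-! ### Amplitudes as sums over flows -/

theorem modeNumber_pos {p : ℝ} (hp : p < 1) : 0 < modeNumber p := by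
  unfold modeNumber
  have : 0 < 1 - p := by linarith
  positivity

theorem hasSum_pow_sum_fin (n : ℕ) {q : ℝ} (h0 : 0 ≤ q) (h1 : q < 1) :
    HasSum (fun a : Fin n → ℕ => q ^ ∑ i, a i) ((1 - q)⁻¹ ^ n) := by
  induction n with
  | zero => simp
  | succ n ih =>
    have hg := hasSum_geometric_of_lt_one h0 h1
    have hs := Summable.mul_of_nonneg hg.summable ih.summable (fun _ => by positivity)
      (fun _ => by positivity)
    have := hg.mul ih hs
    rw [← (Fin.consEquiv fun _ : Fin (n + 1) => ℕ).hasSum_iff, pow_succ']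
    have e : (fun a : Fin (n + 1) → ℕ => q ^ ∑ i, a i) ∘ (Fin.consEquiv fun _ => ℕ) =
        fun x : ℕ × (Fin n → ℕ) => q ^ x.1 * q ^ ∑ i, x.2 i := by
      funext x
      simp only [Function.comp, Fin.sum_univ_succ, pow_add]
      rfl
    rw [e]
    exact this

theorem hasSum_pow_sum (ι : Type*) [Fintype ι] {q : ℝ} (h0 : 0 ≤ q) (h1 : q < 1) :
    HasSum (fun a : ι → ℕ => q ^ ∑ i, a i) ((1 - q)⁻¹ ^ Fintype.card ι) := by
  have := hasSum_pow_sum_fin (Fintype.card ι) h0 h1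
  rw [← (Equiv.arrowCongr (Fintype.equivFin ι) (Equiv.refl ℕ)).hasSum_iff] at this
  convert this using 2 with a
  simp only [Function.comp, Equiv.arrowCongr_apply, Equiv.coe_refl, id]
  rw [Equiv.sum_comp (Fintype.equivFin ι).symm]

namespace Graph

variable {n : ℕ} (G : Graph n)

/-- The momentum at a half-edge when the root has momentum `r`. -/
def halfEdgeMomentum (r : ℕ) (m : Fin n → Momentum) : HalfEdge n → ℕ
  | Sum.inl _ => r
  | Sum.inr (v, a) => (m v).halfEdge a

theorem slotMomentum_eq (r : ℕ) (m : Fin n → Momentum) (s : Slot n) :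
    slotMomentum r m s = halfEdgeMomentum r m (slotHalfEdge s) := by
  rcases s with b | ⟨v, a⟩ <;> rfl

/-- The natural flows with root momentum `r`. -/
def RootedFlow (r : ℕ) : Type := {X : HalfEdge n → ℕ // G.IsFlow X ∧ X (Sum.inl true) = r}

variable {G}

theorem Admissible.isFlow {r : ℕ} {m : Fin n → Momentum} (hm : G.Admissible r m) :
    G.IsFlow (halfEdgeMomentum r m) where
  mate h := by
    have := G.isEdge_mate h
    generalize hg : G.mate h = g at this
    cases this with
    | down v => rw [← slotMomentum_eq, ← hm.solid]; rfl
    | up v => rw [← slotMomentum_eq, ← hm.solid]; rfl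
    | dashed s t d =>
      obtain ⟨l, ⟨rfl, rfl⟩ | ⟨rfl, rfl⟩⟩ := d <;>
        rw [← slotMomentum_eq, ← slotMomentum_eq, hm.dashed l]
  turn h := by
    rcases h with b | ⟨v, a⟩
    · rfl
    · exact (hm.wavy_eq v a).symm
  node v := by
    have := hm.j_le v
    have := hm.k_le v
    simp only [halfEdgeMomentum, Momentum.halfEdge, Matrix.cons_val]
    omega

theorem IsFlow.momentum_halfEdge {X : HalfEdge n → ℕ} (hX : G.IsFlow X) (v : Fin n) (a : Fin 4) :
    Momentum.halfEdge ⟨X (Sum.inr (v, 0)) + X (Sum.inr (v, 1)), X (Sum.inr (v, 0)),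
      X (Sum.inr (v, 2))⟩ a = X (Sum.inr (v, a)) := by
  have := hX.node v
  fin_cases a <;> simp [Momentum.halfEdge]
  omega

theorem IsFlow.inl {X : HalfEdge n → ℕ} (hX : G.IsFlow X) (b : Bool) :
    X (Sum.inl b) = X (Sum.inl true) := by
  cases b
  · exact hX.turn (Sum.inl true)
  · rfl

theorem IsFlow.halfEdgeMomentum_eq {X : HalfEdge n → ℕ} (hX : G.IsFlow X) :
    halfEdgeMomentum (X (Sum.inl true)) (fun v => ⟨X (Sum.inr (v, 0)) + X (Sum.inr (v, 1)),
      X (Sum.inr (v, 0)), X (Sum.inr (v, 2))⟩) = X := by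
  funext h
  rcases h with b | ⟨v, a⟩
  · exact (hX.inl b).symm
  · exact hX.momentum_halfEdge v a

theorem IsFlow.admissible {X : HalfEdge n → ℕ} (hX : G.IsFlow X) :
    G.Admissible (X (Sum.inl true)) (fun v => ⟨X (Sum.inr (v, 0)) + X (Sum.inr (v, 1)),
      X (Sum.inr (v, 0)), X (Sum.inr (v, 2))⟩) where
  j_le v := Nat.le_add_right _ _
  k_le v := by
    have := hX.node v
    simp only
    omega
  solid v := by
    rw [slotMomentum_eq, hX.halfEdgeMomentum_eq, ← mate_up, hX.mate]
  wavy_S v := by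
    have h1 := complement_perm_sum (G.propagator_complement v)
      (fun a => X (Sum.inr (G.wavy v, a))) (hX.node _)
    have e : ∀ a, X (Sum.inr (G.wavy v, G.propagator v a)) = X (Sum.inr (v, a)) :=
      fun a => hX.turn (Sum.inr (v, a))
    simp only [e] at h1
    exact h1.1
  wavy_eq v a := by
    rw [hX.momentum_halfEdge, hX.momentum_halfEdge]
    exact (hX.turn (Sum.inr (v, a))).symm
  dashed l := by
    rw [slotMomentum_eq, slotMomentum_eq, hX.halfEdgeMomentum_eq,
      ← Dashed.mate_eq (⟨l, Or.inl ⟨rfl, rfl⟩⟩ : G.Dashed l.1 (G.pairing l).1), hX.mate]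

variable (G)

/-- Admissible momentum attributions are the natural flows. -/
def admissibleEquiv (r : ℕ) : {m : Fin n → Momentum // G.Admissible r m} ≃ G.RootedFlow r where
  toFun m := ⟨halfEdgeMomentum r m.1, m.2.isFlow, rfl⟩
  invFun X := ⟨fun v => ⟨X.1 (Sum.inr (v, 0)) + X.1 (Sum.inr (v, 1)), X.1 (Sum.inr (v, 0)),
    X.1 (Sum.inr (v, 2))⟩, by
      have := X.2.1.admissible
      rwa [X.2.2] at this⟩
  left_inv m := by
    refine Subtype.ext (funext fun v => ?_)
    have h1 := m.2.j_le v
    change Momentum.mk ((m.1 v).j + ((m.1 v).S - (m.1 v).j)) (m.1 v).j (m.1 v).k = m.1 v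
    rw [Nat.add_sub_cancel' h1]
  right_inv X := by
    refine Subtype.ext ?_
    have := X.2.1.halfEdgeMomentum_eq
    rw [X.2.2] at this
    exact this

/-- The sum of the momenta of the dashed edges. -/
noncomputable def dashedSum (X : HalfEdge n → ℕ) : ℕ :=
  ∑ l : G.tree.Leaf, X (slotHalfEdge l.1)

theorem weight_eq (r : ℕ) (p : ℝ) (m : Fin n → Momentum) :
    G.weight r p m = p ^ G.dashedSum (halfEdgeMomentum r m) := by
  simp only [weight, dashedSum, slotMomentum_eq]
  rw [Finset.prod_pow_eq_pow_sum]

theorem amplitude_eq (r : ℕ) (p : ℝ) :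
    G.amplitude r p = 1 / modeNumber p ^ n * ∑' X : G.RootedFlow r, p ^ G.dashedSum X.1 := by
  rw [amplitude, ← (G.admissibleEquiv r).tsum_eq]
  congr 2
  funext m
  exact G.weight_eq r p m.1

theorem amplitude_nonneg (r : ℕ) {p : ℝ} (h0 : 0 < p) (h1 : p < 1) : 0 ≤ G.amplitude r p := by
  have := modeNumber_pos h1
  rw [amplitude_eq]
  have : 0 ≤ ∑' X : G.RootedFlow r, p ^ G.dashedSum X.1 := tsum_nonneg fun _ => by positivity
  positivity

/-- A flow is determined by the root momentum and as many dashed momenta as there are independent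
faces. -/
theorem exists_determining_leaves : ∃ J : Finset G.tree.Leaf,
    J.card + 1 ≤ Module.finrank ℚ G.flowSpace ∧
    ∀ X Y : HalfEdge n → ℚ, G.IsFlow X → G.IsFlow Y → X (Sum.inl true) = Y (Sum.inl true) →
      (∀ l ∈ J, X (slotHalfEdge l.1) = Y (slotHalfEdge l.1)) → X = Y := by
  classical
  let ev : HalfEdge n → Module.Dual ℚ G.flowSpace := fun h =>
    (LinearMap.proj h : (HalfEdge n → ℚ) →ₗ[ℚ] ℚ).comp G.flowSpace.subtype
  have hev : ∀ h X, ev h X = X.1 h := fun _ _ => rfl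
  let e : Option G.tree.Leaf → Module.Dual ℚ G.flowSpace
    | none => ev (Sum.inl true)
    | some l => ev (slotHalfEdge l.1)
  have hne : e none ≠ 0 := by
    intro h
    have := LinearMap.congr_fun h (⟨fun _ => 1, G.isFlow_one⟩ : G.flowSpace)
    simp [e, hev] at this
  have hs : LinearIndepOn ℚ e {none} := by
    rw [linearIndepOn_singleton_iff]
    exact hne
  obtain ⟨b, -, hb, hspan, hlin⟩ := exists_linearIndepOn_extension hs (Set.subset_univ _)
  refine ⟨Finset.univ.filter fun l => some l ∈ b, ?_, ?_⟩
  · have h1 := LinearIndependent.fintype_card_le_finrank hlin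
    rw [Subspace.dual_finrank_eq] at h1
    refine le_trans (le_of_eq ?_) h1
    have h2 : b.toFinset = Finset.insertNone (Finset.univ.filter fun l => some l ∈ b) := by
      ext x
      rcases x with _ | l
      · simpa using hb
      · simp
    rw [← Set.toFinset_card, h2, Finset.card_insertNone]
  · intro X Y hX hY hr hl
    have hZ : (⟨X, hX⟩ - ⟨Y, hY⟩ : G.flowSpace) = 0 := by
      set Z : G.flowSpace := ⟨X, hX⟩ - ⟨Y, hY⟩ with hZdef
      have hZ' : ∀ h, Z.1 h = X h - Y h := fun _ => rfl
      have hspan' : ∀ φ ∈ Submodule.span ℚ (e '' b), φ Z = 0 := by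
        intro φ hφ
        induction hφ using Submodule.span_induction with
        | mem φ hφ =>
          obtain ⟨x, hx, rfl⟩ := hφ
          rcases x with _ | l
          · simp only [e, hev, hZ']; linarith
          · have := hl l (by simpa using hx)
            simp only [e, hev, hZ']; linarith
        | zero => rfl
        | add φ ψ _ _ h1 h2 => simp [h1, h2]
        | smul c φ _ h1 => simp [h1]
      refine Subtype.ext (IsFlow.eq_zero Z.2 fun l => ?_)
      exact hspan' (e (some l)) (hspan ⟨some l, trivial, rfl⟩)
    exact congrArg Subtype.val (sub_eq_zero.1 hZ)

variable {G} in
theorem IsFlow.root_le_dashedSum {X : HalfEdge n → ℕ} (hX : G.IsFlow X) :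
    X (Sum.inl true) ≤ G.dashedSum X := by
  rw [dashedSum, sum_leaf G hX]
  exact Nat.le_add_right _ _

/-- One half of the dashed momenta pays for the root momentum, the other half for the sum over
independent dashed momenta. -/
theorem amplitude_bound (r : ℕ) {p : ℝ} (h0 : 0 < p) (h1 : p < 1) :
    (Summable fun X : G.RootedFlow r => p ^ G.dashedSum X.1) ∧
      G.amplitude r p ≤ 2 ^ n * modeNumber p ^ (-G.degree) * p ^ ((r : ℝ) / 2) := by
  classical
  obtain ⟨J, hJ, hdet⟩ := G.exists_determining_leaves
  set q := Real.sqrt p with hq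
  have q0 : 0 < q := Real.sqrt_pos.2 h0
  have q1 : q < 1 := by rw [hq, Real.sqrt_lt' one_pos]; simpa using h1
  have qq : q ^ 2 = p := Real.sq_sqrt h0.le
  have hN := modeNumber_pos h1
  let ι : G.RootedFlow r → (J → ℕ) := fun X l => X.1 (slotHalfEdge l.1.1)
  have hι : Function.Injective ι := by
    intro X Y hXY
    have h2 := hdet (fun h => (X.1 h : ℚ)) (fun h => (Y.1 h : ℚ)) X.2.1.cast Y.2.1.cast
      (by simp only [X.2.2, Y.2.2]) (fun l hl => by
        have := congrFun hXY ⟨l, hl⟩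
        simp only [ι] at this
        rw [this])
    refine Subtype.ext (funext fun h => ?_)
    exact_mod_cast congrFun h2 h
  have hterm : ∀ X : G.RootedFlow r, p ^ G.dashedSum X.1 ≤ q ^ r * q ^ ∑ l, ι X l := by
    intro X
    rw [← qq, ← pow_mul, ← pow_add]
    refine pow_le_pow_of_le_one q0.le q1.le ?_
    have h2 : r ≤ G.dashedSum X.1 := X.2.2.symm.le.trans X.2.1.root_le_dashedSum
    have h3 : ∑ l, ι X l ≤ G.dashedSum X.1 := by
      simp only [ι]
      rw [Finset.sum_coe_sort J fun l => X.1 (slotHalfEdge l.1)]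
      exact Finset.sum_le_sum_of_subset (Finset.subset_univ _)
    omega
  have hgeo := hasSum_pow_sum J q0.le q1
  have hgeo' := hgeo.summable.comp_injective hι
  have hsum : Summable fun X : G.RootedFlow r => q ^ r * q ^ ∑ l, ι X l :=
    hgeo'.mul_left _
  have hS : Summable fun X : G.RootedFlow r => p ^ G.dashedSum X.1 :=
    Summable.of_nonneg_of_le (fun _ => by positivity) hterm hsum
  refine ⟨hS, ?_⟩
  have hle : ∑' X : G.RootedFlow r, p ^ G.dashedSum X.1 ≤ q ^ r * (1 - q)⁻¹ ^ J.card := by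
    refine (hS.tsum_le_tsum hterm hsum).trans ?_
    rw [tsum_mul_left]
    refine mul_le_mul_of_nonneg_left ?_ (by positivity)
    have := tsum_comp_le_tsum_of_inj hgeo.summable (fun _ => by positivity) hι
    refine this.trans ?_
    rw [hgeo.tsum_eq, Fintype.card_coe]
  have h2N : (1 - q)⁻¹ ≤ 2 * modeNumber p := by
    have e : modeNumber p = ((1 - q) * (1 + q))⁻¹ := by
      rw [modeNumber, ← qq, one_div]; congr 1; ring
    have h3 : 0 < 1 - q := by linarith
    rw [e, mul_inv]
    have h4 : (1 : ℝ) ≤ 2 * (1 + q)⁻¹ := by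
      rw [← div_eq_mul_inv, le_div_iff₀ (by linarith)]; linarith
    calc (1 - q)⁻¹ = (1 - q)⁻¹ * 1 := (mul_one _).symm
      _ ≤ (1 - q)⁻¹ * (2 * (1 + q)⁻¹) := mul_le_mul_of_nonneg_left h4 (by positivity)
      _ = _ := by ring
  have hN1 : 1 ≤ modeNumber p := by
    rw [modeNumber, le_div_iff₀ (by linarith)]; linarith
  obtain ⟨k, hk⟩ : ∃ k, Module.finrank ℚ G.flowSpace = k + 1 := ⟨_, (Nat.succ_pred_eq_of_pos
    (by omega)).symm⟩
  have hkn := G.finrank_flowSpace_le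
  have hJk : (1 - q)⁻¹ ^ J.card ≤ 2 ^ n * modeNumber p ^ k := by
    have h3 : (1 : ℝ) ≤ 2 * modeNumber p := by linarith
    calc (1 - q)⁻¹ ^ J.card ≤ (2 * modeNumber p) ^ J.card :=
          pow_le_pow_left₀ (inv_nonneg.2 (by linarith)) h2N _
      _ ≤ (2 * modeNumber p) ^ k := pow_le_pow_right₀ h3 (by omega)
      _ = 2 ^ k * modeNumber p ^ k := mul_pow _ _ _
      _ ≤ _ := by
          have : (2 : ℝ) ^ k ≤ 2 ^ n := pow_le_pow_right₀ one_le_two (by omega)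
          gcongr
  have hdeg : modeNumber p ^ (-G.degree) = 1 / modeNumber p ^ n * modeNumber p ^ k := by
    have : -G.degree = (k : ℤ) - n := by rw [degree_eq, hk]; push_cast; ring
    rw [this, zpow_sub₀ hN.ne', zpow_natCast, zpow_natCast]
    ring
  have hqr : p ^ ((r : ℝ) / 2) = q ^ r := by
    rw [hq, Real.sqrt_eq_rpow, ← Real.rpow_mul_natCast h0.le]
    congr 1; ring
  rw [amplitude_eq, hdeg, hqr]
  calc 1 / modeNumber p ^ n * ∑' X : G.RootedFlow r, p ^ G.dashedSum X.1
      ≤ 1 / modeNumber p ^ n * (q ^ r * (2 ^ n * modeNumber p ^ k)) := by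
        refine mul_le_mul_of_nonneg_left (hle.trans ?_) (by positivity)
        exact mul_le_mul_of_nonneg_left hJk (by positivity)
    _ = _ := by ring

theorem summable_weight (r : ℕ) {p : ℝ} (h0 : 0 < p) (h1 : p < 1) :
    Summable fun m : {m : Fin n → Momentum // G.Admissible r m} => G.weight r p m.1 := by
  have := (G.amplitude_bound r h0 h1).1
  rw [← (G.admissibleEquiv r).summable_iff] at this
  refine this.congr fun m => ?_
  exact (G.weight_eq r p m.1).symm

end Graph

/-! ### Melonic insertions in terms of half-edges -/

/-- Renaming of vertices on half-edges. -/
def HalfEdge.rename {n k : ℕ} (f : Fin n → Fin k) : HalfEdge n → HalfEdge k :=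
  Sum.map id (Prod.map f id)

@[simp]
theorem HalfEdge.rename_inl {n k : ℕ} (f : Fin n → Fin k) (b : Bool) :
    HalfEdge.rename f (Sum.inl b) = Sum.inl b := rfl

@[simp]
theorem HalfEdge.rename_inr {n k : ℕ} (f : Fin n → Fin k) (v : Fin n) (a : Fin 4) :
    HalfEdge.rename f (Sum.inr (v, a)) = Sum.inr (f v, a) := rfl

theorem HalfEdge.rename_injective {n k : ℕ} {f : Fin n → Fin k} (hf : Function.Injective f) :
    Function.Injective (HalfEdge.rename f) :=
  Function.injective_id.sumMap (hf.prodMap Function.injective_id)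

theorem slotHalfEdge_rename {n k : ℕ} (f : Fin n → Fin k) (s : Slot n) :
    Graph.slotHalfEdge (Slot.rename f s) = HalfEdge.rename f (Graph.slotHalfEdge s) := by
  rcases s with b | ⟨v, a⟩ <;> rfl

/-- `G'` arises from `G` by inserting a melon with vertices `x` and `y` on the edge with ends `s`
and `t`. The external half-edges of the melon are the parent half-edge of `x` and the
half-edge of `y` identified with it by the propagator. This covers all five types of insertions:
the type is determined by the propagator and by the kind of the edge. -/
structure InsertsMelon {n : ℕ} (G : Graph n) (G' : Graph (n + 2)) (f : Fin n ↪o Fin (n + 2))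
    (x y : Fin (n + 2)) (s t : HalfEdge n) : Prop extends AddsPair G G' f x y where
  mate_left : G.mate s = t
  mate_x : G'.mate (Sum.inr (x, 0)) = HalfEdge.rename f s
  mate_y : G'.mate (Sum.inr (y, G'.propagator x 0)) = HalfEdge.rename f t
  mate_inner : ∀ a, a ≠ 0 → G'.mate (Sum.inr (x, a)) = Sum.inr (y, G'.propagator x a)
  mate_old : ∀ h, h ≠ s → h ≠ t → G'.mate (HalfEdge.rename f h) = HalfEdge.rename f (G.mate h)

theorem fin_four_ne_zero (a : Fin 4) (ha : a ≠ 0) : a = 1 ∨ ∃ c, a = (upper c).succ := by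
  revert a; decide

theorem complement_perm_cases (π : Equiv.Perm (Fin 4))
    (hπ : ∀ a, π (complement a) = complement (π a)) :
    (π 0 = 0 ∧ π 1 = 1 ∧ ∃ b, ∀ c, π (upper c).succ = (upper (xor c b)).succ) ∨
    (π 0 = 1 ∧ π 1 = 0 ∧ ∃ b, ∀ c, π (upper c).succ = (upper (xor c b)).succ) ∨
    ∃ a b, π 0 = (upper b).succ ∧ π 1 = (upper (!b)).succ ∧ π (upper a).succ = 0 ∧
      π (upper (!a)).succ = 1 := by
  revert π; decide

section

variable {n : ℕ} {G : Graph n} {G' : Graph (n + 2)} {f : Fin n ↪o Fin (n + 2)}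
  {x y : Fin (n + 2)}

open MelonicTurbulence.Graph

theorem ReplacesDashed.mate_old {s t : Slot n} (h : ReplacesDashed G G' f s t) (g : HalfEdge n)
    (hs : g ≠ slotHalfEdge s) (ht : g ≠ slotHalfEdge t) :
    G'.mate (HalfEdge.rename f g) = HalfEdge.rename f (G.mate g) := by
  have key := G.isEdge_mate g
  generalize hg : G.mate g = g' at key
  cases key with
  | down v => rw [← slotHalfEdge_rename, ← h.solid_old, mate_parent]; rfl
  | up v => rw [← slotHalfEdge_rename, ← h.solid_old, ← mate_up]; rfl
  | dashed s' t' d =>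
    rw [← slotHalfEdge_rename, ← slotHalfEdge_rename]
    exact (h.dashed_old s' t' d (fun e => hs (by rw [e])) (fun e => ht (by rw [e]))).mate_eq

theorem ReplacesSolid.mate_old {u : Fin n} (h : ReplacesSolid G G' f u) (g : HalfEdge n)
    (hs : g ≠ slotHalfEdge (G.tree.parent u)) (ht : g ≠ Sum.inr (u, 0)) :
    G'.mate (HalfEdge.rename f g) = HalfEdge.rename f (G.mate g) := by
  have key := G.isEdge_mate g
  generalize hg : G.mate g = g' at key
  cases key with
  | down v =>
    have hv : v ≠ u := fun e => hs (by rw [e])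
    rw [← slotHalfEdge_rename, ← h.solid_old v hv, mate_parent]; rfl
  | up v =>
    have hv : v ≠ u := fun e => ht (by rw [e])
    rw [← slotHalfEdge_rename, ← h.solid_old v hv, ← mate_up]; rfl
  | dashed s' t' d =>
    rw [← slotHalfEdge_rename, ← slotHalfEdge_rename]
    exact (h.dashed_old s' t' d).mate_eq

theorem InteriorI.mate_inner {b : Bool} (h : InteriorI G' x y b) (a : Fin 4) (ha : a ≠ 0) :
    G'.mate (Sum.inr (x, a)) = Sum.inr (y, G'.propagator x a) := by
  rcases fin_four_ne_zero a ha with rfl | ⟨c, rfl⟩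
  · rw [h.lead_one]; exact h.dashed_lower.mate_eq
  · rw [h.lead_upper]; exact (h.dashed_upper c).mate_eq

theorem InteriorII.mate_inner {b : Bool} (h : InteriorII G' x y b) (a : Fin 4) (ha : a ≠ 0) :
    G'.mate (Sum.inr (x, a)) = Sum.inr (y, G'.propagator x a) := by
  rcases fin_four_ne_zero a ha with rfl | ⟨c, rfl⟩
  · rw [h.lead_one, ← mate_parent, h.solid]; rfl
  · rw [h.lead_upper]; exact (h.dashed_upper c).mate_eq

theorem InteriorIII.mate_inner {a b : Bool} (h : InteriorIII G' x y a b) (c : Fin 4)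
    (hc : c ≠ 0) : G'.mate (Sum.inr (x, c)) = Sum.inr (y, G'.propagator x c) := by
  rcases fin_four_ne_zero c hc with rfl | ⟨c, rfl⟩
  · rw [h.lead_one]; exact h.dashed_left.mate_eq
  · by_cases hca : c = a
    · subst hca
      rw [h.lead_upper, ← mate_parent, h.solid]; rfl
    · obtain rfl : c = !a := by cases a <;> cases c <;> simp_all
      rw [h.lead_upper']; exact h.dashed_right.mate_eq

theorem MelonicInsertion.insertsMelon (h : MelonicInsertion G G') :
    ∃ f x y s t, InsertsMelon G G' f x y s t := by
  cases h with
  | typeI f x y s t b pair old interior left right =>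
    exact ⟨f, x, y, slotHalfEdge s, slotHalfEdge t, pair, old.edge.mate_eq,
      by rw [mate_up, left, slotHalfEdge_rename],
      by rw [interior.lead_zero, mate_up, right, slotHalfEdge_rename],
      interior.mate_inner, old.mate_old⟩
  | typeII f x y s t b pair old interior left right =>
    exact ⟨f, x, y, slotHalfEdge s, slotHalfEdge t, pair, old.edge.mate_eq,
      by rw [mate_up, left, slotHalfEdge_rename],
      by rw [interior.lead_zero, ← slotHalfEdge_rename]; exact right.mate_eq,
      interior.mate_inner, old.mate_old⟩
  | typeIII f x y s t a b pair old interior left right =>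
    exact ⟨f, x, y, slotHalfEdge s, slotHalfEdge t, pair, old.edge.mate_eq,
      by rw [mate_up, left, slotHalfEdge_rename],
      by rw [interior.lead_zero, ← slotHalfEdge_rename]; exact right.mate_eq,
      interior.mate_inner, old.mate_old⟩
  | typeIIs f x y u b pair old interior left right =>
    exact ⟨f, x, y, slotHalfEdge (G.tree.parent u), Sum.inr (u, 0), pair, G.mate_parent u,
      by rw [mate_up, left, slotHalfEdge_rename],
      by rw [interior.lead_zero, HalfEdge.rename_inr, ← mate_parent, right]; rfl,
      interior.mate_inner, old.mate_old⟩
  | typeIIIs f x y u a b pair old interior left right =>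
    exact ⟨f, x, y, slotHalfEdge (G.tree.parent u), Sum.inr (u, 0), pair, G.mate_parent u,
      by rw [mate_up, left, slotHalfEdge_rename],
      by rw [interior.lead_zero, HalfEdge.rename_inr, ← mate_parent, right]; rfl,
      interior.mate_inner, old.mate_old⟩

namespace InsertsMelon

variable {s t : HalfEdge n} (I : InsertsMelon G G' f x y s t)
include I

theorem ne : x ≠ y := fun h => G'.wavy_ne x (I.wavy_new.trans h.symm)

theorem vertex_cases (v : Fin (n + 2)) : v = x ∨ v = y ∨ ∃ u, v = f u := by
  classical
  by_contra hv
  simp only [not_or, not_exists] at hv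
  have h1 : Finset.univ.image f ⊆ ({x, y, v} : Finset (Fin (n + 2)))ᶜ := by
    intro w hw
    obtain ⟨u, -, rfl⟩ := Finset.mem_image.1 hw
    simp [I.ne_x u, I.ne_y u, Ne.symm (hv.2.2 u)]
  have h2 := Finset.card_le_card h1
  have h3 : ({x, y, v} : Finset (Fin (n + 2))).card = 3 :=
    Finset.card_eq_three.2 ⟨x, y, v, I.ne, Ne.symm hv.1, Ne.symm hv.2.1, rfl⟩
  rw [Finset.card_image_of_injective _ f.injective, Finset.card_compl, h3] at h2
  have h4 := Finset.card_le_univ ({x, y, v} : Finset (Fin (n + 2)))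
  rw [h3] at h4
  simp only [Finset.card_univ, Fintype.card_fin] at h2 h4
  omega

theorem halfEdge_cases (h : HalfEdge (n + 2)) : (∃ g, h = HalfEdge.rename f g) ∨
    (∃ a, h = Sum.inr (x, a)) ∨ ∃ a, h = Sum.inr (y, G'.propagator x a) := by
  rcases h with b | ⟨v, a⟩
  · exact Or.inl ⟨Sum.inl b, rfl⟩
  · rcases I.vertex_cases v with rfl | rfl | ⟨u, rfl⟩
    · exact Or.inr (Or.inl ⟨a, rfl⟩)
    · exact Or.inr (Or.inr ⟨(G'.propagator x).symm a, by simp⟩)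
    · exact Or.inl ⟨Sum.inr (u, a), rfl⟩

theorem mate_right : G.mate t = s := by rw [← I.mate_left, mate_mate]

theorem mate_rename_left : G'.mate (HalfEdge.rename f s) = Sum.inr (x, 0) := by
  rw [← I.mate_x, mate_mate]

theorem mate_rename_right :
    G'.mate (HalfEdge.rename f t) = Sum.inr (y, G'.propagator x 0) := by
  rw [← I.mate_y, mate_mate]

theorem mate_inner' (a : Fin 4) (ha : a ≠ 0) :
    G'.mate (Sum.inr (y, G'.propagator x a)) = Sum.inr (x, a) := by
  rw [← I.mate_inner a ha, mate_mate]

theorem turn_rename (h : HalfEdge n) :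
    G'.turn (HalfEdge.rename f h) = HalfEdge.rename f (G.turn h) := by
  rcases h with b | ⟨v, a⟩
  · rfl
  · simp [turn, I.wavy_old, I.propagator_old]

theorem turn_x (a : Fin 4) : G'.turn (Sum.inr (x, a)) = Sum.inr (y, G'.propagator x a) := by
  simp [turn, I.wavy_new]

theorem turn_y (a : Fin 4) : G'.turn (Sum.inr (y, G'.propagator x a)) = Sum.inr (x, a) := by
  rw [← I.turn_x, turn_turn]

/-- Insertions on half-edges are melonic insertions: the propagator tells the type of the melon. -/
theorem melonicInsertion : MelonicInsertion G G' := by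
  obtain ⟨s₀, rfl⟩ : ∃ s₀, s = slotHalfEdge s₀ := by
    rcases MelonicTurbulence.halfEdge_cases s with ⟨u, rfl⟩ | hs
    · have := I.mate_x
      rw [mate_up] at this
      exact absurd this (slotHalfEdge_ne_up _ _)
    · exact hs
  have left : G'.tree.parent x = Slot.rename f s₀ := by
    rw [parent_eq_iff_mate, I.mate_x, slotHalfEdge_rename]
  have hπ := G'.propagator_complement x
  have lower : G'.mate (Sum.inr (x, 1)) = Sum.inr (y, G'.propagator x 1) :=
    I.mate_inner 1 (by decide)
  have upp : ∀ c, G'.mate (Sum.inr (x, (upper c).succ)) =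
      Sum.inr (y, G'.propagator x (upper c).succ) := fun c => I.mate_inner _ (Fin.succ_ne_zero _)
  rcases MelonicTurbulence.halfEdge_cases t with ⟨u, rfl⟩ | ⟨t₀, rfl⟩
  · have hu : G.tree.parent u = s₀ := by rw [parent_eq_iff_mate, I.mate_right]
    subst hu
    have old : ReplacesSolid G G' f u := by
      constructor
      · intro v hv
        rw [parent_eq_iff_mate, slotHalfEdge_rename, ← mate_up]
        exact I.mate_old (Sum.inr (v, 0)) (fun h => slotHalfEdge_ne_up _ _ h.symm)
          (fun h => hv (by simpa using h))
      · intro s' t' d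
        rw [dashed_iff_mate, slotHalfEdge_rename, slotHalfEdge_rename, ← d.mate_eq]
        refine I.mate_old _ (fun h => d.left_free ⟨u, (slotHalfEdge_injective n h).symm⟩)
          (slotHalfEdge_ne_up _ _)
    have ext := I.mate_rename_right
    rcases complement_perm_cases _ hπ with ⟨h0, h1, b, hb⟩ | ⟨h0, h1, b, hb⟩ |
      ⟨a, b, h0, h1, h2, h3⟩
    · rw [h0, HalfEdge.rename_inr, mate_up] at ext
      exact absurd ext (slotHalfEdge_ne_up _ _)
    · refine .typeIIs f x y u b I.toAddsPair old ⟨?_, ?_, h0, h1, hb⟩ left ?_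
      · rw [parent_eq_iff_mate, ← h1, ← lower, mate_mate]; rfl
      · intro c
        rw [dashed_iff_mate]
        exact (upp c).trans (by rw [hb]; rfl)
      · rw [parent_eq_iff_mate]; exact ext.trans (by rw [h0]; rfl)
    · refine .typeIIIs f x y u a b I.toAddsPair old ⟨?_, ?_, ?_, h0, h1, h2, h3⟩ left ?_
      · rw [parent_eq_iff_mate, ← h2, ← upp, mate_mate]; rfl
      · rw [dashed_iff_mate]
        exact lower.trans (by rw [h1]; rfl)
      · rw [dashed_iff_mate]
        exact (upp _).trans (by rw [h3]; rfl)
      · rw [parent_eq_iff_mate]; exact ext.trans (by rw [h0]; rfl)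
  · have old : ReplacesDashed G G' f s₀ t₀ := by
      constructor
      · rw [dashed_iff_mate, I.mate_left]
      · intro v
        rw [parent_eq_iff_mate, slotHalfEdge_rename, ← mate_up]
        exact I.mate_old (Sum.inr (v, 0)) (fun h => slotHalfEdge_ne_up _ _ h.symm)
          (fun h => slotHalfEdge_ne_up _ _ h.symm)
      · intro s' t' d hs ht
        rw [dashed_iff_mate, slotHalfEdge_rename, slotHalfEdge_rename, ← d.mate_eq]
        exact I.mate_old _ (fun h => hs (slotHalfEdge_injective n h))
          (fun h => ht (slotHalfEdge_injective n h))
    have ext := I.mate_y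
    rw [← slotHalfEdge_rename] at ext
    rcases complement_perm_cases _ hπ with ⟨h0, h1, b, hb⟩ | ⟨h0, h1, b, hb⟩ |
      ⟨a, b, h0, h1, h2, h3⟩
    · refine .typeI f x y s₀ t₀ b I.toAddsPair old ⟨?_, ?_, h0, h1, hb⟩ left ?_
      · rw [dashed_iff_mate]
        exact lower.trans (by rw [h1]; rfl)
      · intro c
        rw [dashed_iff_mate]
        exact (upp c).trans (by rw [hb]; rfl)
      · rw [parent_eq_iff_mate, ← ext, h0]
    · refine .typeII f x y s₀ t₀ b I.toAddsPair old ⟨?_, ?_, h0, h1, hb⟩ left ?_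
      · rw [parent_eq_iff_mate, ← h1, ← lower, mate_mate]; rfl
      · intro c
        rw [dashed_iff_mate]
        exact (upp c).trans (by rw [hb]; rfl)
      · rw [dashed_iff_mate, ← ext, h0]; rfl
    · refine .typeIII f x y s₀ t₀ a b I.toAddsPair old ⟨?_, ?_, ?_, h0, h1, h2, h3⟩ left ?_
      · rw [parent_eq_iff_mate, ← h2, ← upp, mate_mate]; rfl
      · rw [dashed_iff_mate]
        exact lower.trans (by rw [h1]; rfl)
      · rw [dashed_iff_mate]
        exact (upp _).trans (by rw [h3]; rfl)
      · rw [dashed_iff_mate, ← ext, h0]; rfl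

/-- A flow of the larger graph restricts to the smaller one, since a melon conserves the momentum
of its external face. -/
theorem isFlow_restrict {R : Type*} [Add R] {X : HalfEdge (n + 2) → R} (hX : G'.IsFlow X) :
    G.IsFlow fun h => X (HalfEdge.rename f h) where
  mate h := by
    have ext : X (HalfEdge.rename f s) = X (HalfEdge.rename f t) := by
      rw [← I.mate_x, hX.mate, ← I.mate_y, hX.mate, ← I.turn_x, hX.turn]
    by_cases hs : h = s
    · rw [hs, I.mate_left, ext]
    by_cases ht : h = t
    · rw [ht, I.mate_right, ext]
    rw [← I.mate_old h hs ht, hX.mate]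
  turn h := by rw [← I.turn_rename, hX.turn]
  node v := hX.node (f v)

theorem exists_extension {R : Type*} (X : HalfEdge n → R) (g : Fin 4 → R) :
    ∃ X' : HalfEdge (n + 2) → R, (∀ h, X' (HalfEdge.rename f h) = X h) ∧
      (∀ a, X' (Sum.inr (x, a)) = g a) ∧
      ∀ a, X' (Sum.inr (y, G'.propagator x a)) = g a := by
  classical
  have hF := HalfEdge.rename_injective f.injective
  refine ⟨fun h => if hh : ∃ k, HalfEdge.rename f k = h then X hh.choose else
    match h with
    | Sum.inl _ => g 0
    | Sum.inr (v, c) => if v = x then g c else g ((G'.propagator x).symm c), ?_, ?_, ?_⟩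
  · intro h
    have hh : ∃ k, HalfEdge.rename f k = HalfEdge.rename f h := ⟨h, rfl⟩
    simp only [dif_pos hh]
    rw [hF hh.choose_spec]
  · intro a
    have : ¬ ∃ k, HalfEdge.rename f k = Sum.inr (x, a) := by
      rintro ⟨b | ⟨u, c⟩, h⟩ <;> simp [I.ne_x] at h
    simp only [dif_neg this, if_true]
  · intro a
    have : ¬ ∃ k, HalfEdge.rename f k = Sum.inr (y, G'.propagator x a) := by
      rintro ⟨b | ⟨u, c⟩, h⟩ <;> simp [I.ne_y] at h
    simp only [dif_neg this, if_neg I.ne.symm, Equiv.symm_apply_apply]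

theorem isFlow_extend {R : Type*} [AddCommMonoid R] {X' : HalfEdge (n + 2) → R} {g : Fin 4 → R}
    (hX : G.IsFlow fun h => X' (HalfEdge.rename f h)) (hx : ∀ a, X' (Sum.inr (x, a)) = g a)
    (hy : ∀ a, X' (Sum.inr (y, G'.propagator x a)) = g a)
    (h0 : g 0 = X' (HalfEdge.rename f s)) (hg : g 0 + g 1 = g 2 + g 3) : G'.IsFlow X' where
  mate h := by
    have hst := hX.mate s
    rw [I.mate_left] at hst
    rcases I.halfEdge_cases h with ⟨k, rfl⟩ | ⟨a, rfl⟩ | ⟨a, rfl⟩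
    · by_cases hs : k = s
      · rw [hs, I.mate_rename_left, hx, h0]
      by_cases ht : k = t
      · rw [ht, I.mate_rename_right, hy, h0, hst]
      rw [I.mate_old k hs ht]
      exact hX.mate k
    · by_cases ha : a = 0
      · rw [ha, I.mate_x, hx, h0]
      · rw [I.mate_inner a ha, hx, hy]
    · by_cases ha : a = 0
      · rw [ha, I.mate_y, hy, h0, hst]
      · rw [I.mate_inner' a ha, hx, hy]
  turn h := by
    rcases I.halfEdge_cases h with ⟨k, rfl⟩ | ⟨a, rfl⟩ | ⟨a, rfl⟩
    · rw [I.turn_rename]; exact hX.turn k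
    · rw [I.turn_x, hx, hy]
    · rw [I.turn_y, hx, hy]
  node v := by
    rcases I.vertex_cases v with rfl | rfl | ⟨u, rfl⟩
    · simpa only [hx] using hg
    · have hinv : ∀ a, (G'.propagator x)⁻¹ (complement a) = complement ((G'.propagator x)⁻¹ a) := by
        intro a
        rw [← G'.propagator_wavy]
        exact G'.propagator_complement _ a
      have := complement_perm_sum hinv g hg
      have e : ∀ a, X' (Sum.inr (v, a)) = g ((G'.propagator x)⁻¹ a) := by
        intro a
        rw [← hy]; simp
      rw [e, e, e, e, this.1, this.2]
    · exact hX.node u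

end InsertsMelon

end

/-! ### The lower bound on melonic amplitudes -/

/-- The flows of a melonic graph contain an injective image of `ℕ ^ n`, along which all momenta are
bounded by the sum of the root momentum and the parameters: a melon on an edge of momentum `e` is
given the momenta `e, a + b, e + a, b`. -/
theorem IsMelonic.exists_flows {n : ℕ} {G : Graph n} (hG : IsMelonic G) (r : ℕ) :
    ∃ Φ : (Fin n → ℕ) → (HalfEdge n → ℕ), Function.Injective Φ ∧
      ∀ a, G.IsFlow (Φ a) ∧ Φ a (Sum.inl true) = r ∧ ∀ h, Φ a h ≤ r + ∑ i, a i := by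
  induction hG with
  | trivial G =>
    refine ⟨fun _ _ => r, fun a b _ => funext fun i => i.elim0, fun a => ⟨⟨fun _ => rfl,
      fun _ => rfl, fun v => v.elim0⟩, rfl, fun h => Nat.le_add_right _ _⟩⟩
  | @insertion n G G' _ hI ih =>
    obtain ⟨Φ, hinj, hΦ⟩ := ih
    obtain ⟨f, x, y, s, t, I⟩ := hI.insertsMelon
    let old : (Fin (n + 2) → ℕ) → (Fin n → ℕ) := fun a i => a i.castSucc.castSucc
    let g : (Fin (n + 2) → ℕ) → Fin 4 → ℕ := fun a => ![Φ (old a) s,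
      a (Fin.last n).castSucc + a (Fin.last (n + 1)), Φ (old a) s + a (Fin.last n).castSucc,
      a (Fin.last (n + 1))]
    choose Ψ h1 h2 h3 using fun a => I.exists_extension (Φ (old a)) (g a)
    refine ⟨Ψ, ?_, fun a => ⟨?_, ?_, ?_⟩⟩
    · intro a b hab
      have hold : old a = old b := by
        refine hinj (funext fun h => ?_)
        rw [← h1, ← h1, hab]
      have e3 : g a 3 = g b 3 := by rw [← h2, ← h2, hab]
      have e2 : g a 2 = g b 2 := by rw [← h2, ← h2, hab]
      simp only [g, Matrix.cons_val, hold] at e2 e3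
      funext i
      refine Fin.lastCases e3 (fun i => ?_) i
      refine Fin.lastCases ?_ (fun i => ?_) i
      · omega
      · exact congrFun hold i
    · refine I.isFlow_extend ?_ (h2 a) (h3 a) ?_ ?_
      · have : (fun h => Ψ a (HalfEdge.rename f h)) = Φ (old a) := funext (h1 a)
        rw [this]
        exact (hΦ _).1
      · rw [h1]; rfl
      · simp only [g, Matrix.cons_val]; omega
    · rw [← (hΦ (old a)).2.1, ← h1]; rfl
    · have hsum : ∑ i, a i = ∑ i, old a i + a (Fin.last n).castSucc + a (Fin.last (n + 1)) := by
        rw [Fin.sum_univ_castSucc, Fin.sum_univ_castSucc]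
      have hg : ∀ c, g a c ≤ r + ∑ i, a i := by
        have := (hΦ (old a)).2.2 s
        intro c
        fin_cases c <;> simp [g] <;> omega
      intro h
      rcases I.halfEdge_cases h with ⟨k, rfl⟩ | ⟨c, rfl⟩ | ⟨c, rfl⟩
      · rw [h1]
        have := (hΦ (old a)).2.2 k
        omega
      · rw [h2]; exact hg c
      · rw [h3]; exact hg c

theorem IsMelonic.le_amplitude {n : ℕ} {G : Graph n} (hG : IsMelonic G) (r : ℕ) {p : ℝ}
    (h0 : 0 < p) (h1 : p < 1) :
    p ^ ((2 * n + 1) * r) / (2 * (n : ℝ) + 1) ^ n ≤ G.amplitude r p := by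
  obtain ⟨Φ, hinj, hΦ⟩ := hG.exists_flows r
  have hN := modeNumber_pos h1
  set P := p ^ (n + 1) with hP
  have P0 : 0 < P := by positivity
  have P1 : P < 1 := pow_lt_one₀ h0.le h1 (by omega)
  let ι : (Fin n → ℕ) → G.RootedFlow r := fun a => ⟨Φ a, (hΦ a).1, (hΦ a).2.1⟩
  have hι : Function.Injective ι := fun a b h => hinj (congrArg Subtype.val h)
  have hS := (G.amplitude_bound r h0 h1).1
  have hgeo := (hasSum_pow_sum_fin n P0.le P1).mul_left (P ^ r)
  have hterm : ∀ a, P ^ r * P ^ ∑ i, a i ≤ p ^ G.dashedSum (ι a).1 := by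
    intro a
    rw [hP, ← pow_add, ← pow_mul]
    refine pow_le_pow_of_le_one h0.le h1.le ?_
    refine (Finset.sum_le_card_nsmul _ _ _ fun l _ => (hΦ a).2.2 _).trans_eq ?_
    rw [Finset.card_univ, G.card_leaf, smul_eq_mul]
  have hle : P ^ r * (1 - P)⁻¹ ^ n ≤ ∑' X : G.RootedFlow r, p ^ G.dashedSum X.1 := by
    rw [← hgeo.tsum_eq]
    refine (hgeo.summable.tsum_le_tsum hterm (hS.comp_injective hι)).trans ?_
    exact tsum_comp_le_tsum_of_inj hS (fun _ => by positivity) hι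
  have hB : modeNumber p / (2 * n + 1) ≤ (1 - P)⁻¹ := by
    have hb := one_add_mul_le_pow (a := p - 1) (by linarith) (n + 1)
    have h2 : 1 - P ≤ (2 * n + 1) * (1 - p) := by
      rw [hP]
      have e : 1 + (p - 1) = p := by ring
      rw [e] at hb
      push_cast at hb
      nlinarith [mul_nonneg (Nat.cast_nonneg (α := ℝ) n) (by linarith : (0 : ℝ) ≤ 1 - p)]
    rw [modeNumber, div_div, one_div]
    refine inv_anti₀ (by linarith) ?_
    rw [mul_comm]
    exact h2
  rw [Graph.amplitude_eq]
  have hPr : p ^ ((2 * n + 1) * r) ≤ P ^ r := by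
    rw [hP, ← pow_mul]
    exact pow_le_pow_of_le_one h0.le h1.le (Nat.mul_le_mul_right _ (by omega))
  calc p ^ ((2 * n + 1) * r) / (2 * (n : ℝ) + 1) ^ n
      ≤ P ^ r / (2 * (n : ℝ) + 1) ^ n := by gcongr
    _ = 1 / modeNumber p ^ n * (P ^ r * (modeNumber p / (2 * n + 1)) ^ n) := by
        rw [div_pow]
        field_simp
    _ ≤ 1 / modeNumber p ^ n * (P ^ r * (1 - P)⁻¹ ^ n) := by gcongr
    _ ≤ _ := by gcongr

/-- A positive degree would make the amplitude at zero root momentum small. -/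
theorem IsMelonic.degree_eq_zero {n : ℕ} {G : Graph n} (hG : IsMelonic G) : G.degree = 0 := by
  by_contra hne
  have hd : 1 ≤ G.degree := by
    have := G.degree_nonneg
    omega
  set M : ℝ := 2 ^ n * (2 * (n : ℝ) + 1) ^ n + 1 with hM
  have hM1 : 1 < M := by
    have : (0 : ℝ) < 2 ^ n * (2 * (n : ℝ) + 1) ^ n := by positivity
    linarith
  set p : ℝ := 1 - 1 / M with hp
  have hM0 : 0 < M := by linarith
  have h0 : 0 < p := by
    have : 1 / M < 1 := by rw [div_lt_one hM0]; exact hM1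
    linarith
  have h1 : p < 1 := by
    have : 0 < 1 / M := by positivity
    linarith
  have hN : modeNumber p = M := by rw [modeNumber, hp]; field_simp; ring
  have hl := hG.le_amplitude 0 h0 h1
  have hu := (G.amplitude_bound 0 h0 h1).2
  rw [hN] at hu
  simp only [mul_zero, pow_zero, CharP.cast_eq_zero, zero_div, Real.rpow_zero, mul_one] at hl hu
  have hz : M ^ (-G.degree) ≤ M⁻¹ := by
    rw [← zpow_neg_one]
    exact zpow_le_zpow_right₀ hM1.le (by omega)
  have h2 : 1 / (2 * (n : ℝ) + 1) ^ n ≤ 2 ^ n * M⁻¹ :=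
    (hl.trans hu).trans (mul_le_mul_of_nonneg_left hz (by positivity))
  rw [← div_eq_mul_inv, div_le_div_iff₀ (by positivity) hM0] at h2
  linarith

/-! ### Two-edge cuts and elementary melons -/

theorem xor_exchange {a b c d : Prop} (h : Xor a b ↔ Xor c d) : Xor a c ↔ Xor b d := by
  by_cases a <;> by_cases b <;> by_cases c <;> by_cases d <;> simp_all [Xor]

theorem xor_xor_interchange {a b c d : Prop} :
    Xor (Xor a b) (Xor c d) ↔ Xor (Xor a c) (Xor b d) := by
  by_cases a <;> by_cases b <;> by_cases c <;> by_cases d <;> simp_all [Xor]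

namespace Graph

variable {n : ℕ} (G : Graph n)

theorem boundary_nonempty {C : Finset (Fin n)} (hC : C.Nonempty) : (G.boundary C).Nonempty := by
  refine ⟨Sum.inr (C.min' hC, 0), (G.mem_boundary).2 ⟨C.min'_mem hC, fun h => ?_⟩⟩
  rw [mate_up] at h
  rcases hp : G.tree.parent (C.min' hC) with b | ⟨u, a⟩ <;> rw [hp] at h
  · exact h
  · exact absurd (G.tree.heap _ u a hp) (C.min'_le u h).not_gt

/-- A single edge cannot separate a set of vertices, since no constant flow could pass it. -/
theorem two_le_card_boundary {C : Finset (Fin n)} (hC : C.Nonempty) :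
    2 ≤ (G.boundary C).card := by
  have h0 := (G.boundary_nonempty hC).card_pos
  have h1 : (G.boundary C).card ≠ 1 := by
    intro h
    obtain ⟨k, hk⟩ := Finset.card_eq_one.1 h
    have := G.sum_boundary G.isFlow_one C
    rw [hk, Finset.sum_singleton, mul_one] at this
    exact G.orientation_ne_zero k this
  omega

theorem inside_inter {B C : Finset (Fin n)} (h : HalfEdge n) :
    Inside (B ∩ C) h ↔ Inside B h ∧ Inside C h := by
  rcases h with b | ⟨v, a⟩ <;> simp [Inside]

theorem inside_union {B C : Finset (Fin n)} (h : HalfEdge n) :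
    Inside (B ∪ C) h ↔ Inside B h ∨ Inside C h := by
  rcases h with b | ⟨v, a⟩ <;> simp [Inside]

theorem inside_symmDiff {B C : Finset (Fin n)} (h : HalfEdge n) :
    Inside (symmDiff B C) h ↔ Xor (Inside B h) (Inside C h) := by
  rcases h with b | ⟨v, a⟩
  · simp [Inside, Xor]
  · simp [Inside, Finset.mem_symmDiff, Xor]

theorem card_boundary_submodular (B C : Finset (Fin n)) :
    (G.boundary (B ∩ C)).card + (G.boundary (B ∪ C)).card ≤
      (G.boundary B).card + (G.boundary C).card := by
  classical
  rw [← Finset.card_union_add_card_inter, ← Finset.card_union_add_card_inter (G.boundary B)]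
  refine Nat.add_le_add (Finset.card_le_card fun h hh => ?_) (Finset.card_le_card fun h hh => ?_) <;>
  · simp only [Finset.mem_union, Finset.mem_inter, mem_boundary, inside_inter, inside_union] at hh ⊢
    tauto

/-- The edge of `k` leaves `C`. -/
def Crosses (C : Finset (Fin n)) (k : HalfEdge n) : Prop :=
  Xor (Inside C k) (Inside C (G.mate k))

/-- `h` and `k` belong to the same edge. -/
def SameEdge (h k : HalfEdge n) : Prop := k = h ∨ k = G.mate h

theorem crosses_mate {C : Finset (Fin n)} {k : HalfEdge n} :
    G.Crosses C (G.mate k) ↔ G.Crosses C k := by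
  rw [Crosses, Crosses, mate_mate, xor_comm]

theorem sameEdge_mate {h k : HalfEdge n} : G.SameEdge h (G.mate k) ↔ G.SameEdge h k := by
  unfold SameEdge
  rw [G.mate_injective.eq_iff]
  constructor
  · rintro (h | h)
    · right; rw [← h, mate_mate]
    · left; exact h
  · rintro (h | h)
    · right; exact h
    · left; rw [h, mate_mate]

/-- A flow that is carried by a single dashed edge, as far as dashed edges are concerned. -/
structure IsUnitFlow (l : G.tree.Leaf) (X : HalfEdge n → ℚ) : Prop where
  isFlow : G.IsFlow X
  self : X (slotHalfEdge l.1) = 1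
  other : ∀ l', l' ≠ l → X (slotHalfEdge l'.1) = 0

/-- In degree zero the dashed momenta are independent. -/
theorem exists_isUnitFlow (hd : G.degree = 0) (l : G.tree.Leaf) : ∃ X, G.IsUnitFlow l X := by
  classical
  have h1 : Module.finrank ℚ G.flowSpace = Module.finrank ℚ (G.tree.Leaf → ℚ) := by
    rw [Module.finrank_fintype_fun_eq_card, card_leaf]
    rw [degree_eq] at hd
    omega
  obtain ⟨X, hX⟩ := (LinearMap.injective_iff_surjective_of_finrank_eq_finrank h1).1
    G.leafMomentum_injective (Pi.single l 1)
  have hX' : ∀ l', X.1 (slotHalfEdge l'.1) = (Pi.single l 1 : G.tree.Leaf → ℚ) l' :=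
    fun l' => congrFun hX l'
  exact ⟨X.1, X.2, by simp [hX'], fun l' hl' => by simp [hX', hl']⟩

/-- The solid edge above `v` carries a unit flow if and only if the dashed edge of the flow joins
the branch of `v` to the rest of the tree. -/
theorem IsUnitFlow.up_ne_zero_iff {l : G.tree.Leaf} {X : HalfEdge n → ℚ} (hX : G.IsUnitFlow l X)
    (v : Fin n) : X (Sum.inr (v, 0)) ≠ 0 ↔ G.Crosses (G.branch v) (slotHalfEdge l.1) := by
  have hsum := G.sum_boundary hX.isFlow (G.branch v)
  have hmem : (Sum.inr (v, 0) : HalfEdge n) ∈ G.boundary (G.branch v) :=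
    (G.mem_boundary).2 ⟨(inside_inr _ _ _).2 (G.self_mem_branch v), G.mate_up_not_inside_branch v⟩
  have hzero : ∀ k ∈ G.boundary (G.branch v), k ≠ Sum.inr (v, 0) →
      ¬ G.SameEdge (slotHalfEdge l.1) k → X k = 0 := by
    intro k hk hne hS
    rcases G.eq_up_or_dashed_of_mem_boundary_branch hk with h1 | ⟨l', h1 | h1⟩
    · exact absurd h1 hne
    · rw [h1]
      refine hX.other l' fun e => hS (Or.inl (by rw [h1, e]))
    · rw [← hX.isFlow.mate, h1]
      refine hX.other l' fun e => hS (Or.inr ?_)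
      rw [← e, ← h1, mate_mate]
  constructor
  · intro h
    by_contra hc
    refine h ?_
    rw [Finset.sum_eq_single_of_mem _ hmem] at hsum
    · exact (mul_eq_zero.1 hsum).resolve_left (G.orientation_ne_zero _)
    · intro k hk hne
      rw [hzero k hk hne, mul_zero]
      intro hS
      rw [mem_boundary] at hk
      have hck : G.Crosses (G.branch v) k := Or.inl hk
      rcases hS with rfl | rfl
      · exact hc hck
      · exact hc ((G.crosses_mate).1 hck)
  · intro hc
    obtain ⟨k, hk, hS⟩ : ∃ k ∈ G.boundary (G.branch v), G.SameEdge (slotHalfEdge l.1) k := by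
      rcases hc with h | h
      · exact ⟨_, (G.mem_boundary).2 h, Or.inl rfl⟩
      · exact ⟨G.mate (slotHalfEdge l.1), (G.mem_boundary).2 (by rwa [mate_mate]), Or.inr rfl⟩
    have hkX : X k = 1 := by
      rcases hS with rfl | rfl
      · exact hX.self
      · rw [hX.isFlow.mate, hX.self]
    have hkv : k ≠ Sum.inr (v, 0) := by
      rintro rfl
      rcases hS with h | h
      · exact slotHalfEdge_ne_up _ _ h.symm
      · have hl : slotHalfEdge l.1 = slotHalfEdge (G.tree.parent v) := by
          rw [← mate_up, h, mate_mate]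
        exact l.2.1 ⟨v, (slotHalfEdge_injective n hl).symm⟩
    rw [Finset.sum_eq_add_of_mem _ _ hmem hk hkv.symm] at hsum
    · intro h0
      rw [h0, hkX, mul_zero, zero_add, mul_one] at hsum
      exact G.orientation_ne_zero k hsum
    · intro c hc' hne
      rw [hzero c hc' hne.1, mul_zero]
      intro hS'
      rw [mem_boundary] at hk hc'
      have : c = k ∨ c = G.mate k := by
        rcases hS with rfl | rfl <;> rcases hS' with rfl | rfl <;> simp
      rcases this with rfl | rfl
      · exact hne.2 rfl
      · exact hk.2 hc'.1

/-- The branch below a solid edge, or the empty set for a dashed edge: unit flows through the edge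
are those whose dashed edge crosses it or is the edge itself. -/
theorem exists_fundamental_cut (h : HalfEdge n) : ∃ C : Finset (Fin n),
    (∀ u, G.Crosses C (Sum.inr (u, 0)) ↔ G.SameEdge h (Sum.inr (u, 0))) ∧
    ∀ l X, G.IsUnitFlow l X →
      (X h ≠ 0 ↔ Xor (G.Crosses C (slotHalfEdge l.1)) (G.SameEdge h (slotHalfEdge l.1))) := by
  rcases G.edge_cases h with ⟨v, hv⟩ | ⟨l₀, hl⟩
  · have hS : ∀ k, G.SameEdge h k ↔ G.SameEdge (Sum.inr (v, 0)) k := by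
      intro k
      rcases hv with rfl | hv
      · rfl
      · have e : h = G.mate (Sum.inr (v, 0)) := by rw [← hv, mate_mate]
        rw [e, SameEdge, SameEdge, mate_mate, or_comm]
    refine ⟨G.branch v, fun u => ?_, fun l X hX => ?_⟩
    · rw [hS]
      by_cases huv : u = v
      · subst huv
        simp only [SameEdge, true_or, iff_true]
        exact Or.inl ⟨G.self_mem_branch u, G.mate_up_not_inside_branch u⟩
      · have h1 : ¬ G.Crosses (G.branch v) (Sum.inr (u, 0)) := by
          rw [Crosses, G.mate_up_inside_branch_iff huv]
          simp [Inside, Xor]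
        have h2 : ¬ G.SameEdge (Sum.inr (v, 0)) (Sum.inr (u, 0)) := by
          rintro (h | h)
          · exact huv (by simpa using h)
          · rw [mate_up] at h
            exact slotHalfEdge_ne_up _ _ h.symm
        simp [h1, h2]
    · have e : X h = X (Sum.inr (v, 0)) := by
        rcases hv with rfl | hv
        · rfl
        · rw [← hv, hX.isFlow.mate]
      have h2 : ¬ G.SameEdge h (slotHalfEdge l.1) := by
        rw [hS]
        rintro (h | h)
        · exact slotHalfEdge_ne_up _ _ h
        · rw [mate_up] at h
          exact l.2.1 ⟨v, (slotHalfEdge_injective n h).symm⟩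
      rw [e, hX.up_ne_zero_iff]
      simp [Xor, h2]
  · have hS : ∀ k, G.SameEdge h k ↔ G.SameEdge (slotHalfEdge l₀.1) k := by
      intro k
      rcases hl with rfl | hl
      · rfl
      · have e : h = G.mate (slotHalfEdge l₀.1) := by rw [← hl, mate_mate]
        rw [e, SameEdge, SameEdge, mate_mate, or_comm]
    have hC : ∀ k, ¬ G.Crosses ∅ k := by
      have hI : ∀ k : HalfEdge n, ¬ Inside ∅ k := by
        rintro (b | ⟨v, a⟩) <;> simp [Inside]
      intro k
      simp [Crosses, Xor, hI]
    refine ⟨∅, fun u => ?_, fun l X hX => ?_⟩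
    · have h2 : ¬ G.SameEdge (slotHalfEdge l₀.1) (Sum.inr (u, 0)) := by
        rintro (h | h)
        · exact slotHalfEdge_ne_up _ _ h.symm
        · have h3 : slotHalfEdge l₀.1 = slotHalfEdge (G.tree.parent u) := by
            rw [← mate_up, h, mate_mate]
          exact l₀.2.1 ⟨u, (slotHalfEdge_injective n h3).symm⟩
      rw [hS]
      simp [hC, h2]
    · have e : X h = X (slotHalfEdge l₀.1) := by
        rcases hl with rfl | hl
        · rfl
        · rw [← hl, hX.isFlow.mate]
      have h1 : G.SameEdge h (slotHalfEdge l.1) ↔ l = l₀ := by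
        rw [hS]
        constructor
        · rintro (h | h)
          · exact Subtype.ext (slotHalfEdge_injective n h)
          · exfalso
            have := G.outgoing_mate (slotHalfEdge l₀.1)
            rw [← h, outgoing_slot, outgoing_slot, l.2.2, l₀.2.2] at this
            exact absurd this (by decide)
        · rintro rfl
          exact Or.inl rfl
      rw [e, h1]
      by_cases hll : l = l₀
      · subst hll
        simp [hX.self, Xor, hC]
      · simp [hX.other l₀ (Ne.symm hll), Xor, hC, hll]

/-- In degree zero the two edges that meet at a corner have the same momentum in all flows, so that
they coincide or form a two-edge cut. -/
theorem exists_cut (hd : G.degree = 0) {h : HalfEdge n} (hne : G.mate h ≠ G.turn h) :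
    ∃ C : Finset (Fin n), G.Crosses C h ∧ (G.boundary C).card ≤ 2 := by
  classical
  obtain ⟨C₁, hs₁, hd₁⟩ := G.exists_fundamental_cut h
  obtain ⟨C₂, hs₂, hd₂⟩ := G.exists_fundamental_cut (G.turn h)
  have key : ∀ k, G.Crosses (symmDiff C₁ C₂) k ↔ Xor (G.SameEdge h k) (G.SameEdge (G.turn h) k) := by
    have hX : ∀ k, G.Crosses (symmDiff C₁ C₂) k ↔ Xor (G.Crosses C₁ k) (G.Crosses C₂ k) := by
      intro k
      rw [Crosses, inside_symmDiff, inside_symmDiff]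
      exact xor_xor_interchange
    have hsolid : ∀ u, G.Crosses (symmDiff C₁ C₂) (Sum.inr (u, 0)) ↔
        Xor (G.SameEdge h (Sum.inr (u, 0))) (G.SameEdge (G.turn h) (Sum.inr (u, 0))) := by
      intro u
      rw [hX, hs₁, hs₂]
    have hdashed : ∀ l : G.tree.Leaf, G.Crosses (symmDiff C₁ C₂) (slotHalfEdge l.1) ↔
        Xor (G.SameEdge h (slotHalfEdge l.1)) (G.SameEdge (G.turn h) (slotHalfEdge l.1)) := by
      intro l
      obtain ⟨X, hu⟩ := G.exists_isUnitFlow hd l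
      have h1 := hd₁ l X hu
      have h2 := hd₂ l X hu
      rw [hu.isFlow.turn] at h2
      have h3 := h1.symm.trans h2
      rw [hX]
      exact xor_exchange h3
    intro k
    rcases G.edge_cases k with ⟨u, rfl | hu⟩ | ⟨l, rfl | hl⟩
    · exact hsolid u
    · rw [← crosses_mate, ← G.sameEdge_mate, ← G.sameEdge_mate (h := G.turn h), hu]
      exact hsolid u
    · exact hdashed l
    · rw [← crosses_mate, ← G.sameEdge_mate, ← G.sameEdge_mate (h := G.turn h), hl]
      exact hdashed l
  refine ⟨symmDiff C₁ C₂, ?_, ?_⟩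
  · rw [key]
    refine Or.inl ⟨Or.inl rfl, ?_⟩
    rintro (h1 | h1)
    · exact G.turn_ne h h1.symm
    · exact hne (by rw [h1, mate_mate, ← h1])
  · have hone : ∀ g, ((G.boundary (symmDiff C₁ C₂)).filter (G.SameEdge g)).card ≤ 1 := by
      intro g
      refine Finset.card_le_one.2 fun a ha b hb => ?_
      simp only [Finset.mem_filter, mem_boundary] at ha hb
      obtain ⟨⟨a1, a2⟩, ha⟩ := ha
      obtain ⟨⟨b1, b2⟩, hb⟩ := hb
      rcases ha with rfl | rfl <;> rcases hb with rfl | rfl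
      · rfl
      · exact absurd b1 a2
      · exact absurd a1 b2
      · rfl
    have hsub : G.boundary (symmDiff C₁ C₂) ⊆
        (G.boundary (symmDiff C₁ C₂)).filter (G.SameEdge h) ∪
          (G.boundary (symmDiff C₁ C₂)).filter (G.SameEdge (G.turn h)) := by
      intro k hk
      have hc : G.Crosses (symmDiff C₁ C₂) k := Or.inl ((G.mem_boundary).1 hk)
      rw [key] at hc
      rw [Finset.mem_union, Finset.mem_filter, Finset.mem_filter]
      rcases hc with hc | hc
      · exact Or.inl ⟨hk, hc.1⟩
      · exact Or.inr ⟨hk, hc.1⟩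
    have h1 := (Finset.card_le_card hsub).trans (Finset.card_union_le _ _)
    have h2 := hone h
    have h3 := hone (G.turn h)
    omega

/-- A graph of degree zero contains an elementary melon. It sits in a minimal set of vertices with
two external edges: by minimality no two-edge cut separates this set, so that each edge inside it
joins two half-edges identified by a propagator. -/
theorem exists_melon (hd : G.degree = 0) (hn : 0 < n) : ∃ x, x < G.wavy x ∧
    (∀ a, a ≠ 0 → G.mate (Sum.inr (x, a)) = Sum.inr (G.wavy x, G.propagator x a)) ∧
    ¬ Inside {x, G.wavy x} (G.mate (Sum.inr (x, 0))) ∧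
    ¬ Inside {x, G.wavy x} (G.mate (Sum.inr (G.wavy x, G.propagator x 0))) := by
  classical
  have huniv : (G.boundary Finset.univ).card ≤ 2 := by
    have : G.boundary Finset.univ ⊆ {G.mate (Sum.inl true), G.mate (Sum.inl false)} := by
      intro k hk
      rw [mem_boundary] at hk
      generalize hg : G.mate k = g at hk
      rcases g with b | ⟨v, a⟩
      · rw [← G.mate_mate k, hg]
        cases b <;> simp
      · exact absurd (Finset.mem_univ v) hk.2
    exact (Finset.card_le_card this).trans Finset.card_le_two
  let F : Finset (Finset (Fin n)) :=
    Finset.univ.filter fun B => B.Nonempty ∧ (G.boundary B).card ≤ 2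
  have hF : F.Nonempty :=
    ⟨Finset.univ, by simp only [F, Finset.mem_filter, Finset.mem_univ, true_and]
                     exact ⟨⟨⟨0, hn⟩, Finset.mem_univ _⟩, huniv⟩⟩
  obtain ⟨B, hBF, hmin⟩ := Finset.exists_min_image F Finset.card hF
  simp only [F, Finset.mem_filter, Finset.mem_univ, true_and] at hBF hmin
  obtain ⟨⟨x₀, hx₀⟩, hB2⟩ := hBF
  have hinner : ∀ h, Inside B h → Inside B (G.mate h) → G.mate h = G.turn h := by
    intro h h1 h2
    by_contra hne
    obtain ⟨C, hc, hC2⟩ := G.exists_cut hd hne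
    have hex : ∃ u v, u ∈ B ∧ v ∈ B ∧ u ∈ C ∧ v ∉ C := by
      unfold Crosses at hc
      generalize G.mate h = k at h2 hc
      rcases h with b | ⟨u, a⟩
      · exact absurd h1 id
      rcases k with b | ⟨v, c⟩
      · exact absurd h2 id
      rcases hc with hc | hc
      · exact ⟨u, v, h1, h2, hc.1, hc.2⟩
      · exact ⟨v, u, h2, h1, hc.1, hc.2⟩
    obtain ⟨u, v, hu, hv, huC, hvC⟩ := hex
    have hlt : (B ∩ C).card < B.card :=
      Finset.card_lt_card ⟨Finset.inter_subset_left, fun h =>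
        hvC (Finset.mem_inter.1 (h hv)).2⟩
    have hne' : (B ∩ C).Nonempty := ⟨u, Finset.mem_inter.2 ⟨hu, huC⟩⟩
    -- A smaller set has at least three boundary edges, and the union has at least two, against
    -- at most four in total.
    have h3 : 2 < (G.boundary (B ∩ C)).card := by
      by_contra h4
      exact absurd (hmin _ ⟨hne', not_lt.1 h4⟩) hlt.not_ge
    have h4 := G.two_le_card_boundary (C := B ∪ C) ⟨u, Finset.mem_union_left _ hu⟩
    have h5 := G.card_boundary_submodular B C
    omega
  -- If the partner of `x` were outside, all four half-edges at `x` would be on the boundary.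
  have hwavy : ∀ x ∈ B, G.wavy x ∈ B := by
    intro x hx
    by_contra hy
    have hsub : Finset.univ.image (fun a => (Sum.inr (x, a) : HalfEdge n)) ⊆ G.boundary B := by
      intro h hh
      obtain ⟨a, -, rfl⟩ := Finset.mem_image.1 hh
      refine (G.mem_boundary).2 ⟨hx, fun h2 => hy ?_⟩
      rw [hinner (Sum.inr (x, a)) hx h2] at h2
      exact h2
    have := Finset.card_le_card hsub
    rw [Finset.card_image_of_injective _ (fun a b h => by simpa using h), Finset.card_univ,
      Fintype.card_fin] at this
    omega
  obtain ⟨x, hxB, hlt⟩ : ∃ x ∈ B, x < G.wavy x := by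
    rcases G.lt_or_wavy_lt x₀ with h | h
    · exact ⟨x₀, hx₀, h⟩
    · exact ⟨_, hwavy x₀ hx₀, h⟩
  have hyB := hwavy x hxB
  have hsubB : ∀ h, Inside {x, G.wavy x} h → Inside B h := by
    rintro (b | ⟨v, a⟩) h
    · exact h
    · simp only [inside_inr, Finset.mem_insert, Finset.mem_singleton] at h
      rcases h with rfl | rfl
      · exact hxB
      · exact hyB
  have hturn : ∀ h, Inside {x, G.wavy x} h → Inside {x, G.wavy x} (G.turn h) := by
    rintro (b | ⟨v, a⟩) h
    · exact h
    · simp only [inside_inr, Finset.mem_insert, Finset.mem_singleton, turn] at h ⊢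
      rcases h with rfl | rfl
      · exact Or.inr rfl
      · exact Or.inl (G.wavy_wavy x)
  have hsub : G.boundary {x, G.wavy x} ⊆ G.boundary B := by
    intro h hh
    rw [mem_boundary] at hh ⊢
    refine ⟨hsubB h hh.1, fun h2 => hh.2 ?_⟩
    rw [hinner h (hsubB h hh.1) h2]
    exact hturn h hh.1
  have hcard := (Finset.card_le_card hsub).trans hB2
  have hx0 : ¬ Inside {x, G.wavy x} (G.mate (Sum.inr (x, 0))) := by
    rw [mate_up]
    intro h
    rcases hp : G.tree.parent x with b | ⟨u, a⟩ <;> rw [hp] at h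
    · exact h
    · have h1 := G.tree.heap _ u a hp
      simp only [slotHalfEdge, inside_inr, Finset.mem_insert, Finset.mem_singleton] at h
      rcases h with rfl | rfl
      · exact lt_irrefl _ h1
      · exact lt_asymm h1 hlt
  have hxI : ∀ a, Inside {x, G.wavy x} (Sum.inr (x, a)) := fun a => by simp
  have hyI : ∀ a, Inside {x, G.wavy x} (Sum.inr (G.wavy x, a)) := fun a => by simp
  have hy0 : ¬ Inside {x, G.wavy x} (G.mate (Sum.inr (G.wavy x, G.propagator x 0))) := by
    intro h
    have h1 := hinner _ (hsubB _ (hyI _)) (hsubB _ h)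
    have h2 : G.turn (Sum.inr (G.wavy x, G.propagator x 0)) = Sum.inr (x, 0) :=
      G.turn_turn (Sum.inr (x, 0))
    rw [h2] at h1
    apply hx0
    rw [← h1, mate_mate]
    exact hyI _
  refine ⟨x, hlt, fun a ha => ?_, hx0, hy0⟩
  refine hinner _ (hsubB _ (hxI a)) (hsubB _ ?_)
  by_contra hout
  have h3 : ({Sum.inr (x, 0), Sum.inr (x, a), Sum.inr (G.wavy x, G.propagator x 0)} :
      Finset (HalfEdge n)) ⊆ G.boundary {x, G.wavy x} := by
    intro h hh
    simp only [Finset.mem_insert, Finset.mem_singleton] at hh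
    rcases hh with rfl | rfl | rfl
    · exact (G.mem_boundary).2 ⟨hxI _, hx0⟩
    · exact (G.mem_boundary).2 ⟨hxI _, hout⟩
    · exact (G.mem_boundary).2 ⟨hyI _, hy0⟩
  have h4 := Finset.card_le_card h3
  have hxy : ∀ b c, (Sum.inr (x, b) : HalfEdge n) ≠ Sum.inr (G.wavy x, c) := by
    intro b c h
    simp only [Sum.inr.injEq, Prod.mk.injEq] at h
    exact hlt.ne h.1
  rw [Finset.card_eq_three.2 ⟨_, _, _, by simpa using ha.symm, hxy _ _, hxy _ _, rfl⟩] at h4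
  omega

end Graph

/-! ### Graphs from involutions on half-edges -/

/-- The data of a graph in terms of half-edges: an orientation-reversing involution `mate`, whose
values at the parent half-edges are places that respect the heap order, and the wavy edges with
their propagators. -/
structure Wiring (n : ℕ) where
  mate : HalfEdge n → HalfEdge n
  mate_mate : ∀ h, mate (mate h) = h
  outgoing : HalfEdge n → Bool
  outgoing_mate : ∀ h, outgoing (mate h) = !outgoing h
  outgoing_root : ∀ b, outgoing (Sum.inl b) = b
  outgoing_one : ∀ v, outgoing (Sum.inr (v, 1)) = outgoing (Sum.inr (v, 0))
  outgoing_upper : ∀ v c, outgoing (Sum.inr (v, (upper c).succ)) = !outgoing (Sum.inr (v, 0))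
  parent : Fin n → Slot n
  mate_up : ∀ v, mate (Sum.inr (v, 0)) = Graph.slotHalfEdge (parent v)
  heap : ∀ v u a, parent v = Sum.inr (u, a) → u < v
  wavy : Fin n → Fin n
  wavy_wavy : ∀ v, wavy (wavy v) = v
  wavy_ne : ∀ v, wavy v ≠ v
  propagator : Fin n → Equiv.Perm (Fin 4)
  propagator_complement : ∀ v a, propagator v (complement a) = complement (propagator v a)
  propagator_wavy : ∀ v, propagator (wavy v) = (propagator v)⁻¹

namespace Wiring

open MelonicTurbulence.Graph

variable {n : ℕ} (W : Wiring n)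

theorem mate_parent (v : Fin n) : W.mate (slotHalfEdge (W.parent v)) = Sum.inr (v, 0) := by
  rw [← W.mate_up, W.mate_mate]

/-- The tree of a wiring. -/
def tree : HeapTree n where
  parent := W.parent
  parent_injective v u h := by
    have := W.mate_parent v
    rw [h, W.mate_parent] at this
    simpa using this.symm
  heap := W.heap

theorem slotType_of_vertexType (s : Slot n)
    (h : ∀ u a, s = Sum.inr (u, a) → W.tree.vertexType u = !W.outgoing (Sum.inr (u, 0))) :
    W.tree.slotType s = W.outgoing (slotHalfEdge s) := by
  rcases s with b | ⟨u, a⟩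
  · exact (W.outgoing_root b).symm
  · have hu := h u a rfl
    have ha : ∀ a : Fin 3, a = 0 ∨ ∃ c, a = upper c := by decide
    rcases ha a with rfl | ⟨c, rfl⟩
    · have e : W.tree.slotType (Sum.inr (u, 0)) = !W.tree.vertexType u := rfl
      have e2 : W.outgoing (slotHalfEdge (Sum.inr (u, 0))) = W.outgoing (Sum.inr (u, 0)) :=
        W.outgoing_one u
      rw [e, e2, hu, Bool.not_not]
    · have e : W.tree.slotType (Sum.inr (u, upper c)) = W.tree.vertexType u := by
        cases c <;> rfl
      have e2 : W.outgoing (slotHalfEdge (Sum.inr (u, upper c))) = !W.outgoing (Sum.inr (u, 0)) :=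
        W.outgoing_upper u c
      rw [e, e2, hu]

theorem vertexType_eq (v : Fin n) : W.tree.vertexType v = !W.outgoing (Sum.inr (v, 0)) := by
  induction v using WellFoundedLT.induction with
  | _ v ih =>
    rw [HeapTree.vertexType_eq, W.slotType_of_vertexType, ← W.outgoing_mate, W.mate_up]
    · rfl
    · exact fun u a h => ih u (W.heap v u a h)

theorem slotType_eq (s : Slot n) : W.tree.slotType s = W.outgoing (slotHalfEdge s) :=
  W.slotType_of_vertexType s fun u _ _ => W.vertexType_eq u

theorem exists_partner {s : Slot n} (hs : s ∉ Set.range W.tree.parent) :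
    ∃ t, t ∉ Set.range W.tree.parent ∧ W.mate (slotHalfEdge s) = slotHalfEdge t := by
  rcases halfEdge_cases (W.mate (slotHalfEdge s)) with ⟨v, hv⟩ | ⟨t, ht⟩
  · refine absurd ⟨v, slotHalfEdge_injective n ?_⟩ hs
    change slotHalfEdge (W.parent v) = _
    rw [← W.mate_up, ← hv, W.mate_mate]
  · refine ⟨t, ?_, ht⟩
    rintro ⟨v, rfl⟩
    have : slotHalfEdge s = Sum.inr (v, 0) := by
      rw [← W.mate_mate (slotHalfEdge s), ht]
      exact W.mate_parent v
    exact slotHalfEdge_ne_up _ _ this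

/-- The place at the other end of the dashed edge from a free place. -/
noncomputable def partner {s : Slot n} (hs : s ∉ Set.range W.tree.parent) : Slot n :=
  (W.exists_partner hs).choose

theorem partner_free {s : Slot n} (hs : s ∉ Set.range W.tree.parent) :
    W.partner hs ∉ Set.range W.tree.parent := (W.exists_partner hs).choose_spec.1

theorem mate_eq_partner {s : Slot n} (hs : s ∉ Set.range W.tree.parent) :
    W.mate (slotHalfEdge s) = slotHalfEdge (W.partner hs) := (W.exists_partner hs).choose_spec.2

theorem slotType_partner {s : Slot n} (hs : s ∉ Set.range W.tree.parent) :
    W.tree.slotType (W.partner hs) = !W.tree.slotType s := by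
  rw [slotType_eq, slotType_eq, ← mate_eq_partner, W.outgoing_mate]

theorem partner_partner {s : Slot n} (hs : s ∉ Set.range W.tree.parent) :
    W.partner (W.partner_free hs) = s := by
  apply slotHalfEdge_injective n
  rw [← mate_eq_partner, ← mate_eq_partner, W.mate_mate]

/-- The graph of a wiring. -/
noncomputable def graph : Graph n where
  tree := W.tree
  pairing :=
    { toFun := fun l => ⟨W.partner l.2.1, W.partner_free _, by rw [slotType_partner, l.2.2]; rfl⟩
      invFun := fun l => ⟨W.partner l.2.1, W.partner_free _, by rw [slotType_partner, l.2.2]; rfl⟩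
      left_inv := fun l => Subtype.ext (W.partner_partner l.2.1)
      right_inv := fun l => Subtype.ext (W.partner_partner l.2.1) }
  wavy := W.wavy
  wavy_wavy := W.wavy_wavy
  wavy_ne := W.wavy_ne
  propagator := W.propagator
  propagator_complement := W.propagator_complement
  propagator_wavy := W.propagator_wavy

theorem graph_mate (h : HalfEdge n) : W.graph.mate h = W.mate h := by
  rw [mate_eq_iff]
  rcases halfEdge_cases h with ⟨v, rfl⟩ | ⟨s, rfl⟩
  · rw [W.mate_up]
    exact IsEdge.up (G := W.graph) v
  · by_cases hs : s ∈ Set.range W.tree.parent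
    · obtain ⟨v, rfl⟩ := hs
      have : W.mate (slotHalfEdge (W.tree.parent v)) = Sum.inr (v, 0) := W.mate_parent v
      rw [this]
      exact IsEdge.down (G := W.graph) v
    · rw [W.mate_eq_partner hs]
      refine .dashed _ _ ?_
      by_cases ht : W.tree.slotType s = true
      · exact ⟨⟨s, hs, ht⟩, Or.inl ⟨rfl, rfl⟩⟩
      · refine ⟨⟨W.partner hs, W.partner_free hs, ?_⟩, Or.inr ⟨rfl, (W.partner_partner hs).symm⟩⟩
        change W.tree.slotType _ = true
        rw [slotType_partner]
        simpa using ht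

end Wiring

/-! ### Melonic reductions -/

namespace Graph

theorem outgoing_complement {n : ℕ} (G : Graph n) (v : Fin n) (a : Fin 4) :
    G.outgoing (Sum.inr (v, complement a)) = G.outgoing (Sum.inr (v, a)) := by
  have h : (complement a = 0 ∨ complement a = 1) ↔ (a = 0 ∨ a = 1) := by revert a; decide
  simp only [outgoing, h]

theorem outgoing_one {n : ℕ} (G : Graph n) (v : Fin n) :
    G.outgoing (Sum.inr (v, 1)) = G.outgoing (Sum.inr (v, 0)) := by
  simp [outgoing]

theorem outgoing_upper {n : ℕ} (G : Graph n) (v : Fin n) (c : Bool) :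
    G.outgoing (Sum.inr (v, (upper c).succ)) = !G.outgoing (Sum.inr (v, 0)) := by
  cases c <;> simp [outgoing, upper]

/-- An elementary melon whose external edges leave it can be removed. -/
theorem exists_reduction {n : ℕ} (G : Graph (n + 2)) {x : Fin (n + 2)} (hxy : x < G.wavy x)
    (hin : ∀ a, a ≠ 0 → G.mate (Sum.inr (x, a)) = Sum.inr (G.wavy x, G.propagator x a))
    (hx : ¬ Inside {x, G.wavy x} (G.mate (Sum.inr (x, 0))))
    (hy : ¬ Inside {x, G.wavy x} (G.mate (Sum.inr (G.wavy x, G.propagator x 0)))) :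
    ∃ (G₀ : Graph n) (f : Fin n ↪o Fin (n + 2)) (s t : HalfEdge n),
      InsertsMelon G₀ G f x (G.wavy x) s t := by
  classical
  set y := G.wavy x with hydef
  set π := G.propagator x with hπ
  have hcard : (({x, y} : Finset (Fin (n + 2)))ᶜ).card = n := by
    rw [Finset.card_compl, Finset.card_pair hxy.ne, Fintype.card_fin]; omega
  let f : Fin n ↪o Fin (n + 2) := Finset.orderEmbOfFin _ hcard
  have hrange : ∀ v, (∃ u, f u = v) ↔ v ≠ x ∧ v ≠ y := by
    intro v
    have : v ∈ Set.range f ↔ v ∈ ((({x, y} : Finset (Fin (n + 2)))ᶜ : Finset _) : Set _) := by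
      rw [Finset.range_orderEmbOfFin]
    simpa [and_comm] using this
  have hfx : ∀ u, f u ≠ x := fun u => ((hrange _).1 ⟨u, rfl⟩).1
  have hfy : ∀ u, f u ≠ y := fun u => ((hrange _).1 ⟨u, rfl⟩).2
  let F : HalfEdge n → HalfEdge (n + 2) := HalfEdge.rename f
  have hF : Function.Injective F := HalfEdge.rename_injective f.injective
  have hFrange : ∀ h, ¬ Inside {x, y} h → ∃ k, F k = h := by
    rintro (b | ⟨v, a⟩) h
    · exact ⟨Sum.inl b, rfl⟩
    · simp only [inside_inr, Finset.mem_insert, Finset.mem_singleton, not_or] at h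
      obtain ⟨u, rfl⟩ := (hrange v).2 h
      exact ⟨Sum.inr (u, a), rfl⟩
  have hFslot : ∀ k q, F k = slotHalfEdge q → ∃ s, k = slotHalfEdge s ∧ q = Slot.rename f s := by
    intro k q hk
    rcases halfEdge_cases k with ⟨u, rfl⟩ | ⟨s, rfl⟩
    · exact absurd hk.symm (slotHalfEdge_ne_up _ _)
    · refine ⟨s, rfl, slotHalfEdge_injective _ ?_⟩
      rw [slotHalfEdge_rename]
      exact hk.symm
  obtain ⟨s, hs⟩ := hFrange _ hx
  obtain ⟨t, ht⟩ := hFrange _ hy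
  have hsx : G.mate (F s) = Sum.inr (x, 0) := by rw [hs, mate_mate]
  have hty : G.mate (F t) = Sum.inr (y, π 0) := by rw [ht, mate_mate]
  have hFx : ∀ k a, F k ≠ Sum.inr (x, a) := by
    rintro (b | ⟨u, c⟩) a h <;> simp [F, hfx] at h
  have hFy : ∀ k a, F k ≠ Sum.inr (y, a) := by
    rintro (b | ⟨u, c⟩) a h <;> simp [F, hfy] at h
  have hst : s ≠ t := by
    rintro rfl
    rw [hsx] at hty
    simp only [Sum.inr.injEq, Prod.mk.injEq] at hty
    exact hxy.ne hty.1
  -- The new edges are the old ones, and the two external edges of the melon are merged.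
  have hex : ∀ h, ∃ k, (h = s → k = t) ∧ (h = t → k = s) ∧
      (h ≠ s → h ≠ t → F k = G.mate (F h)) := by
    intro h
    by_cases h1 : h = s
    · exact ⟨t, fun _ => rfl, fun h2 => absurd (h1.symm.trans h2) hst, fun h2 => absurd h1 h2⟩
    by_cases h2 : h = t
    · exact ⟨s, fun h3 => absurd h3 h1, fun _ => rfl, fun _ h3 => absurd h2 h3⟩
    obtain ⟨k, hk⟩ := hFrange (G.mate (F h)) (by
      intro hI
      generalize hg : G.mate (F h) = g at hI
      rcases g with b | ⟨v, a⟩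
      · exact hI
      have hg' : F h = G.mate (Sum.inr (v, a)) := by rw [← hg, mate_mate]
      simp only [inside_inr, Finset.mem_insert, Finset.mem_singleton] at hI
      rcases hI with rfl | rfl
      · by_cases ha : a = 0
        · subst ha
          exact h1 (hF (hg'.trans hs.symm))
        · rw [hin a ha] at hg'
          exact hFy _ _ hg'
      · by_cases ha : π.symm a = 0
        · have : a = π 0 := by rw [← ha]; simp
          subst this
          exact h2 (hF (hg'.trans ht.symm))
        · have h3 := hin _ ha
          rw [Equiv.apply_symm_apply] at h3
          rw [← h3, mate_mate] at hg'
          exact hFx _ _ hg')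
    exact ⟨k, fun h => absurd h h1, fun h => absurd h h2, fun _ _ => hk⟩
  choose M hMs hMt hMo using hex
  have hMs := hMs s rfl
  have hMt := hMt t rfl
  have hMM : ∀ h, M (M h) = h := by
    intro h
    by_cases h1 : h = s
    · rw [h1, hMs, hMt]
    by_cases h2 : h = t
    · rw [h2, hMt, hMs]
    have h3 := hMo h h1 h2
    have h4 : M h ≠ s := by
      intro e
      rw [e] at h3
      have : F h = Sum.inr (x, 0) := by rw [← hsx, h3, mate_mate]
      exact hFx _ _ this
    have h5 : M h ≠ t := by
      intro e
      rw [e] at h3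
      have : F h = Sum.inr (y, π 0) := by rw [← hty, h3, mate_mate]
      exact hFy _ _ this
    apply hF
    rw [hMo _ h4 h5, h3, mate_mate]
  -- Half-edges in the same half of a vertex have the same orientation, and `π` respects the halves;
  -- the inner edge at `e₂(x)` then relates the orientations of the two external half-edges.
  have hout : G.outgoing (Sum.inr (y, π 0)) = !G.outgoing (Sum.inr (x, 0)) := by
    have h1 : π 1 = complement (π 0) := G.propagator_complement x 0
    rw [← outgoing_complement, ← h1, ← hin 1 (by decide), outgoing_mate, outgoing_one]
  have hoM : ∀ h, G.outgoing (F (M h)) = !G.outgoing (F h) := by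
    have e1 : G.outgoing (F s) = !G.outgoing (Sum.inr (x, 0)) := by rw [hs, outgoing_mate]
    have e2 : G.outgoing (F t) = !G.outgoing (Sum.inr (y, π 0)) := by rw [ht, outgoing_mate]
    intro h
    by_cases h1 : h = s
    · rw [h1, hMs, e1, e2, hout]
    by_cases h2 : h = t
    · rw [h2, hMt, e1, e2, hout, Bool.not_not]
    rw [hMo h h1 h2, outgoing_mate]
  -- If the child of `y` is attached to the former parent of `x`, the heap order persists because
  -- `x < y`.
  have hpar : ∀ v, ∃ q, M (Sum.inr (v, 0)) = slotHalfEdge q ∧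
      ∀ u a, q = Sum.inr (u, a) → u < v := by
    intro v
    have hv1 : (Sum.inr (v, 0) : HalfEdge n) ≠ s := by
      rintro rfl
      have h1 : F (Sum.inr (v, 0)) = slotHalfEdge (G.tree.parent x) := by rw [hs, mate_up]
      exact slotHalfEdge_ne_up _ _ h1.symm
    by_cases hv2 : (Sum.inr (v, 0) : HalfEdge n) = t
    · have h1 : F s = slotHalfEdge (G.tree.parent x) := by rw [hs, mate_up]
      obtain ⟨q, hq, hq'⟩ := hFslot _ _ h1
      refine ⟨q, by rw [hv2, hMt, hq], ?_⟩
      rintro u a rfl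
      have h2 : f u < x := G.tree.heap x (f u) a hq'
      have h3 : slotHalfEdge (G.tree.parent (f v)) = Sum.inr (y, π 0) := by
        rw [← mate_up, ← hty, ← hv2]; rfl
      have h4 : y < f v := by
        rcases hp : G.tree.parent (f v) with b | ⟨w, c⟩
        · rw [hp] at h3
          exact absurd h3 (by simp [slotHalfEdge])
        · have h5 := G.tree.heap _ _ _ hp
          rw [hp] at h3
          simp only [slotHalfEdge, Sum.inr.injEq, Prod.mk.injEq] at h3
          rwa [h3.1] at h5
      exact f.lt_iff_lt.1 (h2.trans (hxy.trans h4))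
    · have h1 : F (M (Sum.inr (v, 0))) = slotHalfEdge (G.tree.parent (f v)) := by
        rw [hMo _ hv1 hv2, ← mate_up]; rfl
      obtain ⟨q, hq, hq'⟩ := hFslot _ _ h1
      refine ⟨q, hq, ?_⟩
      rintro u a rfl
      exact f.lt_iff_lt.1 (G.tree.heap _ (f u) a hq')
  choose par hpar1 hpar2 using hpar
  have hwavy : ∀ v, ∃ w, f w = G.wavy (f v) := by
    intro v
    refine (hrange _).2 ⟨fun h => hfy v ?_, fun h => hfx v ?_⟩
    · rw [hydef, ← h, G.wavy_wavy]
    · rw [← G.wavy_wavy (f v), h, hydef, G.wavy_wavy]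
  choose wv hwv using hwavy
  let W : Wiring n :=
    { mate := M
      mate_mate := hMM
      outgoing := fun h => G.outgoing (F h)
      outgoing_mate := hoM
      outgoing_root := fun _ => rfl
      outgoing_one := fun v => G.outgoing_one (f v)
      outgoing_upper := fun v => G.outgoing_upper (f v)
      parent := par
      mate_up := hpar1
      heap := hpar2
      wavy := wv
      wavy_wavy := fun v => f.injective (by rw [hwv, hwv, G.wavy_wavy])
      wavy_ne := fun v h => G.wavy_ne (f v) (by rw [← hwv, h])
      propagator := fun v => G.propagator (f v)
      propagator_complement := fun v => G.propagator_complement (f v)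
      propagator_wavy := fun v => by rw [hwv, G.propagator_wavy] }
  refine ⟨W.graph, f, s, t, ⟨hfx, hfy, rfl, fun v => (hwv v).symm, fun _ => rfl⟩, ?_, hs.symm,
    ht.symm, hin, ?_⟩
  · rw [W.graph_mate]; exact hMs
  · intro h h1 h2
    rw [W.graph_mate]
    exact (hMo h h1 h2).symm

end Graph

/-- Removing a melon removes at most two independent momenta, so that the degree cannot
increase. -/
theorem InsertsMelon.degree_le {n : ℕ} {G : Graph n} {G' : Graph (n + 2)}
    {f : Fin n ↪o Fin (n + 2)} {x y : Fin (n + 2)} {s t : HalfEdge n}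
    (I : InsertsMelon G G' f x y s t) : G.degree ≤ G'.degree := by
  let Φ : G'.flowSpace →ₗ[ℚ] (G.flowSpace × (ℚ × ℚ)) :=
    { toFun := fun X => (⟨fun h => X.1 (HalfEdge.rename f h), I.isFlow_restrict X.2⟩,
        X.1 (Sum.inr (x, 1)), X.1 (Sum.inr (x, 2)))
      map_add' := fun _ _ => rfl
      map_smul' := fun _ _ => rfl }
  have hΦ : Function.Injective Φ := by
    rw [injective_iff_map_eq_zero]
    intro X hX
    have h1 : ∀ h, X.1 (HalfEdge.rename f h) = 0 := fun h =>
      congrFun (congrArg Subtype.val (congrArg Prod.fst hX)) h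
    have h2 : X.1 (Sum.inr (x, 1)) = 0 := congrArg (fun z => z.2.1) hX
    have h3 : X.1 (Sum.inr (x, 2)) = 0 := congrArg (fun z => z.2.2) hX
    have h0 : X.1 (Sum.inr (x, 0)) = 0 := by rw [← X.2.mate, I.mate_x, h1]
    have h4 : X.1 (Sum.inr (x, 3)) = 0 := by
      have := X.2.node x
      rw [h0, h2, h3] at this
      linarith
    have hx : ∀ a, X.1 (Sum.inr (x, a)) = 0 := by
      intro a
      fin_cases a <;> assumption
    refine Subtype.ext (funext fun h => ?_)
    rcases I.halfEdge_cases h with ⟨k, rfl⟩ | ⟨a, rfl⟩ | ⟨a, rfl⟩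
    · exact h1 k
    · exact hx a
    · rw [← I.turn_x, X.2.turn]; exact hx a
  have h := LinearMap.finrank_le_finrank_of_injective hΦ
  rw [Module.finrank_prod, Module.finrank_prod, Module.finrank_self] at h
  rw [Graph.degree_eq, Graph.degree_eq]
  push_cast
  omega

/-- Removing a melon from a graph of degree zero leaves the degree zero, so that the graph is
reduced to the trivial one. -/
theorem Graph.isMelonic_of_degree_eq_zero {n : ℕ} (G : Graph n) (hd : G.degree = 0) :
    IsMelonic G := by
  induction n using Nat.strong_induction_on with
  | _ n ih =>
    rcases Nat.eq_zero_or_pos n with rfl | hn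
    · exact .trivial G
    · obtain ⟨x, hxy, hin, hx, hy⟩ := G.exists_melon hd hn
      obtain ⟨m, rfl⟩ : ∃ m, n = m + 2 := ⟨n - 2, by
        have h1 : x.val < (G.wavy x).val := hxy
        have h2 := (G.wavy x).isLt
        omega⟩
      obtain ⟨G₀, f, s, t, I⟩ := G.exists_reduction hxy hin hx hy
      have h0 : G₀.degree = 0 := le_antisymm (I.degree_le.trans_eq hd) G₀.degree_nonneg
      exact .insertion G₀ G (ih m (by omega) G₀ h0) I.melonicInsertion

/-! ### Existence of melonic graphs -/

theorem Graph.even_order {n : ℕ} (G : Graph n) : Even n := by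
  have h : ∑ _v : Fin n, (1 : ZMod 2) = 0 :=
    Finset.sum_involution (fun v _ => G.wavy v) (fun _ _ => by decide)
      (fun v _ _ => G.wavy_ne v) (fun _ _ => Finset.mem_univ _) (fun v _ => G.wavy_wavy v)
  simp only [Finset.sum_const, Finset.card_univ, Fintype.card_fin, nsmul_eq_mul, mul_one] at h
  exact (ZMod.natCast_eq_zero_iff_even).1 h

open MelonicTurbulence.Graph in
/-- A melon of type I can be inserted on a dashed edge. -/
theorem Graph.exists_insertsMelon {n : ℕ} (G : Graph n) :
    ∃ (G' : Graph (n + 2)) (f : Fin n ↪o Fin (n + 2)) (x y : Fin (n + 2)) (s t : HalfEdge n),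
      InsertsMelon G G' f x y s t := by
  classical
  obtain ⟨l⟩ : Nonempty G.tree.Leaf := Fintype.card_pos_iff.1 (by rw [G.card_leaf]; omega)
  let f : Fin n ↪o Fin (n + 2) := Fin.castAddOrderEmb 2
  let x : Fin (n + 2) := (Fin.last n).castSucc
  let y : Fin (n + 2) := Fin.last (n + 1)
  let F : HalfEdge n → HalfEdge (n + 2) := HalfEdge.rename f
  have hfx' : ∀ u, f u < x := fun u => by
    rw [Fin.lt_def]; simp [f, x]
  have hxy' : x < y := Fin.castSucc_lt_last _
  have hfx : ∀ u, f u ≠ x := fun u => (hfx' u).ne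
  have hfy' : ∀ u, f u < y := fun u => (hfx' u).trans hxy'
  have hfy : ∀ u, f u ≠ y := fun u => (hfy' u).ne
  have hcases : ∀ v : Fin (n + 2), (∃ u, v = f u) ∨ v = x ∨ v = y := by
    intro v
    refine Fin.lastCases (Or.inr (Or.inr rfl)) (fun v => ?_) v
    refine Fin.lastCases (Or.inr (Or.inl rfl)) (fun v => ?_) v
    exact Or.inl ⟨v, rfl⟩
  have hF : Function.Injective F := HalfEdge.rename_injective f.injective
  have hvert : ∀ {R : Type} (φ : Fin n → R) (r₁ r₂ : R), ∃ X : Fin (n + 2) → R,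
      (∀ v, X (f v) = φ v) ∧ X x = r₁ ∧ X y = r₂ := by
    intro R φ r₁ r₂
    refine ⟨Fin.snoc (α := fun _ => R) (Fin.snoc (α := fun _ => R) φ r₁) r₂, fun v => ?_, ?_, ?_⟩
    · have : f v = v.castSucc.castSucc := rfl
      rw [this, Fin.snoc_castSucc, Fin.snoc_castSucc]
    · simp only [x]
      rw [Fin.snoc_castSucc, Fin.snoc_last]
    · simp only [y]
      rw [Fin.snoc_last]
  have hhalf : ∀ {R : Type} (φ : HalfEdge n → R) (g₁ g₂ : Fin 4 → R), ∃ X : HalfEdge (n + 2) → R,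
      (∀ h, X (F h) = φ h) ∧ (∀ a, X (Sum.inr (x, a)) = g₁ a) ∧
      ∀ a, X (Sum.inr (y, a)) = g₂ a := by
    intro R φ g₁ g₂
    obtain ⟨X, h1, h2, h3⟩ := hvert (fun v a => φ (Sum.inr (v, a))) g₁ g₂
    refine ⟨fun h => Sum.elim (fun b => φ (Sum.inl b)) (fun va => X va.1 va.2) h, ?_, ?_, ?_⟩
    · rintro (b | ⟨v, a⟩)
      · rfl
      · exact congrFun (h1 v) a
    · exact fun a => congrFun h2 a
    · exact fun a => congrFun h3 a
  have hcases' : ∀ h : HalfEdge (n + 2), (∃ k, h = F k) ∨ (∃ a, h = Sum.inr (x, a)) ∨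
      ∃ a, h = Sum.inr (y, a) := by
    rintro (b | ⟨v, a⟩)
    · exact Or.inl ⟨Sum.inl b, rfl⟩
    · rcases hcases v with ⟨u, rfl⟩ | rfl | rfl
      · exact Or.inl ⟨Sum.inr (u, a), rfl⟩
      · exact Or.inr (Or.inl ⟨a, rfl⟩)
      · exact Or.inr (Or.inr ⟨a, rfl⟩)
  have hd : G.Dashed l.1 (G.pairing l).1 := ⟨l, Or.inl ⟨rfl, rfl⟩⟩
  set s : HalfEdge n := slotHalfEdge l.1 with hs
  set t : HalfEdge n := slotHalfEdge (G.pairing l).1 with ht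
  have hst : G.mate s = t := hd.mate_eq
  have hts : G.mate t = s := by rw [← hst, mate_mate]
  have hne : s ≠ t := fun h => G.mate_ne s (hst.trans h.symm)
  have hos : G.outgoing s = true := by rw [hs, outgoing_slot]; exact l.2.2
  have hot : G.outgoing t = false := by rw [ht, outgoing_slot]; exact (G.pairing l).2.2
  obtain ⟨M, hM, hMx, hMy⟩ := hhalf
    (fun h => if h = s then Sum.inr (x, 0) else if h = t then Sum.inr (y, 0) else F (G.mate h))
    (fun a => if a = 0 then F s else Sum.inr (y, a))
    (fun a => if a = 0 then F t else Sum.inr (x, a))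
  have hMs : M (F s) = Sum.inr (x, 0) := by simp [hM]
  have hMt : M (F t) = Sum.inr (y, 0) := by simp [hM, hne.symm]
  have hMo : ∀ h, h ≠ s → h ≠ t → M (F h) = F (G.mate h) := fun h h1 h2 => by simp [hM, h1, h2]
  have hMx0 : M (Sum.inr (x, 0)) = F s := by simp [hMx]
  have hMy0 : M (Sum.inr (y, 0)) = F t := by simp [hMy]
  have hMxa : ∀ a, a ≠ 0 → M (Sum.inr (x, a)) = Sum.inr (y, a) := fun a ha => by simp [hMx, ha]
  have hMya : ∀ a, a ≠ 0 → M (Sum.inr (y, a)) = Sum.inr (x, a) := fun a ha => by simp [hMy, ha]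
  -- The leaf end `s` is out-going, so `x` is of type `α` and `y` of type `ᾱ`.
  obtain ⟨o, ho, hox, hoy⟩ := hhalf G.outgoing (fun a => decide (a = 2 ∨ a = 3))
    (fun a => decide (a = 0 ∨ a = 1))
  obtain ⟨par, hp, hpx, hpy⟩ := hvert (fun v => Slot.rename f (G.tree.parent v))
    (Slot.rename f l.1) (Slot.rename f (G.pairing l).1)
  obtain ⟨wv, hw, hwx, hwy⟩ := hvert (fun v => f (G.wavy v)) y x
  obtain ⟨pr, hpr, hprx, hpry⟩ := hvert G.propagator 1 1
  have hren : ∀ (q : Slot n) (u : Fin (n + 2)) (a : Fin 3), Slot.rename f q = Sum.inr (u, a) →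
      ∃ w, q = Sum.inr (w, a) ∧ u = f w := by
    rintro (b | ⟨w, c⟩) u a h
    · exact absurd h (by simp [Slot.rename])
    · simp only [Slot.rename, Sum.inr.injEq, Prod.mk.injEq] at h
      exact ⟨w, by rw [h.2], h.1.symm⟩
  have o01 : ∀ a : Fin 4, decide (a = 2 ∨ a = 3) = !decide (a = 0 ∨ a = 1) := by decide
  have ou : ∀ c, decide ((upper c).succ = 2 ∨ (upper c).succ = (3 : Fin 4)) = true := by decide
  let W : Wiring (n + 2) :=
    { mate := M
      mate_mate := by
        intro h
        rcases hcases' h with ⟨k, rfl⟩ | ⟨a, rfl⟩ | ⟨a, rfl⟩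
        · by_cases h1 : k = s
          · rw [h1, hMs, hMx0]
          by_cases h2 : k = t
          · rw [h2, hMt, hMy0]
          rw [hMo k h1 h2, hMo _ (fun e => h2 ?_) (fun e => h1 ?_), mate_mate]
          · rw [← hst, ← e, mate_mate]
          · rw [← hts, ← e, mate_mate]
        · by_cases ha : a = 0
          · rw [ha, hMx0, hMs]
          · rw [hMxa a ha, hMya a ha]
        · by_cases ha : a = 0
          · rw [ha, hMy0, hMt]
          · rw [hMya a ha, hMxa a ha]
      outgoing := o
      outgoing_mate := by
        intro h
        rcases hcases' h with ⟨k, rfl⟩ | ⟨a, rfl⟩ | ⟨a, rfl⟩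
        · by_cases h1 : k = s
          · rw [h1, hMs, hox, ho, hos]; rfl
          by_cases h2 : k = t
          · rw [h2, hMt, hoy, ho, hot]; rfl
          rw [hMo k h1 h2, ho, ho, outgoing_mate]
        · by_cases ha : a = 0
          · rw [ha, hMx0, hox, ho, hos]; rfl
          · rw [hMxa a ha, hox, hoy, o01, Bool.not_not]
        · by_cases ha : a = 0
          · rw [ha, hMy0, hoy, ho, hot]; rfl
          · rw [hMya a ha, hox, hoy, o01]
      outgoing_root := fun b => ho (Sum.inl b)
      outgoing_one := by
        intro v
        rcases hcases v with ⟨u, rfl⟩ | rfl | rfl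
        · have h0 := ho (Sum.inr (u, 0))
          have h1 := ho (Sum.inr (u, 1))
          exact h1.trans ((G.outgoing_one u).trans h0.symm)
        · rw [hox, hox]; rfl
        · rw [hoy, hoy]; rfl
      outgoing_upper := by
        intro v c
        rcases hcases v with ⟨u, rfl⟩ | rfl | rfl
        · have h0 := ho (Sum.inr (u, 0))
          have h1 := ho (Sum.inr (u, (upper c).succ))
          exact h1.trans ((G.outgoing_upper u c).trans (congrArg _ h0.symm))
        · rw [hox, hox, ou]; rfl
        · rw [hoy, hoy, ← Bool.not_not (decide _), ← o01, ou]; rfl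
      parent := par
      mate_up := by
        intro v
        rcases hcases v with ⟨u, rfl⟩ | rfl | rfl
        · have h1 := hMo (Sum.inr (u, 0)) (fun e => slotHalfEdge_ne_up _ _ e.symm)
            (fun e => slotHalfEdge_ne_up _ _ e.symm)
          rw [hp, slotHalfEdge_rename, ← mate_up]
          exact h1
        · rw [hMx0, hpx, slotHalfEdge_rename]
        · rw [hMy0, hpy, slotHalfEdge_rename]
      heap := by
        intro v u a h
        rcases hcases v with ⟨w, rfl⟩ | rfl | rfl
        · rw [hp] at h
          obtain ⟨u', h1, rfl⟩ := hren _ _ _ h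
          exact f.lt_iff_lt.2 (G.tree.heap _ _ _ h1)
        · rw [hpx] at h
          obtain ⟨u', -, rfl⟩ := hren _ _ _ h
          exact hfx' u'
        · rw [hpy] at h
          obtain ⟨u', -, rfl⟩ := hren _ _ _ h
          exact hfy' u'
      wavy := wv
      wavy_wavy := by
        intro v
        rcases hcases v with ⟨u, rfl⟩ | rfl | rfl
        · rw [hw, hw, G.wavy_wavy]
        · rw [hwx, hwy]
        · rw [hwy, hwx]
      wavy_ne := by
        intro v
        rcases hcases v with ⟨u, rfl⟩ | rfl | rfl
        · rw [hw]; exact fun h => G.wavy_ne u (f.injective h)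
        · rw [hwx]; exact hxy'.ne'
        · rw [hwy]; exact hxy'.ne
      propagator := pr
      propagator_complement := by
        intro v a
        rcases hcases v with ⟨u, rfl⟩ | rfl | rfl
        · rw [hpr]; exact G.propagator_complement u a
        · rw [hprx]; rfl
        · rw [hpry]; rfl
      propagator_wavy := by
        intro v
        rcases hcases v with ⟨u, rfl⟩ | rfl | rfl
        · rw [hw, hpr, hpr]; exact G.propagator_wavy u
        · rw [hwx, hprx, hpry, inv_one]
        · rw [hwy, hprx, hpry, inv_one] }
  have hprop : W.graph.propagator x = 1 := hprx
  refine ⟨W.graph, f, x, y, s, t, ⟨hfx, hfy, hwx, hw, hpr⟩, hst, ?_, ?_, ?_, ?_⟩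
  · rw [W.graph_mate]; exact hMx0
  · rw [W.graph_mate, hprop]; exact hMy0
  · intro a ha
    rw [W.graph_mate, hprop]; exact hMxa a ha
  · intro h h1 h2
    rw [W.graph_mate]; exact hMo h h1 h2

/-- The wiring of the trivial graph. -/
def trivialWiring : Wiring 0 where
  mate := Sum.map not id
  mate_mate := by rintro (b | ⟨v, -⟩); exacts [by simp, v.elim0]
  outgoing := Sum.elim id fun _ => true
  outgoing_mate := by rintro (b | ⟨v, -⟩); exacts [rfl, v.elim0]
  outgoing_root _ := rfl
  outgoing_one v := v.elim0
  outgoing_upper v := v.elim0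
  parent v := v.elim0
  mate_up v := v.elim0
  heap v := v.elim0
  wavy v := v
  wavy_wavy _ := rfl
  wavy_ne v := v.elim0
  propagator _ := 1
  propagator_complement v := v.elim0
  propagator_wavy v := v.elim0

theorem exists_isMelonic {n : ℕ} (hn : Even n) : ∃ G : Graph n, IsMelonic G := by
  obtain ⟨m, rfl⟩ := hn
  induction m with
  | zero => exact ⟨trivialWiring.graph, .trivial _⟩
  | succ m ih =>
    obtain ⟨G, hG⟩ := ih
    obtain ⟨G', f, x, y, s, t, I⟩ := G.exists_insertsMelon
    have e : m + 1 + (m + 1) = m + m + 2 := by ring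
    rw [e]
    exact ⟨G', .insertion G G' hG I.melonicInsertion⟩

/-! ### The number of melonic graphs -/

/-- Codes of melonic two-point graphs: the edge between two half-edges is either a single edge, or
it consists of an edge to a half-edge `a` of a vertex `x`, of the melon formed by `x` and `y` with
propagator `π`, and of four further two-point graphs. One of these, with index `a`, leads from the
other external half-edge of the melon to the end; the others are the inner edges of the melon. -/
inductive MelonCode (n : ℕ) : Type
  | nil : MelonCode n
  | node (x y : Fin n) (a : Fin 4) (π : Equiv.Perm (Fin 4)) (c : Fin 4 → MelonCode n) :
      MelonCode n

/-- The starting half-edges of the four parts of a code that starts with a melon. -/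
def melonStart {n : ℕ} (x y : Fin n) (a : Fin 4) (π : Equiv.Perm (Fin 4)) (i : Fin 4) :
    HalfEdge n := if i = a then Sum.inr (y, π i) else Sum.inr (x, i)

/-- The final half-edges of the four parts of a code that starts with a melon. -/
def melonEnd {n : ℕ} (y : Fin n) (a : Fin 4) (π : Equiv.Perm (Fin 4)) (t : HalfEdge n)
    (i : Fin 4) : HalfEdge n := if i = a then t else Sum.inr (y, π i)

namespace MelonCode

variable {n : ℕ}

/-- The number of occurrences of a vertex in a code. -/
def count : MelonCode n → Fin n → ℕ
  | nil, _ => 0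
  | node x y _ _ c, v => (if v = x then 1 else 0) + (if v = y then 1 else 0) + ∑ i, (c i).count v

/-- The number of occurrences of the vertex of a half-edge in a code. -/
def halfCount (T : MelonCode n) : HalfEdge n → ℕ
  | Sum.inl _ => 0
  | Sum.inr (v, _) => T.count v

/-- `T.Encodes G u t`: the part of `G` that is entered at `u` and left at `t` has the code `T`. -/
def Encodes (G : Graph n) : MelonCode n → HalfEdge n → HalfEdge n → Prop
  | nil, u, t => u = t
  | node x y a π c, u, t => u = Sum.inr (x, a) ∧ G.wavy x = y ∧ G.propagator x = π ∧
      ∀ i, Encodes G (c i) (G.mate (melonStart x y a π i)) (melonEnd y a π t i)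

/-- A code determines the edges, wavy edges and propagators of the part of the graph that it
encodes. -/
theorem Encodes.determines {G G' : Graph n} (T : MelonCode n) {s t : HalfEdge n}
    (h : Encodes G T (G.mate s) t) (h' : Encodes G' T (G'.mate s) t) :
    (∀ k, (k = s ∨ k = t ∨ T.halfCount k ≠ 0) → G.mate k = G'.mate k) ∧
      ∀ v, T.count v ≠ 0 → G.wavy v = G'.wavy v ∧ G.propagator v = G'.propagator v := by
  induction T generalizing s t with
  | nil =>
    have e : G.mate s = t := h
    have e' : G'.mate s = t := h'
    refine ⟨?_, fun v hv => absurd rfl hv⟩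
    rintro k (rfl | rfl | hk)
    · rw [e, e']
    · rw [← e, G.mate_mate, e, ← e', G'.mate_mate]
    · rcases k with b | ⟨v, a⟩ <;> exact absurd rfl hk
  | node x y a π c ih =>
    obtain ⟨h1, h2, h3, h4⟩ := h
    obtain ⟨h1', h2', h3', h4'⟩ := h'
    have IH := fun i => ih i (h4 i) (h4' i)
    have hs : ∀ i, G.mate (melonStart x y a π i) = G'.mate (melonStart x y a π i) :=
      fun i => (IH i).1 _ (Or.inl rfl)
    have he : ∀ i, G.mate (melonEnd y a π t i) = G'.mate (melonEnd y a π t i) :=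
      fun i => (IH i).1 _ (Or.inr (Or.inl rfl))
    have hsum : ∀ v, (node x y a π c).count v ≠ 0 → v = x ∨ v = y ∨ ∃ i, (c i).count v ≠ 0 := by
      intro v hv
      by_contra hcon
      simp only [not_or, not_exists, not_not] at hcon
      exact hv (by simp [count, hcon])
    have ht : G.mate t = G'.mate t := by simpa [melonEnd] using he a
    constructor
    · rintro k (rfl | rfl | hk)
      · rw [h1, h1']
      · exact ht
      · rcases k with b | ⟨v, j⟩
        · exact absurd rfl hk
        rcases hsum v hk with rfl | rfl | ⟨i, hi⟩
        · by_cases hj : j = a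
          · rw [hj, ← h1, G.mate_mate, h1, ← h1', G'.mate_mate]
          · simpa [melonStart, hj] using hs j
        · by_cases hj : π.symm j = a
          · have h5 := hs (π.symm j)
            rwa [melonStart, if_pos hj, Equiv.apply_symm_apply] at h5
          · simpa [melonEnd, hj] using he (π.symm j)
        · exact (IH i).1 _ (Or.inr (Or.inr hi))
    · intro v hv
      rcases hsum v hv with rfl | rfl | ⟨i, hi⟩
      · exact ⟨h2.trans h2'.symm, h3.trans h3'.symm⟩
      · have e := G.propagator_wavy x
        have e' := G'.propagator_wavy x
        rw [h2, h3] at e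
        rw [h2', h3'] at e'
        refine ⟨?_, e.trans e'.symm⟩
        rw [← h2, G.wavy_wavy, h2, ← h2', G'.wavy_wavy]
      · exact (IH i).2 v hi

theorem sum_eq_single_vertex (x : Fin n) (k : HalfEdge n) (σ : Equiv.Perm (Fin 4)) :
    ∑ i, (if k = Sum.inr (x, σ i) then 1 else 0) =
      (Sum.elim (fun _ => 0) (fun va => if va.1 = x then 1 else 0) k : ℕ) := by
  rw [Equiv.sum_comp σ fun i => if k = Sum.inr (x, i) then 1 else 0]
  rcases k with b | ⟨v, a⟩
  · simp
  · by_cases hv : v = x <;> simp [hv]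

/-- In a code that starts with a melon, each half-edge of the melon other than the one entered
first is an end of one of the four parts. -/
theorem sum_start_end (x y : Fin n) (a : Fin 4) (π : Equiv.Perm (Fin 4)) (t k : HalfEdge n) :
    ∑ i, ((if k = melonStart x y a π i then 1 else 0) +
        (if k = melonEnd y a π t i then 1 else 0)) + (if k = Sum.inr (x, a) then 1 else 0) =
      (if k = t then 1 else 0) +
        (Sum.elim (fun _ => 0) (fun va => if va.1 = x then 1 else 0) k +
        Sum.elim (fun _ => 0) (fun va => if va.1 = y then 1 else 0) k : ℕ) := by
  have hterm : ∀ i, ((if k = melonStart x y a π i then 1 else 0) +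
      (if k = melonEnd y a π t i then 1 else 0)) +
      (if i = a then (if k = Sum.inr (x, a) then 1 else 0) else 0) =
      (if k = Sum.inr (x, i) then 1 else 0) + (if k = Sum.inr (y, π i) then 1 else 0) +
      (if i = a then (if k = t then 1 else 0) else 0) := by
    intro i
    by_cases hi : i = a
    · subst hi
      simp only [melonStart, melonEnd, if_true]
      ring
    · simp only [melonStart, melonEnd, if_neg hi]
  have := Finset.sum_congr (rfl : (Finset.univ : Finset (Fin 4)) = Finset.univ)
    fun i _ => hterm i
  rw [Finset.sum_add_distrib, Finset.sum_add_distrib (f := fun i => _ + _),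
    Finset.sum_ite_eq' Finset.univ a, Finset.sum_ite_eq' Finset.univ a,
    Finset.sum_add_distrib (f := fun i => if k = Sum.inr (x, i) then 1 else 0),
    sum_eq_single_vertex y k π] at this
  have h1 : ∑ i, (if k = Sum.inr (x, i) then 1 else 0) = _ :=
    sum_eq_single_vertex x k (Equiv.refl _)
  rw [h1] at this
  simp only [Finset.mem_univ, if_true] at this
  omega

section Insertion

variable {G : Graph n} {G' : Graph (n + 2)} {f : Fin n ↪o Fin (n + 2)} {x y : Fin (n + 2)}
  {s t : HalfEdge n}

/-- If the first edge is the one on which the melon is inserted, then the melon precedes the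
code. -/
theorem exists_encodes_edge (I : InsertsMelon G G' f x y s t) {s₀ : HalfEdge n}
    {t₀ : HalfEdge (n + 2)} {T : MelonCode (n + 2)}
    (h : Encodes G' T (HalfEdge.rename f (G.mate s₀)) t₀) :
    ∃ T', Encodes G' T' (G'.mate (HalfEdge.rename f s₀)) t₀ ∧
      ∀ v, T'.count v = T.count v + if s₀ = s ∨ s₀ = t then
        (if v = x then 1 else 0) + (if v = y then 1 else 0) else 0 := by
  classical
  have hcount : ∀ (x' y' : Fin (n + 2)) a π v,
      (node x' y' a π (fun i => if i = a then T else nil)).count v =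
      T.count v + ((if v = x' then 1 else 0) + (if v = y' then 1 else 0)) := by
    intro x' y' a π v
    have : ∑ i, (if i = a then T else nil).count v = T.count v := by
      rw [Finset.sum_eq_single a]
      · simp
      · intro i _ hi
        simp [hi, count]
      · simp
    rw [count, this, add_comm]
  by_cases hs : s₀ = s
  · subst hs
    refine ⟨node x y 0 (G'.propagator x) fun i => if i = 0 then T else nil,
      ⟨I.mate_rename_left, I.wavy_new, rfl, fun i => ?_⟩, fun v => ?_⟩
    · by_cases hi : i = 0
      · subst hi
        rw [I.mate_left] at h
        simp only [melonStart, melonEnd, if_true]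
        rwa [I.mate_y]
      · simp only [melonStart, melonEnd, if_neg hi]
        exact I.mate_inner i hi
    · rw [hcount, if_pos (Or.inl rfl)]
  by_cases ht : s₀ = t
  · subst ht
    have hw : G'.wavy y = x := by rw [← I.wavy_new, G'.wavy_wavy]
    have hp : G'.propagator y = (G'.propagator x)⁻¹ := by rw [← I.wavy_new, G'.propagator_wavy]
    refine ⟨node y x (G'.propagator x 0) (G'.propagator y) fun i =>
      if i = G'.propagator x 0 then T else nil, ⟨I.mate_rename_right, hw, rfl, fun i => ?_⟩,
      fun v => ?_⟩
    · by_cases hi : i = G'.propagator x 0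
      · subst hi
        rw [I.mate_right] at h
        simp only [melonStart, melonEnd, if_true]
        rw [hp, Equiv.Perm.inv_def, Equiv.symm_apply_apply, I.mate_x]
        exact h
      · simp only [melonStart, melonEnd, if_neg hi]
        have h0 : (G'.propagator x).symm i ≠ 0 := fun e => hi (by rw [← e]; simp)
        have := I.mate_inner' _ h0
        rw [Equiv.apply_symm_apply] at this
        rw [hp]
        exact this
    · rw [hcount, if_pos (Or.inr rfl)]
      omega
  · refine ⟨T, ?_, fun v => ?_⟩
    · rwa [I.mate_old s₀ hs ht]
    · rw [if_neg (by tauto), add_zero]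

/-- The code after an insertion contains the melon once for each occurrence of its edge. -/
theorem exists_encodes_insertion (I : InsertsMelon G G' f x y s t) (T : MelonCode n)
    {u t₀ : HalfEdge n} (h : Encodes G T u t₀) :
    ∃ T', Encodes G' T' (HalfEdge.rename f u) (HalfEdge.rename f t₀) ∧
      (∀ v, T'.count (f v) = T.count v) ∧
      ∀ z, z = x ∨ z = y → T'.count z + (if s = u then 1 else 0) =
        (if s = t₀ then 1 else 0) + T.halfCount s := by
  induction T generalizing u t₀ with
  | nil =>
    obtain rfl : u = t₀ := h
    refine ⟨nil, rfl, fun _ => rfl, fun z _ => ?_⟩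
    have : (nil : MelonCode n).halfCount s = 0 := by rcases s with b | ⟨v, a⟩ <;> rfl
    rw [this]
    exact add_comm _ _
  | node x₁ y₁ a π c ih =>
    obtain ⟨h1, h2, h3, h4⟩ := h
    choose c₁ hc₁ hold hnew using fun i => ih i (h4 i)
    choose c' hc' hcount using fun i => exists_encodes_edge I (hc₁ i)
    -- Each part of the code starts after the edge from `melonStart`, which may be the edge where the
    -- melon is inserted; the two ends of that edge account for the two indicator terms.
    have hst : ∀ k : HalfEdge n, k = t ↔ s = G.mate k := by
      intro k
      rw [← I.mate_right, G.mate_injective.eq_iff, eq_comm]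
    have hpart : ∀ i z, z = x ∨ z = y → (c' i).count z =
        (if s = melonStart x₁ y₁ a π i then 1 else 0) +
        (if s = melonEnd y₁ a π t₀ i then 1 else 0) + (c i).halfCount s := by
      intro i z hz
      have e1 := hnew i z hz
      rw [hcount]
      have e2 : (if z = x then 1 else 0) + (if z = y then 1 else 0) = 1 := by
        rcases hz with rfl | rfl
        · simp [I.ne]
        · simp [I.ne.symm]
      rw [e2]
      generalize melonStart x₁ y₁ a π i = k at e1 ⊢
      by_cases hk : k = s
      · have hk' : s ≠ G.mate k := fun e => G.mate_ne k (e.symm.trans hk.symm)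
        simp only [if_neg hk', add_zero] at e1
        rw [if_pos (Or.inl hk), if_pos hk.symm, e1]
        ring
      · by_cases hkt : k = t
        · rw [if_pos ((hst k).1 hkt)] at e1
          rw [if_pos (Or.inr hkt), if_neg (Ne.symm hk), e1]
          ring
        · have hk' : s ≠ G.mate k := fun e => hkt ((hst k).2 e)
          simp only [if_neg hk', add_zero] at e1
          rw [if_neg (by tauto), if_neg (Ne.symm hk), e1]
          ring
    refine ⟨node (f x₁) (f y₁) a π c', ⟨?_, ?_, ?_, fun i => ?_⟩, fun v => ?_, fun z hz => ?_⟩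
    · rw [h1]; rfl
    · rw [I.wavy_old, h2]
    · rw [I.propagator_old, h3]
    · have e1 : melonStart (f x₁) (f y₁) a π i = HalfEdge.rename f (melonStart x₁ y₁ a π i) := by
        unfold melonStart; split <;> rfl
      have e2 : melonEnd (f y₁) a π (HalfEdge.rename f t₀) i =
          HalfEdge.rename f (melonEnd y₁ a π t₀ i) := by
        unfold melonEnd; split <;> rfl
      rw [e1, e2]
      exact hc' i
    · have e : ∀ i, (c' i).count (f v) = (c i).count v := by
        intro i
        rw [hcount, hold, if_neg (I.ne_x v), if_neg (I.ne_y v)]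
        simp
      simp only [count, e, f.injective.eq_iff]
    · have hx : z ≠ f x₁ := by
        rcases hz with rfl | rfl
        · exact (I.ne_x _).symm
        · exact (I.ne_y _).symm
      have hy : z ≠ f y₁ := by
        rcases hz with rfl | rfl
        · exact (I.ne_x _).symm
        · exact (I.ne_y _).symm
      have e := sum_start_end x₁ y₁ a π t₀ s
      have hhalf : (node x₁ y₁ a π c).halfCount s =
          Sum.elim (fun _ => 0) (fun va => if va.1 = x₁ then 1 else 0) s +
          Sum.elim (fun _ => 0) (fun va => if va.1 = y₁ then 1 else 0) s +
          ∑ i, (c i).halfCount s := by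
        rcases s with b | ⟨v, j⟩
        · simp [halfCount]
        · simp [halfCount, count]
      rw [hhalf, count, if_neg hx, if_neg hy, Finset.sum_congr rfl fun i _ => hpart i z hz,
        Finset.sum_add_distrib, h1]
      omega

end Insertion

end MelonCode

/-- A melonic graph has a code in which each vertex occurs exactly once. -/
theorem IsMelonic.exists_code {n : ℕ} {G : Graph n} (hG : IsMelonic G) :
    ∃ T : MelonCode n, T.Encodes G (G.mate (Sum.inl true)) (Sum.inl false) ∧
      ∀ v, T.count v = 1 := by
  induction hG with
  | trivial G =>
    refine ⟨.nil, ?_, fun v => v.elim0⟩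
    change G.mate (Sum.inl true) = Sum.inl false
    have h1 := G.mate_ne (Sum.inl true)
    generalize G.mate (Sum.inl true) = g at h1
    rcases g with (_ | _) | ⟨v, -⟩
    · rfl
    · exact absurd rfl h1
    · exact v.elim0
  | @insertion n G G' _ hI ih =>
    obtain ⟨T, hT, hc⟩ := ih
    obtain ⟨f, x, y, s, t, I⟩ := hI.insertsMelon
    obtain ⟨T₁, h1, h2, h3⟩ := MelonCode.exists_encodes_insertion I T hT
    obtain ⟨T₂, h4, h5⟩ := MelonCode.exists_encodes_edge I h1
    refine ⟨T₂, h4, fun v => ?_⟩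
    have hnew : ∀ z, z = x ∨ z = y → T₂.count z = 1 := by
      intro z hz
      have e1 := h3 z hz
      have e2 : (if z = x then 1 else 0) + (if z = y then 1 else 0) = 1 := by
        rcases hz with rfl | rfl
        · simp [I.ne]
        · simp [I.ne.symm]
      rw [h5, e2]
      have hst : (Sum.inl true : HalfEdge n) = t ↔ s = G.mate (Sum.inl true) := by
        rw [← I.mate_right, G.mate_injective.eq_iff, eq_comm]
      simp only [hst]
      rcases s with (_ | _) | ⟨v, j⟩
      · simp only [MelonCode.halfCount] at e1
        simp at e1 ⊢
        split_ifs at e1 ⊢ <;> omega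
      · have : (Sum.inl true : HalfEdge n) ≠ G.mate (Sum.inl true) := (G.mate_ne _).symm
        simp only [MelonCode.halfCount] at e1
        simp [this] at e1 ⊢
        omega
      · simp only [MelonCode.halfCount, hc] at e1
        simp at e1 ⊢
        split_ifs at e1 ⊢ <;> omega
    rcases I.vertex_cases v with rfl | rfl | ⟨u, rfl⟩
    · exact hnew _ (Or.inl rfl)
    · exact hnew _ (Or.inr rfl)
    · rw [h5, h2, hc, if_neg (I.ne_x u), if_neg (I.ne_y u)]
      simp

namespace MelonCode

variable {n : ℕ}

/-- The shape of a code, in prefix notation. -/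
def shape : MelonCode n → List (Option (Fin 4 × Equiv.Perm (Fin 4)))
  | nil => [none]
  | node _ _ a π c => some (a, π) ::
      ((c 0).shape ++ ((c 1).shape ++ ((c 2).shape ++ (c 3).shape)))

/-- The vertices of a code, in prefix order. -/
def labels : MelonCode n → List (Fin n)
  | nil => []
  | node x y _ _ c => x :: y ::
      ((c 0).labels ++ ((c 1).labels ++ ((c 2).labels ++ (c 3).labels)))

/-- The prefix notation is uniquely readable, hence a code is determined by its shape and its
labels. -/
theorem prefix_unique (T T' : MelonCode n) {r r' : List (Option (Fin 4 × Equiv.Perm (Fin 4)))}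
    {q q' : List (Fin n)} (h : T.shape ++ r = T'.shape ++ r') (hq : T.labels ++ q = T'.labels ++ q') :
    T = T' ∧ r = r' ∧ q = q' := by
  induction T generalizing T' r r' q q' with
  | nil =>
    cases T' with
    | nil =>
      simp only [shape, List.cons_append, List.nil_append, List.cons.injEq, true_and] at h
      exact ⟨rfl, h, hq⟩
    | node => simp [shape] at h
  | node x y a π c ih =>
    cases T' with
    | nil => simp [shape] at h
    | node x' y' a' π' c' =>
      simp only [shape, labels, List.cons_append, List.append_assoc, List.cons.injEq,
        Option.some.injEq, Prod.mk.injEq] at h hq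
      obtain ⟨⟨rfl, rfl⟩, h⟩ := h
      obtain ⟨rfl, rfl, hq⟩ := hq
      obtain ⟨e0, h, hq⟩ := ih 0 _ h hq
      obtain ⟨e1, h, hq⟩ := ih 1 _ h hq
      obtain ⟨e2, h, hq⟩ := ih 2 _ h hq
      obtain ⟨e3, h, hq⟩ := ih 3 _ h hq
      refine ⟨?_, h, hq⟩
      congr 1
      funext i
      fin_cases i <;> assumption

theorem length_shape (T : MelonCode n) : T.shape.length = 2 * T.labels.length + 1 := by
  induction T with
  | nil => rfl
  | node x y a π c ih =>
    simp only [shape, labels, List.length_cons, List.length_append, ih]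
    omega

theorem count_labels (T : MelonCode n) (v : Fin n) : T.labels.count v = T.count v := by
  induction T with
  | nil => rfl
  | node x y a π c ih =>
    simp only [labels, count, List.count_cons, List.count_append, ih, Fin.sum_univ_four,
      beq_iff_eq]
    have e : ∀ z, (if z = v then 1 else 0) = if v = z then 1 else 0 := fun z => by
      simp only [eq_comm]
    rw [e x, e y]
    omega

theorem labels_perm {T : MelonCode n} (hT : ∀ v, T.count v = 1) :
    T.labels.Perm (List.finRange n) := by
  rw [List.perm_iff_count]
  intro v
  rw [count_labels, hT, List.count_eq_one_of_mem (List.nodup_finRange n) (List.mem_finRange v)]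

end MelonCode

/-- The shape is a word of `2 * n + 1` letters from an alphabet of `1 + 4 * 4!` letters, and the
labels are a permutation of the vertices. -/
theorem card_isMelonic_le (n : ℕ) :
    Nat.card {G : Graph n // IsMelonic G} ≤ 97 ^ (2 * n + 1) * n.factorial := by
  classical
  choose T hT hc using fun G : {G : Graph n // IsMelonic G} => G.2.exists_code
  have hperm := fun G => MelonCode.labels_perm (hc G)
  have hlen : ∀ G, (T G).shape.length = 2 * n + 1 := by
    intro G
    rw [MelonCode.length_shape, (hperm G).length_eq, List.length_finRange]
  let Φ : {G : Graph n // IsMelonic G} →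
      List.Vector (Option (Fin 4 × Equiv.Perm (Fin 4))) (2 * n + 1) ×
        (List.finRange n).permutations.toFinset :=
    fun G => (⟨(T G).shape, hlen G⟩, ⟨(T G).labels, by
      rw [List.mem_toFinset, List.mem_permutations]; exact hperm G⟩)
  have hΦ : Function.Injective Φ := by
    intro G H h
    have h1 : (T G).shape = (T H).shape := congrArg (fun z => z.1.1) h
    have h2 : (T G).labels = (T H).labels := congrArg (fun z => z.2.1) h
    have h3 : T G = T H :=
      (MelonCode.prefix_unique (T G) (T H) (r := []) (r' := []) (q := []) (q' := [])
        (by rw [h1]) (by rw [h2])).1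
    have hH := hT H
    rw [← h3] at hH
    have hdet := MelonCode.Encodes.determines (T G) (hT G) hH
    refine Subtype.ext (Graph.ext_of_mate (fun k => hdet.1 k ?_) (fun v => (hdet.2 v ?_).1)
      (fun v => (hdet.2 v ?_).2))
    · rcases k with (_ | _) | ⟨v, a⟩
      · exact Or.inr (Or.inl rfl)
      · exact Or.inl rfl
      · refine Or.inr (Or.inr ?_)
        simp [MelonCode.halfCount, hc]
    all_goals simp [hc]
  refine (Nat.card_le_card_of_injective Φ hΦ).trans ?_
  rw [Nat.card_prod, Nat.card_eq_fintype_card, Nat.card_eq_fintype_card, card_vector,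
    Fintype.card_coe]
  have e : Fintype.card (Option (Fin 4 × Equiv.Perm (Fin 4))) = 97 := by
    rw [Fintype.card_option, Fintype.card_prod, Fintype.card_perm, Fintype.card_fin]
    rfl
  rw [e]
  refine Nat.mul_le_mul_left _ ((List.toFinset_card_le _).trans_eq ?_)
  rw [List.length_permutations, List.length_finRange]

/-- For `n = 0` the general bound is not sharp enough. -/
theorem card_isMelonic_zero_le : Nat.card {G : Graph 0 // IsMelonic G} ≤ 1 := by
  have hroot : ∀ (G : Graph 0) (b : Bool), G.mate (Sum.inl b) = Sum.inl (!b) := by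
    intro G b
    have h1 := G.mate_ne (Sum.inl b)
    generalize G.mate (Sum.inl b) = g at h1
    rcases g with c | ⟨v, -⟩
    · cases b <;> cases c <;> simp_all
    · exact v.elim0
  have : Subsingleton {G : Graph 0 // IsMelonic G} := by
    refine ⟨fun G H => Subtype.ext (Graph.ext_of_mate (fun h => ?_) (fun v => v.elim0)
      (fun v => v.elim0))⟩
    rcases h with b | ⟨v, -⟩
    · rw [hroot, hroot]
    · exact v.elim0
  exact Finite.card_le_one_iff_subsingleton.2 this

theorem exists_card_isMelonic_le : ∃ K : ℝ, 0 < K ∧ ∀ n : ℕ,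
    (Nat.card {G : Graph n // IsMelonic G} : ℝ) ≤ K ^ n * (n.factorial : ℝ) := by
  refine ⟨97 ^ 3, by norm_num, fun n => ?_⟩
  rcases Nat.eq_zero_or_pos n with rfl | hn
  · have := card_isMelonic_zero_le
    simpa using this
  · have h1 := card_isMelonic_le n
    have h2 : 97 ^ (2 * n + 1) ≤ (97 ^ 3) ^ n := by
      rw [← pow_mul]
      exact Nat.pow_le_pow_right (by norm_num) (by omega)
    have h3 := h1.trans (Nat.mul_le_mul_right _ h2)
    exact_mod_cast h3

/-! ### Sobolev sums -/

theorem eventually_mem_Ioo : ∀ᶠ p : ℝ in 𝓝[<] 1, 1 / 2 < p ∧ p < 1 :=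
  Ioo_mem_nhdsLT (by norm_num)

theorem tendsto_modeNumber : Tendsto modeNumber (𝓝[<] 1) atTop := by
  have h1 : Tendsto (fun p : ℝ => 1 - p) (𝓝[<] 1) (𝓝[>] 0) := by
    refine tendsto_nhdsWithin_of_tendsto_nhds_of_eventually_within _ ?_ ?_
    · have : Tendsto (fun p : ℝ => 1 - p) (𝓝 1) (𝓝 (1 - 1)) :=
        tendsto_const_nhds.sub tendsto_id
      rw [sub_self] at this
      exact this.mono_left nhdsWithin_le_nhds
    · filter_upwards [self_mem_nhdsWithin] with p hp
      simpa using hp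
  have h2 := tendsto_inv_nhdsGT_zero.comp h1
  refine h2.congr fun p => ?_
  simp [modeNumber]

theorem one_sub_eq {p : ℝ} (h1 : p < 1) : p = 1 - 1 / modeNumber p := by
  have : (1 : ℝ) - p ≠ 0 := by linarith
  rw [modeNumber]
  field_simp
  ring

theorem one_le_modeNumber {p : ℝ} (h0 : 0 < p) (h1 : p < 1) : 1 ≤ modeNumber p := by
  rw [modeNumber, le_div_iff₀ (by linarith)]
  linarith

theorem exists_rpow_le_exp {γ : ℝ} (hγ : 0 ≤ γ) :
    ∃ C : ℝ, 0 < C ∧ ∀ x : ℝ, 0 ≤ x → x ^ γ ≤ C * Real.exp x := by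
  obtain ⟨k, hk⟩ := exists_nat_ge γ
  refine ⟨1 + k.factorial, by positivity, fun x hx => ?_⟩
  have h1 : x ^ γ ≤ 1 + x ^ k := by
    rcases le_total x 1 with h | h
    · have := Real.rpow_le_one hx h hγ
      have : 0 ≤ x ^ k := by positivity
      linarith
    · have h2 := Real.rpow_le_rpow_of_exponent_le h hk
      rw [Real.rpow_natCast] at h2
      linarith
  have h2 := Real.pow_div_factorial_le_exp x hx k
  rw [div_le_iff₀ (by positivity)] at h2
  have h3 := Real.one_le_exp hx
  linarith

/-- The Sobolev sum of an exponentially decaying amplitude: half of the decay controls the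
weight `r ^ γ`, the other half gives a geometric series. -/
theorem exists_sobolev_bound {γ : ℝ} (hγ : 0 ≤ γ) : ∃ C : ℝ, 0 < C ∧ ∀ p : ℝ, 0 < p → p < 1 →
    (Summable fun r : ℕ => (r : ℝ) ^ γ / modeNumber p * p ^ ((r : ℝ) / 2)) ∧
    ∑' r : ℕ, (r : ℝ) ^ γ / modeNumber p * p ^ ((r : ℝ) / 2) ≤ C * modeNumber p ^ γ := by
  obtain ⟨C, hC, hexp⟩ := exists_rpow_le_exp hγ
  refine ⟨4 * (C * 4 ^ γ), by positivity, fun p h0 h1 => ?_⟩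
  have hN := modeNumber_pos h1
  set N := modeNumber p with hNdef
  set q := p ^ (1 / 4 : ℝ) with hq
  have q0 : 0 < q := Real.rpow_pos_of_pos h0 _
  have q1 : q < 1 := Real.rpow_lt_one h0.le h1 (by norm_num)
  have q4 : q ^ 4 = p := by
    rw [hq, ← Real.rpow_natCast, ← Real.rpow_mul h0.le]
    norm_num
  have hgeo := hasSum_geometric_of_lt_one q0.le q1
  have hqN : (1 - q)⁻¹ ≤ 4 * N := by
    have hb := one_add_mul_le_pow (a := q - 1) (by linarith) 4
    have e : 1 + (q - 1) = q := by ring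
    rw [e, q4] at hb
    push_cast at hb
    rw [hNdef, modeNumber, mul_one_div, inv_eq_one_div, div_le_div_iff₀ (by linarith) (by linarith)]
    linarith
  have hterm : ∀ r : ℕ, (r : ℝ) ^ γ / N * p ^ ((r : ℝ) / 2) ≤ C * 4 ^ γ * N ^ γ / N * q ^ r := by
    intro r
    have e1 : p ^ ((r : ℝ) / 2) = q ^ r * q ^ r := by
      rw [hq, ← Real.rpow_mul_natCast h0.le, ← Real.rpow_add h0]
      congr 1; ring
    have e2 : (r : ℝ) ^ γ * q ^ r ≤ C * 4 ^ γ * N ^ γ := by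
      have hx : (0 : ℝ) ≤ r / (4 * N) := by positivity
      have h2 := hexp _ hx
      have h3 : q ^ r ≤ Real.exp (-(r / (4 * N))) := by
        have hp : p ≤ Real.exp (-(1 / N)) := by
          have := Real.add_one_le_exp (-(1 / N))
          rw [one_sub_eq h1]
          linarith
        rw [hq, ← Real.rpow_mul_natCast h0.le]
        refine (Real.rpow_le_rpow h0.le hp (by positivity)).trans_eq ?_
        rw [← Real.exp_mul]
        congr 1
        field_simp
      have h4 : (r : ℝ) ^ γ = (r / (4 * N)) ^ γ * (4 * N) ^ γ := by
        rw [← Real.mul_rpow hx (by positivity)]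
        congr 1
        field_simp
      rw [h4, Real.mul_rpow (by norm_num) hN.le]
      calc (r / (4 * N)) ^ γ * (4 ^ γ * N ^ γ) * q ^ r
          ≤ C * Real.exp (r / (4 * N)) * (4 ^ γ * N ^ γ) * Real.exp (-(r / (4 * N))) := by
            gcongr
        _ = C * (4 ^ γ * N ^ γ) * (Real.exp (r / (4 * N)) * Real.exp (-(r / (4 * N)))) := by ring
        _ = C * 4 ^ γ * N ^ γ := by rw [← Real.exp_add]; simp; ring
    calc (r : ℝ) ^ γ / N * p ^ ((r : ℝ) / 2) = (r : ℝ) ^ γ * q ^ r / N * q ^ r := by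
          rw [e1]; ring
      _ ≤ _ := by gcongr
  have hS := hgeo.summable.mul_left (C * 4 ^ γ * N ^ γ / N)
  have hS' : Summable fun r : ℕ => (r : ℝ) ^ γ / N * p ^ ((r : ℝ) / 2) :=
    Summable.of_nonneg_of_le (fun r => by positivity) hterm hS
  refine ⟨hS', (hS'.tsum_le_tsum hterm hS).trans ?_⟩
  rw [tsum_mul_left, hgeo.tsum_eq]
  calc C * 4 ^ γ * N ^ γ / N * (1 - q)⁻¹ ≤ C * 4 ^ γ * N ^ γ / N * (4 * N) := by gcongr
    _ = _ := by field_simp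

theorem norm_sign {n : ℕ} (T : HeapTree n) : ‖T.sign‖ = 1 := by
  rw [HeapTree.sign, norm_prod]
  refine Finset.prod_eq_one fun v _ => ?_
  split <;> simp

/-- The absolute value of the numerical prefactor of a graph of order `n`. -/
noncomputable def prefactor (n : ℕ) : ℝ := 1 / ((n.factorial : ℝ) * Real.sqrt 8 ^ n)

theorem prefactor_pos (n : ℕ) : 0 < prefactor n := by
  unfold prefactor
  positivity

namespace Graph

variable {n : ℕ} (G : Graph n)

theorem twoPointTerm_eq (r : ℕ) (p : ℝ) :
    G.twoPointTerm r p = (prefactor n : ℂ) * G.tree.sign * (G.amplitude r p : ℂ) := by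
  rw [twoPointTerm, prefactor]
  push_cast
  rfl

theorem norm_twoPointTerm (r : ℕ) {p : ℝ} (h0 : 0 < p) (h1 : p < 1) :
    ‖G.twoPointTerm r p‖ = prefactor n * G.amplitude r p := by
  rw [twoPointTerm_eq, norm_mul, norm_mul, norm_sign, Complex.norm_real, Complex.norm_real,
    Real.norm_of_nonneg (prefactor_pos n).le, Real.norm_of_nonneg (G.amplitude_nonneg r h0 h1),
    mul_one]

theorem norm_twoPointTerm_le (r : ℕ) {p : ℝ} (h0 : 0 < p) (h1 : p < 1) :
    ‖G.twoPointTerm r p‖ ≤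
      prefactor n * (2 ^ n * modeNumber p ^ (-G.degree)) * p ^ ((r : ℝ) / 2) := by
  rw [G.norm_twoPointTerm r h0 h1, mul_assoc]
  exact mul_le_mul_of_nonneg_left (G.amplitude_bound r h0 h1).2 (prefactor_pos n).le

theorem norm_weight_mul_le {γ p c : ℝ} (h1 : p < 1) (r : ℕ) {z : ℂ}
    (hz : ‖z‖ ≤ c * p ^ ((r : ℝ) / 2)) :
    ‖(((r : ℝ) ^ γ / modeNumber p : ℝ) : ℂ) * z‖ ≤
      c * ((r : ℝ) ^ γ / modeNumber p * p ^ ((r : ℝ) / 2)) := by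
  have hN := modeNumber_pos h1
  rw [norm_mul, Complex.norm_real, Real.norm_of_nonneg (by positivity)]
  calc (r : ℝ) ^ γ / modeNumber p * ‖z‖ ≤ (r : ℝ) ^ γ / modeNumber p * (c * p ^ ((r : ℝ) / 2)) := by
        gcongr
    _ = _ := by ring

theorem summable_sobolev {γ : ℝ} (hγ : 0 ≤ γ) {p : ℝ} (h0 : 0 < p) (h1 : p < 1) :
    Summable fun r : ℕ => (((r : ℝ) ^ γ / modeNumber p : ℝ) : ℂ) * G.twoPointTerm r p := by
  obtain ⟨C, -, hC⟩ := exists_sobolev_bound hγ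
  exact Summable.of_norm_bounded ((hC p h0 h1).1.mul_left _) fun r =>
    norm_weight_mul_le h1 r (G.norm_twoPointTerm_le r h0 h1)

theorem sobolevTerm_isBigO {γ : ℝ} (hγ : 0 ≤ γ) :
    (fun p : ℝ => G.sobolevTerm γ p) =O[𝓝[<] 1]
      fun p : ℝ => modeNumber p ^ (γ - (G.degree : ℝ)) := by
  obtain ⟨C, hC0, hC⟩ := exists_sobolev_bound hγ
  refine IsBigO.of_bound (prefactor n * 2 ^ n * C) ?_
  filter_upwards [eventually_mem_Ioo] with p hp
  have h0 : 0 < p := by linarith [hp.1]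
  have hN := modeNumber_pos hp.2
  obtain ⟨hS, hle⟩ := hC p h0 hp.2
  have hpre := prefactor_pos n
  rw [Real.norm_of_nonneg (by positivity), Real.rpow_sub hN, Real.rpow_intCast, sobolevTerm]
  refine (tsum_of_norm_bounded (hS.hasSum.mul_left _) fun r =>
    norm_weight_mul_le hp.2 r (G.norm_twoPointTerm_le r h0 hp.2)).trans ?_
  rw [zpow_neg]
  calc prefactor n * (2 ^ n * (modeNumber p ^ G.degree)⁻¹) *
        ∑' r : ℕ, (r : ℝ) ^ γ / modeNumber p * p ^ ((r : ℝ) / 2)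
      ≤ prefactor n * (2 ^ n * (modeNumber p ^ G.degree)⁻¹) * (C * modeNumber p ^ γ) := by gcongr
    _ = _ := by ring

theorem amplitude_isBigO (r : ℕ) : (fun p : ℝ => G.amplitude r p) =O[𝓝[<] 1]
    fun p : ℝ => modeNumber p ^ (-G.degree) := by
  refine IsBigO.of_bound (2 ^ n) ?_
  filter_upwards [eventually_mem_Ioo] with p hp
  have h0 : 0 < p := by linarith [hp.1]
  have hN := modeNumber_pos hp.2
  rw [Real.norm_of_nonneg (G.amplitude_nonneg r h0 hp.2), Real.norm_of_nonneg (by positivity)]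
  refine (G.amplitude_bound r h0 hp.2).2.trans ?_
  exact mul_le_of_le_one_right (by positivity) (Real.rpow_le_one h0.le hp.2.le (by positivity))

end Graph

/-- The weighted amplitudes with root momenta between `N` and `4 N` are all of order
`N ^ γ / N`. -/
theorem IsMelonic.exists_le_sobolev {n : ℕ} {G : Graph n} (hG : IsMelonic G) {γ : ℝ}
    (hγ : 0 ≤ γ) : ∃ c : ℝ, 0 < c ∧ ∀ p : ℝ, 1 / 2 < p → p < 1 →
      c * modeNumber p ^ γ ≤ ‖G.sobolevTerm γ p‖ := by
  set M : ℕ := 2 * n + 1 with hM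
  refine ⟨prefactor n * (Real.exp (-(8 * M)) / (2 * (n : ℝ) + 1) ^ n), by
    have := prefactor_pos n
    positivity, fun p h0' h1 => ?_⟩
  have h0 : 0 < p := by linarith
  have hN := modeNumber_pos h1
  have hN1 := one_le_modeNumber h0 h1
  have hpre := prefactor_pos n
  have hsum := G.summable_sobolev hγ h0 h1
  set N := modeNumber p with hNdef
  let a : ℕ → ℝ := fun r => (r : ℝ) ^ γ / N * G.amplitude r p
  have ha0 : ∀ r, 0 ≤ a r := fun r => by
    have := G.amplitude_nonneg r h0 h1
    simp only [a]
    positivity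
  have hterm : ∀ r : ℕ, (((r : ℝ) ^ γ / N : ℝ) : ℂ) * G.twoPointTerm r p =
      ((prefactor n : ℂ) * G.tree.sign) * (a r : ℂ) := by
    intro r
    rw [G.twoPointTerm_eq]
    simp only [a]
    push_cast
    ring
  have hne : (prefactor n : ℂ) * G.tree.sign ≠ 0 := by
    rw [← norm_ne_zero_iff, norm_mul, norm_sign, Complex.norm_real, Real.norm_of_nonneg hpre.le]
    simpa using hpre.ne'
  have ha : Summable a := by
    rw [funext hterm, summable_mul_left_iff hne] at hsum
    exact_mod_cast hsum
  have hnorm : ‖G.sobolevTerm γ p‖ = prefactor n * ∑' r, a r := by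
    rw [Graph.sobolevTerm, funext hterm, tsum_mul_left, ← Complex.ofReal_tsum, norm_mul, norm_mul,
      norm_sign, Complex.norm_real, Complex.norm_real, Real.norm_of_nonneg hpre.le,
      Real.norm_of_nonneg (tsum_nonneg ha0), mul_one]
  have hexp : Real.exp (-(2 / N)) ≤ p := by
    have hx : 1 / N ≤ 1 / 2 := by
      have := one_sub_eq h1
      rw [← hNdef] at this
      linarith
    have hx0 : 0 < 1 / N := by positivity
    have h2 := Real.add_one_le_exp (2 / N)
    have e : (2 : ℝ) / N = 2 * (1 / N) := by ring
    have h3 : 1 ≤ p * (2 / N + 1) := by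
      rw [one_sub_eq h1, ← hNdef, e]
      nlinarith
    rw [Real.exp_neg, inv_le_iff_one_le_mul₀ (Real.exp_pos _)]
    exact h3.trans (mul_le_mul_of_nonneg_left h2 h0.le)
  -- There are at least `N` values of `r` in this window, on which `p ^ r` is bounded below.
  have hlow : ∀ r ∈ Finset.Ico ⌈N⌉₊ (2 * ⌈N⌉₊),
      N ^ γ / N * (Real.exp (-(8 * M)) / (2 * (n : ℝ) + 1) ^ n) ≤ a r := by
    intro r hr
    rw [Finset.mem_Ico] at hr
    have hr1 : N ≤ r := (Nat.le_ceil N).trans (by exact_mod_cast hr.1)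
    have hr2 : (r : ℝ) ≤ 4 * N := by
      have h2 : (r : ℝ) ≤ 2 * (⌈N⌉₊ : ℝ) := by exact_mod_cast hr.2.le
      have h3 := (Nat.ceil_lt_add_one hN.le).le
      linarith
    have h2 : Real.exp (-(8 * M)) ≤ p ^ (M * r) := by
      refine le_trans ?_ (pow_le_pow_left₀ (Real.exp_pos _).le hexp _)
      rw [← Real.exp_nat_mul]
      refine Real.exp_le_exp.2 ?_
      push_cast
      have h3 : (M : ℝ) * r * (2 / N) ≤ M * (4 * N) * (2 / N) := by gcongr
      have h4 : (M : ℝ) * (4 * N) * (2 / N) = 8 * M := by field_simp; ring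
      linarith
    have h3 := hG.le_amplitude r h0 h1
    simp only [a]
    have h5 : Real.exp (-(8 * M)) / (2 * (n : ℝ) + 1) ^ n ≤ G.amplitude r p := by
      refine le_trans ?_ h3
      gcongr
    gcongr
  have hsumlow := Finset.sum_le_sum hlow
  rw [Finset.sum_const, Nat.card_Ico, nsmul_eq_mul] at hsumlow
  have hcard : 2 * ⌈N⌉₊ - ⌈N⌉₊ = ⌈N⌉₊ := by omega
  rw [hcard] at hsumlow
  have htot := ha.sum_le_tsum (Finset.Ico ⌈N⌉₊ (2 * ⌈N⌉₊)) fun r _ => ha0 r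
  rw [hnorm]
  calc prefactor n * (Real.exp (-(8 * M)) / (2 * (n : ℝ) + 1) ^ n) * N ^ γ
      = prefactor n * (N * (N ^ γ / N * (Real.exp (-(8 * M)) / (2 * (n : ℝ) + 1) ^ n))) := by
        field_simp
    _ ≤ prefactor n * (⌈N⌉₊ * (N ^ γ / N * (Real.exp (-(8 * M)) / (2 * (n : ℝ) + 1) ^ n))) := by
        have := Nat.le_ceil N
        gcongr
    _ ≤ _ := mul_le_mul_of_nonneg_left (hsumlow.trans htot) hpre.le

theorem IsMelonic.sobolevTerm_isTheta {n : ℕ} {G : Graph n} (hG : IsMelonic G) {γ : ℝ}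
    (hγ : 0 ≤ γ) :
    (fun p : ℝ => G.sobolevTerm γ p) =Θ[𝓝[<] 1] fun p : ℝ => modeNumber p ^ γ := by
  constructor
  · have := G.sobolevTerm_isBigO hγ
    rw [hG.degree_eq_zero] at this
    simpa using this
  · obtain ⟨c, hc, hle⟩ := hG.exists_le_sobolev hγ
    refine IsBigO.of_bound c⁻¹ ?_
    filter_upwards [eventually_mem_Ioo] with p hp
    have hN := modeNumber_pos hp.2
    rw [Real.norm_of_nonneg (by positivity), ← div_eq_inv_mul, le_div_iff₀ hc, mul_comm]
    exact hle p hp.1 hp.2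

theorem modeNumber_rpow_isBigO {a b : ℝ} (hab : a ≤ b) :
    (fun p : ℝ => modeNumber p ^ a) =O[𝓝[<] 1] fun p : ℝ => modeNumber p ^ b := by
  refine IsBigO.of_bound 1 ?_
  filter_upwards [eventually_mem_Ioo] with p hp
  have hN := modeNumber_pos hp.2
  rw [Real.norm_of_nonneg (by positivity), Real.norm_of_nonneg (by positivity), one_mul]
  exact Real.rpow_le_rpow_of_exponent_le (one_le_modeNumber (by linarith [hp.1]) hp.2) hab

theorem modeNumber_rpow_not_isBigO {a b : ℝ} (hab : a < b) :
    ¬ (fun p : ℝ => modeNumber p ^ b) =O[𝓝[<] 1] fun p : ℝ => modeNumber p ^ a := by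
  intro h
  obtain ⟨C, hC⟩ := h.bound
  have ht : Tendsto (fun p => modeNumber p ^ (b - a)) (𝓝[<] 1) atTop :=
    (tendsto_rpow_atTop (by linarith)).comp tendsto_modeNumber
  obtain ⟨p, ⟨h1, h2⟩, h3⟩ := ((hC.and (ht.eventually_gt_atTop C)).and eventually_mem_Ioo).exists
  have hN := modeNumber_pos h3.2
  rw [Real.norm_of_nonneg (by positivity), Real.norm_of_nonneg (by positivity)] at h1
  rw [Real.rpow_sub hN, lt_div_iff₀ (by positivity)] at h2
  linarith

theorem Graph.one_le_degree {n : ℕ} {G : Graph n} (hG : ¬ IsMelonic G) : 1 ≤ G.degree := by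
  have h1 := G.degree_nonneg
  have h2 : G.degree ≠ 0 := fun h => hG (G.isMelonic_of_degree_eq_zero h)
  omega

/-- Dominance is only informative in comparison with a melonic graph, and there is one of each
even order. -/
theorem Graph.isDominant_iff {n : ℕ} (G : Graph n) {γ : ℝ} (hγ : 0 ≤ γ) :
    G.IsDominant γ ↔ IsMelonic G := by
  constructor
  · intro hdom
    by_contra hG
    have hd : (1 : ℝ) ≤ G.degree := by exact_mod_cast Graph.one_le_degree hG
    obtain ⟨H, hH⟩ := exists_isMelonic G.even_order
    have h1 := (hH.sobolevTerm_isTheta hγ).2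
    have h2 := (h1.trans (hdom H)).trans (G.sobolevTerm_isBigO hγ)
    exact modeNumber_rpow_not_isBigO (by linarith) h2
  · intro hG H
    have hd : (0 : ℝ) ≤ H.degree := by exact_mod_cast H.degree_nonneg
    exact ((H.sobolevTerm_isBigO hγ).trans (modeNumber_rpow_isBigO (by linarith))).trans
      (hG.sobolevTerm_isTheta hγ).2

theorem sobolevCoeff_sub_isBigO {γ : ℝ} (hγ : 0 ≤ γ) (n : ℕ) :
    (fun p : ℝ => sobolevCoeff γ p n - meloSobolevCoeff γ p n) =O[𝓝[<] 1]
      fun p : ℝ => modeNumber p ^ (γ - 1) := by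
  classical
  have h1 : ∀ p : ℝ, sobolevCoeff γ p n - meloSobolevCoeff γ p n =
      ∑ G ∈ Finset.univ.filter (fun G : Graph n => ¬ IsMelonic G), G.sobolevTerm γ p := by
    intro p
    rw [sobolevCoeff, meloSobolevCoeff,
      ← Finset.sum_filter_add_sum_filter_not Finset.univ (fun G : Graph n => IsMelonic G),
      sub_eq_iff_eq_add, add_comm]
  simp only [h1]
  refine IsBigO.fun_sum fun G hG => ?_
  have hG' : ¬ IsMelonic G := (Finset.mem_filter.1 hG).2
  have hd : (1 : ℝ) ≤ G.degree := by exact_mod_cast Graph.one_le_degree hG'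
  exact (G.sobolevTerm_isBigO hγ).trans (modeNumber_rpow_isBigO (by linarith))

/-! ### Analyticity of the melonic approximation -/

theorem norm_meloTwoPointCoeff_le {K : ℝ} (hK : ∀ n : ℕ,
    (Nat.card {G : Graph n // IsMelonic G} : ℝ) ≤ K ^ n * (n.factorial : ℝ)) (r : ℕ) {p : ℝ}
    (h0 : 0 < p) (h1 : p < 1) (n : ℕ) :
    ‖meloTwoPointCoeff r p n‖ ≤ (2 * K / Real.sqrt 8) ^ n * p ^ ((r : ℝ) / 2) := by
  classical
  have hpre := prefactor_pos n
  have hterm : ∀ G ∈ Finset.univ.filter (fun G : Graph n => IsMelonic G),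
      ‖G.twoPointTerm r p‖ ≤ prefactor n * 2 ^ n * p ^ ((r : ℝ) / 2) := by
    intro G hG
    have hG' : IsMelonic G := (Finset.mem_filter.1 hG).2
    have := G.norm_twoPointTerm_le r h0 h1
    rwa [hG'.degree_eq_zero, neg_zero, zpow_zero, mul_one] at this
  have h2 := (norm_sum_le _ _).trans (Finset.sum_le_card_nsmul _ _ _ hterm)
  have hcard : (Finset.univ.filter (fun G : Graph n => IsMelonic G)).card =
      Nat.card {G : Graph n // IsMelonic G} := by
    rw [Nat.subtype_card]
    simp
  rw [hcard, nsmul_eq_mul] at h2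
  have h3 : ‖meloTwoPointCoeff r p n‖ ≤ (Nat.card {G : Graph n // IsMelonic G} : ℝ) *
      (prefactor n * 2 ^ n * p ^ ((r : ℝ) / 2)) := by
    refine le_trans (le_of_eq ?_) h2
    rw [meloTwoPointCoeff]
  refine h3.trans ((mul_le_mul_of_nonneg_right (hK n) (by positivity)).trans_eq ?_)
  rw [prefactor, div_pow, mul_pow]
  field_simp

theorem meloSobolevCoeff_eq {γ p : ℝ} (hγ : 0 ≤ γ) (h0 : 0 < p) (h1 : p < 1) (n : ℕ) :
    meloSobolevCoeff γ p n =
      ∑' r : ℕ, (((r : ℝ) ^ γ / modeNumber p : ℝ) : ℂ) * meloTwoPointCoeff r p n := by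
  classical
  simp only [meloSobolevCoeff, meloTwoPointCoeff, Finset.mul_sum]
  rw [Summable.tsum_finsetSum fun G _ => G.summable_sobolev hγ h0 h1]
  rfl

/-- The factorial in the number of melonic graphs cancels the one in the prefactor, so that the
double series over `r` and the order converges absolutely, dominated by a product of two
convergent series. -/
theorem exists_radius {K : ℝ} (hK0 : 0 < K) (hK : ∀ n : ℕ,
    (Nat.card {G : Graph n // IsMelonic G} : ℝ) ≤ K ^ n * (n.factorial : ℝ)) :
    ∃ ρ : ℝ, 0 < ρ ∧ ∀ (γ p : ℝ), 0 ≤ γ → 0 < p → p < 1 →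
      (∀ t : ℂ, ‖t‖ < ρ →
        (∀ r : ℕ, Summable fun m : ℕ => meloTwoPointCoeff r p (2 * m) * t ^ (2 * m)) ∧
        (Summable fun r : ℕ =>
          (((r : ℝ) ^ γ / modeNumber p : ℝ) : ℂ) * meloTwoPoint r p t) ∧
        HasSum (fun m : ℕ => meloSobolevCoeff γ p (2 * m) * t ^ (2 * m)) (meloSobolev γ p t)) ∧
      AnalyticOnNhd ℂ (meloSobolev γ p) (Metric.ball 0 ρ) := by
  set κ : ℝ := 2 * K / Real.sqrt 8 with hκ
  have hκ0 : 0 < κ := by positivity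
  refine ⟨1 / (2 * κ), by positivity, fun γ p hγ h0 h1 => ?_⟩
  have hN := modeNumber_pos h1
  obtain ⟨C, -, hC⟩ := exists_sobolev_bound hγ
  have hS := (hC p h0 h1).1
  set w : ℕ → ℝ := fun r => (r : ℝ) ^ γ / modeNumber p * p ^ ((r : ℝ) / 2) with hw
  have hgeo : Summable fun m : ℕ => (1 / 4 : ℝ) ^ m :=
    summable_geometric_of_lt_one (by norm_num) (by norm_num)
  have hκt : ∀ t : ℂ, ‖t‖ < 1 / (2 * κ) → ∀ m : ℕ, κ ^ (2 * m) * ‖t‖ ^ (2 * m) ≤ (1 / 4) ^ m := by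
    intro t ht m
    have h2 : κ * ‖t‖ ≤ 1 / 2 := by
      rw [lt_div_iff₀ (by positivity)] at ht
      linarith
    rw [← mul_pow, pow_mul]
    refine pow_le_pow_left₀ (by positivity) ?_ m
    have := pow_le_pow_left₀ (by positivity) h2 2
    norm_num at this ⊢
    exact this
  have hterm : ∀ t : ℂ, ‖t‖ < 1 / (2 * κ) → ∀ r m : ℕ,
      ‖meloTwoPointCoeff r p (2 * m) * t ^ (2 * m)‖ ≤ (1 / 4) ^ m * p ^ ((r : ℝ) / 2) := by
    intro t ht r m
    rw [norm_mul, norm_pow]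
    calc _ ≤ κ ^ (2 * m) * p ^ ((r : ℝ) / 2) * ‖t‖ ^ (2 * m) := by
          gcongr
          exact norm_meloTwoPointCoeff_le hK r h0 h1 (2 * m)
      _ = κ ^ (2 * m) * ‖t‖ ^ (2 * m) * p ^ ((r : ℝ) / 2) := by ring
      _ ≤ _ := by
          gcongr
          exact hκt t ht m
  have hpoint : ∀ t : ℂ, ‖t‖ < 1 / (2 * κ) →
      (∀ r : ℕ, Summable fun m : ℕ => meloTwoPointCoeff r p (2 * m) * t ^ (2 * m)) ∧
      (Summable fun r : ℕ => (((r : ℝ) ^ γ / modeNumber p : ℝ) : ℂ) * meloTwoPoint r p t) ∧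
      HasSum (fun m : ℕ => meloSobolevCoeff γ p (2 * m) * t ^ (2 * m)) (meloSobolev γ p t) := by
    intro t ht
    have hsum1 : ∀ r : ℕ, Summable fun m : ℕ => meloTwoPointCoeff r p (2 * m) * t ^ (2 * m) :=
      fun r => Summable.of_norm_bounded (hgeo.mul_right _) (hterm t ht r)
    let Φ : ℕ × ℕ → ℂ := fun z => (((z.1 : ℝ) ^ γ / modeNumber p : ℝ) : ℂ) *
      (meloTwoPointCoeff z.1 p (2 * z.2) * t ^ (2 * z.2))
    have hΦ : Summable Φ := by
      refine Summable.of_norm_bounded (hS.mul_of_nonneg hgeo (fun r => by simp only [w]; positivity)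
        (fun m => by positivity)) fun z => ?_
      refine (Graph.norm_weight_mul_le h1 z.1 (hterm t ht z.1 z.2)).trans_eq ?_
      simp only [w]
      ring
    have hrow : ∀ r : ℕ, HasSum (fun m => Φ (r, m))
        ((((r : ℝ) ^ γ / modeNumber p : ℝ) : ℂ) * meloTwoPoint r p t) :=
      fun r => (hsum1 r).hasSum.mul_left _
    have htot := hΦ.hasSum.prod_fiberwise hrow
    have hcol : ∀ m : ℕ, HasSum (fun r => Φ (r, m))
        (meloSobolevCoeff γ p (2 * m) * t ^ (2 * m)) := by
      intro m
      have h2 : Summable fun r => Φ (r, m) := hΦ.prod_symm.prod_factor m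
      have h3 : ∑' r, Φ (r, m) = meloSobolevCoeff γ p (2 * m) * t ^ (2 * m) := by
        rw [meloSobolevCoeff_eq hγ h0 h1, ← tsum_mul_right]
        exact tsum_congr fun r => (mul_assoc _ _ _).symm
      rw [← h3]
      exact h2.hasSum
    have htot' := ((Equiv.prodComm ℕ ℕ).hasSum_iff.2 hΦ.hasSum).prod_fiberwise hcol
    refine ⟨hsum1, htot.summable, ?_⟩
    have e : meloSobolev γ p t = ∑' z, Φ z := htot.tsum_eq
    rw [e]
    exact htot'
  refine ⟨hpoint, ?_⟩
  have hcoeff : ∀ m, ‖meloSobolevCoeff γ p (2 * m)‖ ≤ κ ^ (2 * m) * ∑' r, w r := by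
    intro m
    rw [meloSobolevCoeff_eq hγ h0 h1]
    exact tsum_of_norm_bounded (hS.hasSum.mul_left _) fun r =>
      Graph.norm_weight_mul_le h1 r (norm_meloTwoPointCoeff_le hK r h0 h1 (2 * m))
  have hw0 : 0 ≤ ∑' r, w r := tsum_nonneg fun r => by simp only [w]; positivity
  have hdiff : DifferentiableOn ℂ
      (fun t => ∑' m : ℕ, meloSobolevCoeff γ p (2 * m) * t ^ (2 * m))
      (Metric.ball 0 (1 / (2 * κ))) := by
    refine Complex.differentiableOn_tsum_of_summable_norm (hgeo.mul_right (∑' r, w r))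
      (fun m => by fun_prop) Metric.isOpen_ball fun m t ht => ?_
    rw [mem_ball_zero_iff] at ht
    rw [norm_mul, norm_pow]
    calc _ ≤ κ ^ (2 * m) * (∑' r, w r) * ‖t‖ ^ (2 * m) := by
          gcongr
          exact hcoeff m
      _ = κ ^ (2 * m) * ‖t‖ ^ (2 * m) * ∑' r, w r := by ring
      _ ≤ _ := by
          gcongr
          exact hκt t ht m
  have hcongr : DifferentiableOn ℂ (meloSobolev γ p) (Metric.ball 0 (1 / (2 * κ))) :=
    hdiff.congr fun t ht => ((hpoint t (mem_ball_zero_iff.1 ht)).2.2.tsum_eq).symm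
  exact hcongr.analyticOnNhd Metric.isOpen_ball

end MelonicTurbulence

theorem theorem1 :
    -- the degree is nonnegative and vanishes exactly on the melonic graphs
    (∀ (n : ℕ) (G : MelonicTurbulence.Graph n),
      0 ≤ G.degree ∧
      (MelonicTurbulence.IsMelonic G → G.degree = 0) ∧
      (¬ MelonicTurbulence.IsMelonic G → 0 < G.degree)) ∧
    -- amplitudes are finite, and at fixed root momentum they scale at most as `N ^ (-d)`
    (∀ (n : ℕ) (G : MelonicTurbulence.Graph n) (r : ℕ),
      (∀ p : ℝ, 0 < p → p < 1 →
        Summable fun m : {m : Fin n → MelonicTurbulence.Momentum // G.Admissible r m} =>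
          G.weight r p m.1) ∧
      (fun p : ℝ => G.amplitude r p) =O[𝓝[<] 1]
        fun p : ℝ => MelonicTurbulence.modeNumber p ^ (-G.degree)) ∧
    -- amplitudes of melonic graphs are of order `1`, with an exponential upper bound
    (∀ (n : ℕ) (G : MelonicTurbulence.Graph n), MelonicTurbulence.IsMelonic G →
      ∀ (r : ℕ) (p : ℝ), 0 < p → p < 1 →
        p ^ ((2 * n + 1) * r) / (2 * (n : ℝ) + 1) ^ n ≤ G.amplitude r p ∧
        G.amplitude r p ≤ 4 ^ n * p ^ ((r : ℝ) / 2)) ∧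
    -- the graphs that dominate the averaged Sobolev norm are exactly the melonic graphs
    (∀ (γ : ℝ), 0 ≤ γ → ∀ (n : ℕ) (G : MelonicTurbulence.Graph n),
      (∀ p : ℝ, 0 < p → p < 1 →
        Summable fun r : ℕ =>
          (((r : ℝ) ^ γ / MelonicTurbulence.modeNumber p : ℝ) : ℂ) * G.twoPointTerm r p) ∧
      (fun p : ℝ => G.sobolevTerm γ p) =O[𝓝[<] 1]
        (fun p : ℝ => MelonicTurbulence.modeNumber p ^ (γ - (G.degree : ℝ))) ∧
      (MelonicTurbulence.IsMelonic G →
        (fun p : ℝ => G.sobolevTerm γ p) =Θ[𝓝[<] 1]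
          fun p : ℝ => MelonicTurbulence.modeNumber p ^ γ) ∧
      (G.IsDominant γ ↔ MelonicTurbulence.IsMelonic G)) ∧
    -- order by order, the melonic approximation is correct up to a relative error `O(1 / N)`
    (∀ (γ : ℝ), 0 ≤ γ → ∀ n : ℕ,
      (fun p : ℝ => MelonicTurbulence.sobolevCoeff γ p n -
          MelonicTurbulence.meloSobolevCoeff γ p n) =O[𝓝[<] 1]
        fun p : ℝ => MelonicTurbulence.modeNumber p ^ (γ - 1)) ∧
    -- the number of melonic graphs is at most `K ^ n * n!`
    (∃ K : ℝ, ∀ n : ℕ,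
      (Nat.card {G : MelonicTurbulence.Graph n // MelonicTurbulence.IsMelonic G} : ℝ) ≤
        K ^ n * (n.factorial : ℝ)) ∧
    -- the melonic approximation is analytic in a disk
    (∃ ρ : ℝ, 0 < ρ ∧ ∀ (γ p : ℝ), 0 ≤ γ → 0 < p → p < 1 →
      (∀ t : ℂ, ‖t‖ < ρ →
        (∀ r : ℕ, Summable fun m : ℕ =>
          MelonicTurbulence.meloTwoPointCoeff r p (2 * m) * t ^ (2 * m)) ∧
        (Summable fun r : ℕ =>
          (((r : ℝ) ^ γ / MelonicTurbulence.modeNumber p : ℝ) : ℂ) *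
            MelonicTurbulence.meloTwoPoint r p t) ∧
        HasSum (fun m : ℕ => MelonicTurbulence.meloSobolevCoeff γ p (2 * m) * t ^ (2 * m))
          (MelonicTurbulence.meloSobolev γ p t)) ∧
      AnalyticOnNhd ℂ (MelonicTurbulence.meloSobolev γ p) (Metric.ball 0 ρ)) := by
  refine ⟨fun n G => ⟨G.degree_nonneg, fun h => h.degree_eq_zero, fun h => ?_⟩,
    fun n G r => ⟨fun p h0 h1 => G.summable_weight r h0 h1, G.amplitude_isBigO r⟩,
    fun n G hG r p h0 h1 => ⟨hG.le_amplitude r h0 h1, ?_⟩,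
    fun γ hγ n G => ⟨fun p h0 h1 => G.summable_sobolev hγ h0 h1, G.sobolevTerm_isBigO hγ,
      fun h => h.sobolevTerm_isTheta hγ, G.isDominant_iff hγ⟩,
    fun γ hγ n => MelonicTurbulence.sobolevCoeff_sub_isBigO hγ n, ?_⟩
  · have := MelonicTurbulence.Graph.one_le_degree h
    omega
  · have h := (G.amplitude_bound r h0 h1).2
    rw [hG.degree_eq_zero, neg_zero, zpow_zero, mul_one] at h
    refine h.trans (mul_le_mul_of_nonneg_right ?_ (Real.rpow_nonneg h0.le _))
    exact pow_le_pow_left₀ (by norm_num) (by norm_num) n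
  · obtain ⟨K, hK0, hK⟩ := MelonicTurbulence.exists_card_isMelonic_le
    exact ⟨⟨K, hK⟩, MelonicTurbulence.exists_radius hK0 hK⟩
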